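/- Let $n\ge 2$, $\mathfrak g=\mathfrak{sl}(n+1,\mathbb C)$, and let $\mathfrak h\subset\mathfrak g$ be the Cartan subalgebra of diagonal matrices. For $0\le k\le n-1$ let $E_k$ and $F_k$ be the elementary matrices $E_{k+1,k+2}$ and $E_{k+2,k+1}$. For $0\le j\le n-1$ let $\mathfrak l_j$ be the maximal standard Levi subalgebra of $\mathfrak g$ generated as a Lie algebra by $\mathfrak h$ and the $E_k,F_k$ with $k\ne j$. A weight module is a finitely generated $\mathfrak g$-module $V$ that is the direct sum of its weight spaces $V_\lambda$ ($\lambda\in\mathfrak h^*$), all of finite dimension. Its degree is $\sup_\lambda\dim V_\lambda$. Its contragredient is $\bigoplus_\lambda V_\lambda^*\subset V^*$ with the action $(Xf)(v)=-f(Xv)$. A $\mathfrak g$-module is a $(\mathfrak g,\mathfrak l_j)$-module of finite type if, as an $\mathfrak l_j$-module, it is a direct sum of simple finite-dimensional $\mathfrak l_j$-modules with finite multiplicities. For $b\in\mathbb C^{n+1}$ let $N(b)$ be the $\mathfrak g$-module with basis the symbols $x(c)$, where $c\in b+\mathbb Z^{n+1}$, $\sum_i c_i=\sum_i b_i$, and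 for every $i$ the number $c_i$ is a negative integer if and only if $b_i$ is one. The elementary matrix $E_{i,k}$ ($1\le i\neq k\le n+1$) acts by $x(c)\mapsto c_k\,x(c-\epsilon_k+\epsilon_i)$, where the right-hand side is read as $0$ if $c-\epsilon_k+\epsilon_i$ is not the index of a basis vector. A diagonal matrix $\mathrm{diag}(d_1,\dots,d_{n+1})\in\mathfrak h$ acts by $x(c)\mapsto(\sum_i d_ic_i)\,x(c)$. Fix $0\le j\le n-1$. Let $V$ be a simple infinite-dimensional weight $\mathfrak g$-module of degree $1$ which is a $(\mathfrak g,\mathfrak l_j)$-module of finite type. Then $V$ or its contragredient is isomorphic to one of the following modules (all parameter vectors have $n+1$ entries). 1. If $j=0$: $N(a,0,\dots,0)$ for some $a\in\mathbb C\setminus\mathbb Z_{\ge0}$, or $N(-1,m,0,\dots,0)$ for some $m\in\mathbb Z_{\ge0}$. 2. If $j=n-1$: $N(-1,\dots,-1,a)$ for some $a\in\mathbb C\setminus\mathbb Z_{<0}$, or $N(-1,\dots,-1,-1-m,0)$ for some $m\in\mathbb Z_{\ge0}$. 3. If $0<j<n-1$: $N(\underbrace{-1,\dots,-1}_{j+1},m,0,\dots,0)$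 or $N(\underbrace{-1,\dots,-1}_{j},-1-m,0,\dots,0)$ for some $m\in\mathbb Z_{\ge0}$. Conversely, every module listed for $j$, and its contragredient, is a simple infinite-dimensional weight $\mathfrak g$-module of degree $1$ and a $(\mathfrak g,\mathfrak l_j)$-module of finite type. -/

import Mathlib

noncomputable section

namespace SlDegreeOne

/-! ### `sl(n+1, ℂ)`, its Cartan subalgebra and its maximal standard Levi subalgebras -/

/-- The Lie algebra `sl(n+1, ℂ)` of traceless matrices of size `n + 1`. -/
abbrev sl (n : ℕ) := LieAlgebra.SpecialLinear.sl (Fin (n + 1)) ℂ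

theorem sl_bracket_val {n : ℕ} (X Y : sl n) :
    (⁅X, Y⁆ : sl n).val = X.val * Y.val - Y.val * X.val := rfl

/-- The standard Cartan subalgebra of `sl(n+1, ℂ)`: the diagonal traceless matrices. -/
def cartan (n : ℕ) : LieSubalgebra ℂ (sl n) where
  carrier := {X | X.val.IsDiag}
  add_mem' hX hY := Matrix.IsDiag.add hX hY
  zero_mem' := Matrix.isDiag_zero
  smul_mem' c _ hX := Matrix.IsDiag.smul c hX
  lie_mem' := by
    intro X Y hX hY
    obtain ⟨d, hd⟩ : ∃ d, X.val = Matrix.diagonal d := ⟨_, hX.diagonal_diag.symm⟩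
    obtain ⟨e, he⟩ : ∃ e, Y.val = Matrix.diagonal e := ⟨_, hY.diagonal_diag.symm⟩
    show (⁅X, Y⁆ : sl n).val.IsDiag
    rw [sl_bracket_val, hd, he, Matrix.diagonal_mul_diagonal, Matrix.diagonal_mul_diagonal]
    exact (Matrix.isDiag_diagonal _).sub (Matrix.isDiag_diagonal _)

/-- The Chevalley generator `E_k`, `0 ≤ k ≤ n - 1`: the matrix unit whose nonzero entry is in row
`k` and column `k + 1` (rows and columns being numbered from `0` to `n`). -/
def generatorE {n : ℕ} (k : Fin n) : sl n :=
  LieAlgebra.SpecialLinear.single k.castSucc k.succ (Fin.castSucc_lt_succ (i := k)).ne 1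

/-- The Chevalley generator `F_k`, `0 ≤ k ≤ n - 1`: the matrix unit whose nonzero entry is in row
`k + 1` and column `k` (rows and columns being numbered from `0` to `n`). -/
def generatorF {n : ℕ} (k : Fin n) : sl n :=
  LieAlgebra.SpecialLinear.single k.succ k.castSucc (Fin.castSucc_lt_succ (i := k)).ne' 1

/-- The maximal standard Levi subalgebra `l_j`, Lie-generated by the Cartan subalgebra and all
`E_k`, `F_k` with `k ≠ j`. -/
def levi {n : ℕ} (j : Fin n) : LieSubalgebra ℂ (sl n) :=
  LieSubalgebra.lieSpan ℂ (sl n)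
    ((cartan n : Set (sl n)) ∪ ⋃ k ∈ {k : Fin n | k ≠ j}, {generatorE k, generatorF k})

/-! ### Weight modules, degree, modules of finite type -/

section Modules

variable (n : ℕ) (V : Type*) [AddCommGroup V] [Module ℂ V] [LieRingModule (sl n) V]
  [LieModule ℂ (sl n) V]

/-- The weight space of weight `μ ∈ h^*`, where `h` is the Cartan subalgebra. -/
abbrev wtSpace (μ : Module.Dual ℂ (cartan n)) : LieSubmodule ℂ (cartan n) V :=
  LieModule.weightSpace V μ

open Classical in
/-- Weight modules: finitely generated, the direct sum of their weight spaces, and with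
finite-dimensional weight spaces. -/
structure IsWeightModule : Prop where
  finitelyGenerated : ∃ s : Finset V, LieSubmodule.lieSpan ℂ (sl n) (s : Set V) = ⊤
  isInternal : DirectSum.IsInternal fun μ : Module.Dual ℂ (cartan n) => (wtSpace n V μ).toSubmodule
  finiteDimensional : ∀ μ : Module.Dual ℂ (cartan n), FiniteDimensional ℂ (wtSpace n V μ)

/-- The degree: the supremum of the dimensions of the weight spaces. -/
def degree : ℕ∞ :=
  ⨆ μ : Module.Dual ℂ (cartan n), Cardinal.toENat (Module.rank ℂ (wtSpace n V μ))

variable {n} in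
open Classical in
/-- `(g, l)`-modules of finite type, `g = sl(n+1, ℂ)`: as an `l`-module, `V` is the direct sum of a
family `S` of simple finite-dimensional submodules, each isomorphism class of which occurs only
finitely often. -/
def IsFiniteType (l : LieSubalgebra ℂ (sl n)) : Prop :=
  ∃ S : Set (LieSubmodule ℂ l V),
    DirectSum.IsInternal (fun W : S => W.val.toSubmodule) ∧
    (∀ W ∈ S, LieModule.IsIrreducible ℂ l W ∧ FiniteDimensional ℂ W) ∧
    ∀ W ∈ S, {W' ∈ S | Nonempty (W' ≃ₗ⁅ℂ,l⁆ W)}.Finite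

variable {n} in
/-- Simple infinite-dimensional `(g, l_j)`-modules of finite type which are weight modules of
degree `1`. -/
structure IsSimpleFiniteTypeDegreeOne (j : Fin n) : Prop where
  simple : LieModule.IsIrreducible ℂ (sl n) V
  infiniteDimensional : ¬ FiniteDimensional ℂ V
  finiteType : IsFiniteType V (levi j)
  weightModule : IsWeightModule n V
  degree_eq_one : degree n V = 1

end Modules

/-! ### The contragredient module -/

section Contragredient

variable {n : ℕ}

/-- The weight `ε_a - ε_b`. -/
def rootWeight (a b : Fin (n + 1)) : Module.Dual ℂ (cartan n) where
  toFun H := H.val.val a a - H.val.val b b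
  map_add' H K := by
    show (H.val.val a a + K.val.val a a) - (H.val.val b b + K.val.val b b) = _
    ring
  map_smul' c H := by
    show c * H.val.val a a - c * H.val.val b b = c * (H.val.val a a - H.val.val b b)
    ring

variable {V : Type*} [AddCommGroup V] [Module ℂ V] [LieRingModule (sl n) V]
  [LieModule ℂ (sl n) V]

theorem cartan_lie_single (H : cartan n) (a b : Fin (n + 1)) (h : a ≠ b) (c : ℂ) :
    ⁅H.val, LieAlgebra.SpecialLinear.single a b h c⁆
      = rootWeight a b H • LieAlgebra.SpecialLinear.single a b h c := by
  obtain ⟨d, hd⟩ : ∃ d, H.val.val = Matrix.diagonal d := ⟨_, H.prop.diagonal_diag.symm⟩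
  apply Subtype.ext
  show H.val.val * Matrix.single a b c - Matrix.single a b c * H.val.val
    = (H.val.val a a - H.val.val b b) • Matrix.single a b c
  rw [hd]
  ext p q
  simp only [Matrix.sub_apply, Matrix.diagonal_mul, Matrix.mul_diagonal, Matrix.smul_apply,
    Matrix.single_apply, Matrix.diagonal_apply_eq, smul_eq_mul]
  split_ifs with hpq
  · rw [hpq.1, hpq.2]; ring
  · ring

theorem single_lie_mem (μ : Module.Dual ℂ (cartan n)) {v : V} (hv : v ∈ wtSpace n V μ)
    (a b : Fin (n + 1)) (h : a ≠ b) (c : ℂ) :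
    ⁅(LieAlgebra.SpecialLinear.single a b h c : sl n), v⁆ ∈ wtSpace n V (μ + rootWeight a b) := by
  rw [LieModule.mem_weightSpace] at hv ⊢
  intro H
  have h1 : ⁅H.val, v⁆ = μ H • v := hv H
  show ⁅H.val, ⁅(LieAlgebra.SpecialLinear.single a b h c : sl n), v⁆⁆ = _
  rw [leibniz_lie, cartan_lie_single, h1, smul_lie, lie_smul, ← add_smul, add_comm]
  rfl

/-- The diagonal part of a traceless matrix is in the Cartan subalgebra. -/
theorem sub_offDiag_mem (X : sl n) :
    X - ∑ a, ∑ b, (if h : a ≠ b then LieAlgebra.SpecialLinear.single a b h (X.val a b) else 0)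
      ∈ cartan n := by
  intro p q hpq
  have h1 : ∀ Y : sl n, ∀ p q, (X - Y).val p q = X.val p q - Y.val p q := fun _ _ _ => rfl
  rw [h1, sub_eq_zero]
  let L : sl n →ₗ[ℂ] ℂ :=
    { toFun := fun Y => Y.val p q, map_add' := fun _ _ => rfl, map_smul' := fun _ _ => rfl }
  show _ = L _
  rw [map_sum]
  simp only [map_sum]
  have h2 : ∀ a b, L (if h : a ≠ b then LieAlgebra.SpecialLinear.single a b h (X.val a b) else 0)
      = if a = p ∧ b = q then X.val p q else 0 := by
    intro a b
    by_cases h : a ≠ b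
    · rw [dif_pos h]
      show Matrix.single a b (X.val a b) p q = _
      rw [Matrix.single_apply]
      split_ifs with hh
      · rw [hh.1, hh.2]
      · rfl
    · rw [dif_neg h, map_zero, if_neg]
      rintro ⟨rfl, rfl⟩
      exact h hpq
  simp only [h2, ite_and]
  simp

variable (n V) in
/-- The contragredient (restricted dual) `⨁ V_μ^*` of `V`: the submodule of the dual
representation formed by the linear forms that vanish on all but finitely many weight spaces, with
the action `(X f)(v) = -f(X v)`. -/
def contragredient : LieSubmodule ℂ (sl n) (Module.Dual ℂ V) where
  carrier := {f | {μ : Module.Dual ℂ (cartan n) | ∃ v ∈ wtSpace n V μ, f v ≠ 0}.Finite}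
  add_mem' := by
    intro f g hf hg
    refine (Set.Finite.union hf hg).subset ?_
    rintro μ ⟨v, hv, h⟩
    by_cases h0 : f v = 0
    · exact Or.inr ⟨v, hv, fun h1 => h (by simp [h0, h1])⟩
    · exact Or.inl ⟨v, hv, h0⟩
  zero_mem' := by simp
  smul_mem' := by
    intro c f hf
    refine Set.Finite.subset hf ?_
    rintro μ ⟨v, hv, h⟩
    exact ⟨v, hv, fun h1 => h (by simp [h1])⟩
  lie_mem := by
    intro X f hf
    have hf' : {μ : Module.Dual ℂ (cartan n) | ∃ v ∈ wtSpace n V μ, f v ≠ 0}.Finite := hf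
    refine (hf'.union (Set.finite_iUnion fun a : Fin (n + 1) => Set.finite_iUnion
      fun b : Fin (n + 1) => hf'.image fun μ => μ - rootWeight a b)).subset ?_
    rintro μ ⟨v, hv, h⟩
    by_contra hcon
    simp only [Set.mem_union, Set.mem_iUnion, Set.mem_image, Set.mem_ofPred_eq, not_or, not_exists,
      not_and, ne_eq, not_not] at hcon
    obtain ⟨hc1, hc2⟩ := hcon
    apply h
    rw [Module.Dual.lie_apply, neg_eq_zero]
    have hX : X = (⟨_, sub_offDiag_mem X⟩ : cartan n).val + ∑ a, ∑ b,
        (if h : a ≠ b then LieAlgebra.SpecialLinear.single a b h (X.val a b) else 0) :=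
      (sub_add_cancel _ _).symm
    have h1 : ∀ H : cartan n, f ⁅H.val, v⁆ = 0 := by
      intro H
      have h2 : ⁅H.val, v⁆ = μ H • v := (LieModule.mem_weightSpace _ _).1 hv H
      rw [h2, map_smul, hc1 v hv, smul_zero]
    rw [hX, add_lie, map_add, h1, zero_add, sum_lie, map_sum]
    refine Finset.sum_eq_zero fun a _ => ?_
    rw [sum_lie, map_sum]
    refine Finset.sum_eq_zero fun b _ => ?_
    by_cases hab : a ≠ b
    · rw [dif_pos hab]
      by_contra hne
      exact hc2 a b _ ⟨_, single_lie_mem μ hv a b hab _, hne⟩ (add_sub_cancel_right _ _)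
    · rw [dif_neg hab, zero_lie, map_zero]

end Contragredient

/-! ### The modules `N(b)` -/

section ModuleN

/-- The vector space with basis the monomials `x(c) = x_0^{c_0} ⋯ x_n^{c_n}`, `c ∈ ℂ^{n+1}`. -/
def Monomials (n : ℕ) : Type := (Fin (n + 1) → ℂ) →₀ ℂ

instance (n : ℕ) : AddCommGroup (Monomials n) :=
  inferInstanceAs (AddCommGroup ((Fin (n + 1) → ℂ) →₀ ℂ))

instance (n : ℕ) : Module ℂ (Monomials n) :=
  inferInstanceAs (Module ℂ ((Fin (n + 1) → ℂ) →₀ ℂ))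

variable {n : ℕ}

/-- The monomial `x(c)`. -/
def mon (c : Fin (n + 1) → ℂ) : Monomials n := Finsupp.single c 1

/-- The linear map with prescribed values on the monomials. -/
def monLift {W : Type*} [AddCommGroup W] [Module ℂ W] (f : (Fin (n + 1) → ℂ) → W) :
    Monomials n →ₗ[ℂ] W := Finsupp.linearCombination ℂ f

@[simp]
theorem monLift_mon {W : Type*} [AddCommGroup W] [Module ℂ W] (f : (Fin (n + 1) → ℂ) → W)
    (c : Fin (n + 1) → ℂ) : monLift f (mon c) = f c := by
  unfold monLift mon
  exact (Finsupp.linearCombination_single ℂ 1 c).trans (one_smul _ _)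

theorem mon_ext {W : Type*} [AddCommGroup W] [Module ℂ W] {f g : Monomials n →ₗ[ℂ] W}
    (h : ∀ c, f (mon c) = g (mon c)) : f = g :=
  Finsupp.lhom_ext' fun c => LinearMap.ext_ring (h c)

/-- The operator `q_i` ("multiplication by `x_i`") of the Weyl algebra:
`q_i x(c) = x(c + ε_i)`, except that `q_i x(c) = 0` if `c_i = -1`. -/
def opQ (i : Fin (n + 1)) : Module.End ℂ (Monomials n) :=
  monLift fun c => if c i = -1 then 0 else mon (c + Pi.single i 1)

/-- The operator `p_i` ("derivative with respect to `x_i`") of the Weyl algebra: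
`p_i x(c) = c_i x(c - ε_i)`. -/
def opP (i : Fin (n + 1)) : Module.End ℂ (Monomials n) :=
  monLift fun c => c i • mon (c - Pi.single i 1)

theorem opQ_mon (i : Fin (n + 1)) (c : Fin (n + 1) → ℂ) :
    opQ i (mon c) = if c i = -1 then 0 else mon (c + Pi.single i 1) := monLift_mon _ _

theorem opP_mon (i : Fin (n + 1)) (c : Fin (n + 1) → ℂ) :
    opP i (mon c) = c i • mon (c - Pi.single i 1) := monLift_mon _ _

theorem opQ_comm (i k : Fin (n + 1)) : opQ i * opQ k = opQ k * opQ i := by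
  rcases eq_or_ne i k with rfl | h
  · rfl
  refine mon_ext fun c => ?_
  simp only [Module.End.mul_apply, opQ_mon]
  split_ifs <;> simp_all [opQ_mon, h.symm, add_right_comm]

theorem opP_comm (i k : Fin (n + 1)) : opP i * opP k = opP k * opP i := by
  rcases eq_or_ne i k with rfl | h
  · rfl
  refine mon_ext fun c => ?_
  simp only [Module.End.mul_apply, opP_mon, map_smul, smul_smul]
  simp [h, h.symm, mul_comm, sub_right_comm]

/-- The canonical commutation relations. -/
theorem opP_opQ (j k : Fin (n + 1)) :
    opP j * opQ k = opQ k * opP j + if j = k then 1 else 0 := by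
  refine mon_ext fun c => ?_
  rcases eq_or_ne j k with rfl | h
  · simp only [Module.End.mul_apply, LinearMap.add_apply, opP_mon, opQ_mon, map_smul, if_true,
      Module.End.one_apply, Pi.sub_apply, Pi.single_eq_same, sub_add_cancel]
    by_cases h1 : c j = -1
    · simp [h1, show (-1 - 1 : ℂ) ≠ -1 by norm_num]
    · by_cases h0 : c j = 0
      · simp [h0, opP_mon]
      · have h2 : c j - 1 ≠ -1 := fun h => h0 (by linear_combination h)
        simp [h1, h2, opP_mon, add_smul]
  · simp only [Module.End.mul_apply, opP_mon, opQ_mon, map_smul, if_neg h, add_zero]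
    have h3 : (c - Pi.single j 1 : Fin (n + 1) → ℂ) k = c k := by simp [h.symm]
    rw [h3]
    split_ifs with h1
    · simp
    · rw [opP_mon]
      simp [h, sub_add_eq_add_sub]

/-- The action of `gl(n+1, ℂ)` in which the matrix unit with nonzero entry in row `i` and column
`k` acts as `q_i p_k`. -/
def glAct (X : Matrix (Fin (n + 1)) (Fin (n + 1)) ℂ) : Module.End ℂ (Monomials n) :=
  ∑ i, ∑ k, X i k • (opQ i * opP k)

theorem glAct_add (X Y : Matrix (Fin (n + 1)) (Fin (n + 1)) ℂ) :
    glAct (X + Y) = glAct X + glAct Y := by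
  simp [glAct, add_smul, Finset.sum_add_distrib]

theorem glAct_smul (t : ℂ) (X : Matrix (Fin (n + 1)) (Fin (n + 1)) ℂ) :
    glAct (t • X) = t • glAct X := by
  simp [glAct, mul_smul, Finset.smul_sum]

theorem glAct_sub (X Y : Matrix (Fin (n + 1)) (Fin (n + 1)) ℂ) :
    glAct (X - Y) = glAct X - glAct Y := by
  simp [glAct, sub_smul, Finset.sum_sub_distrib]

theorem glAct_mul (X Y : Matrix (Fin (n + 1)) (Fin (n + 1)) ℂ) :
    glAct X * glAct Y = glAct (X * Y) +
      ∑ i, ∑ j, ∑ k, ∑ l, (X i j * Y k l) • (opQ i * opQ k * opP j * opP l) := by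
  have key : ∀ i j k l : Fin (n + 1), (opQ i * opP j) * (opQ k * opP l)
      = (if j = k then opQ i * opP l else 0) + opQ i * opQ k * opP j * opP l := by
    intro i j k l
    rw [mul_assoc, ← mul_assoc (opP j), opP_opQ]
    split_ifs <;> simp [mul_assoc, add_mul, mul_add, add_comm]
  have h1 : glAct (X * Y) = ∑ i, ∑ j, ∑ k, ∑ l : Fin (n + 1),
      (X i j * Y k l) • (if j = k then opQ i * opP l else 0) := by
    simp only [glAct, Matrix.mul_apply, Finset.sum_smul]
    refine Finset.sum_congr rfl fun i _ => ?_
    rw [Finset.sum_comm]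
    refine Finset.sum_congr rfl fun j _ => ?_
    rw [Finset.sum_comm]
    refine Finset.sum_congr rfl fun l _ => ?_
    simp
  rw [h1]
  simp only [← Finset.sum_add_distrib, ← smul_add, ← key]
  unfold glAct
  rw [Finset.sum_mul]
  refine Finset.sum_congr rfl fun i _ => ?_
  rw [Finset.sum_mul]
  refine Finset.sum_congr rfl fun j _ => ?_
  rw [Finset.mul_sum]
  refine Finset.sum_congr rfl fun k _ => ?_
  rw [Finset.mul_sum]
  refine Finset.sum_congr rfl fun l _ => ?_
  rw [smul_mul_smul_comm]

theorem glAct_commutator (X Y : Matrix (Fin (n + 1)) (Fin (n + 1)) ℂ) :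
    glAct (X * Y - Y * X) = glAct X * glAct Y - glAct Y * glAct X := by
  have h : ∑ i, ∑ j, ∑ k, ∑ l, (X i j * Y k l) • (opQ i * opQ k * opP j * opP l)
      = ∑ i, ∑ j, ∑ k, ∑ l, (Y i j * X k l) • (opQ i * opQ k * opP j * opP l) := by
    calc _ = ∑ i, ∑ k, ∑ j, ∑ l, (X i j * Y k l) • (opQ i * opQ k * opP j * opP l) :=
          Finset.sum_congr rfl fun i _ => Finset.sum_comm
      _ = ∑ k, ∑ i, ∑ j, ∑ l, (X i j * Y k l) • (opQ i * opQ k * opP j * opP l) :=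
          Finset.sum_comm
      _ = ∑ k, ∑ i, ∑ l, ∑ j, (X i j * Y k l) • (opQ i * opQ k * opP j * opP l) :=
          Finset.sum_congr rfl fun k _ => Finset.sum_congr rfl fun i _ => Finset.sum_comm
      _ = ∑ k, ∑ l, ∑ i, ∑ j, (X i j * Y k l) • (opQ i * opQ k * opP j * opP l) :=
          Finset.sum_congr rfl fun k _ => Finset.sum_comm
      _ = _ := by
          refine Finset.sum_congr rfl fun k _ => Finset.sum_congr rfl fun l _ =>
            Finset.sum_congr rfl fun i _ => Finset.sum_congr rfl fun j _ => ?_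
          rw [opQ_comm i k, mul_assoc (opQ k * opQ i), opP_comm j l, ← mul_assoc, mul_comm]
  rw [glAct_sub, glAct_mul X Y, glAct_mul Y X, h, add_sub_add_right_eq_sub]

instance : LieRingModule (sl n) (Monomials n) where
  bracket X w := glAct X.val w
  add_lie X Y w := by
    show glAct (X.val + Y.val) w = _
    rw [glAct_add]
    rfl
  lie_add X w w' := map_add _ _ _
  leibniz_lie X Y w := by
    show glAct X.val (glAct Y.val w)
      = glAct (X.val * Y.val - Y.val * X.val) w + glAct Y.val (glAct X.val w)
    rw [glAct_commutator]
    simp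

instance : LieModule ℂ (sl n) (Monomials n) where
  smul_lie t X w := by
    show glAct (t • X.val) w = _
    rw [glAct_smul]
    rfl
  lie_smul t X w := map_smul _ _ _

/-- The complex number `z` is a negative integer. -/
def IsNegInt (z : ℂ) : Prop := ∃ m : ℕ, z = -(m + 1 : ℂ)

/-- The exponents of the monomials of `N(b)`: those `c ∈ b + ℤ^{n+1}` with `∑ c_i = ∑ b_i` and with
negative integers in the same positions as `b`. -/
def exponents (b : Fin (n + 1) → ℂ) : Set (Fin (n + 1) → ℂ) :=
  {c | (∀ i, ∃ z : ℤ, c i = b i + z) ∧ ∑ i, c i = ∑ i, b i ∧ ∀ i, IsNegInt (c i) ↔ IsNegInt (b i)}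

theorem isNegInt_add_one {z : ℂ} (h : z ≠ -1) : IsNegInt (z + 1) ↔ IsNegInt z := by
  constructor
  · rintro ⟨m, hm⟩
    exact ⟨m + 1, by push_cast; linear_combination hm⟩
  · rintro ⟨m, hm⟩
    rcases m with _ | m
    · exact absurd (by simpa using hm) h
    · exact ⟨m, by push_cast at hm; linear_combination hm⟩

theorem exponents_shift {b c : Fin (n + 1) → ℂ} (hc : c ∈ exponents b) {i k : Fin (n + 1)}
    (hk : c k ≠ 0) (hi : (c - Pi.single k 1 : Fin (n + 1) → ℂ) i ≠ -1) :
    c - Pi.single k 1 + Pi.single i 1 ∈ exponents b := by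
  obtain ⟨h1, h2, h3⟩ := hc
  refine ⟨fun l => ?_, ?_, fun l => ?_⟩
  · obtain ⟨z, hz⟩ := h1 l
    refine ⟨z - (if l = k then 1 else 0) + (if l = i then 1 else 0), ?_⟩
    simp only [Pi.add_apply, Pi.sub_apply, Pi.single_apply, hz]
    push_cast
    ring
  · simp [Finset.sum_add_distrib, Finset.sum_sub_distrib, h2]
  · have h4 : IsNegInt ((c - Pi.single k 1 : Fin (n + 1) → ℂ) l) ↔ IsNegInt (c l) := by
      rcases eq_or_ne l k with rfl | hl
      · rw [← isNegInt_add_one (z := (c - Pi.single l 1 : Fin (n + 1) → ℂ) l)]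
        · simp
        · simp only [Pi.sub_apply, Pi.single_eq_same]
          exact fun h => hk (by linear_combination h)
      · simp [hl]
    rw [← h3 l, ← h4]
    rcases eq_or_ne l i with rfl | hl
    · rw [Pi.add_apply, Pi.single_eq_same, isNegInt_add_one hi]
    · simp [Pi.single_apply, hl]

/-- The `sl(n+1, ℂ)`-module `N(b)`, `b ∈ ℂ^{n+1}`: the span of the monomials with exponents in
`exponents b`, the matrix unit in position `(i, k)` acting as `q_i p_k`, that is by
`x(c) ↦ c_k x(c - ε_k + ε_i)`, or `0` if this leaves `exponents b`. -/
def moduleN (b : Fin (n + 1) → ℂ) : LieSubmodule ℂ (sl n) (Monomials n) where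
  toSubmodule := Submodule.span ℂ (mon '' exponents b)
  lie_mem := by
    intro X w hw
    show glAct X.val w ∈ Submodule.span ℂ (mon '' exponents b)
    have hw' : w ∈ Submodule.span ℂ (mon '' exponents b) := hw
    induction hw' using Submodule.span_induction with
    | mem w h =>
      obtain ⟨c, hc, rfl⟩ := h
      simp only [glAct, LinearMap.sum_apply, LinearMap.smul_apply, Module.End.mul_apply]
      refine Submodule.sum_mem _ fun i _ => Submodule.sum_mem _ fun k _ =>
        Submodule.smul_mem _ _ ?_
      rw [opP_mon, map_smul, opQ_mon]
      by_cases hk : c k = 0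
      · simp [hk]
      · refine Submodule.smul_mem _ _ ?_
        split_ifs with hi
        · exact Submodule.zero_mem _
        · exact Submodule.subset_span ⟨_, exponents_shift hc hk hi, rfl⟩
    | zero => simp
    | add x y hx hy ihx ihy => rw [map_add]; exact Submodule.add_mem _ (ihx hx) (ihy hy)
    | smul t x hx ih => rw [map_smul]; exact Submodule.smul_mem _ _ (ih hx)

/-- The vector `(-1, …, -1, z, 0, …, 0) ∈ ℂ^{n+1}` with exactly `i` leading entries `-1`. -/
def param (n i : ℕ) (z : ℂ) : Fin (n + 1) → ℂ :=
  fun k => if k.val < i then -1 else if k.val = i then z else 0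

/-- The parameters `b` of the modules `N(b)` in the list attached to `l_j`, `0 ≤ j ≤ n - 1`. -/
def parameters {n : ℕ} (j : Fin n) : Set (Fin (n + 1) → ℂ) :=
  {b | (j.val = 0 ∧ ((∃ a : ℂ, (∀ m : ℕ, a ≠ m) ∧ b = param n 0 a) ∨
          ∃ m : ℕ, b = param n 1 m)) ∨
       (j.val = n - 1 ∧ ((∃ a : ℂ, ¬ IsNegInt a ∧ b = param n n a) ∨
          ∃ m : ℕ, b = param n (n - 1) (-1 - m))) ∨
       (0 < j.val ∧ j.val < n - 1 ∧
          ∃ m : ℕ, b = param n (j.val + 1) m ∨ b = param n j.val (-1 - m))}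

end ModuleN

/-- `V` or its contragredient is isomorphic to `N(b)`. -/
def IsNUpToContragredient {n : ℕ} (V : Type*) [AddCommGroup V] [Module ℂ V]
    [LieRingModule (sl n) V] [LieModule ℂ (sl n) V] (b : Fin (n + 1) → ℂ) : Prop :=
  Nonempty (V ≃ₗ⁅ℂ,sl n⁆ moduleN b) ∨ Nonempty (contragredient n V ≃ₗ⁅ℂ,sl n⁆ moduleN b)

end SlDegreeOne

end

open SlDegreeOne

/-! Let `gl(n+1)` act on `V` through its projection onto `sl(n+1)`, and split the indices into the
two blocks of `l_j`. In a simple module every root vector is either locally nilpotent or injective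
(`locNil_or_injective`). Finite type makes the root vectors inside the blocks locally nilpotent
(`locNil_of_isFiniteType`), so the set of weights is invariant under the reflections inside the
blocks (`occurs_swap`), and each of the two nilradicals acts uniformly: all its root vectors are
locally nilpotent or all are injective. They cannot all be injective on both sides: since `n ≥ 2`,
some block has two indices, and a root of that block is the sum of a root of each nilradical, so the
weights would continue for ever in a locally nilpotent direction (`locNil_dichotomy`). Hence `V` has
a highest weight vector for the standard order of the indices or for the reversed one. As `V` is
infinite-dimensional, the opposite nilradical acts injectively.

The highest weight is dominant on each block, and its difference across the break between the blocks
is not a natural number (`sub_ne_nat`). Degree one gives more: two lowering paths from the highest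
weight vector to the same weight must be proportional, and applying raising operators to that
proportionality yields equations for the weight (`exists_triple`, `not_plateau`, `sq_eq_one`). Up to
a constant vector, only the listed parameters survive (`exists_parameter`). In `N(b)` the monomial
`x(b)` is a highest weight vector of the same weight, and a simple highest weight module is
determined by its weight (`exists_equiv`). In the reversed order `V` is `N(b ∘ rev)`, whose
contragredient is `N(-1 - b ∘ rev)` (`isMonomialBasis_dualBasis`); this parameter is again in the
list for `j` (`reflect_rev_mem_parameters`).

For the converse, distinct monomials have distinct weights and are linked by nonzero coefficients,
which gives simplicity and degree one. Over `l_j` the module splits into the eigenspaces of the sum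
of the diagonal units of the first block. They are simple by the same linking inside blocks,
finite-dimensional because the exponents in a block with several entries are integers of one sign,
and pairwise non-isomorphic. These arguments use only a basis satisfying `IsMonomialBasis`, so they
cover `N(b)` and its contragredient at once. -/

namespace SlDegreeOne

/-! ### Root vectors on simple weight modules of degree one: nilpotence, injectivity, reflections.
-/

section GlAction

variable {ι : Type*} [DecidableEq ι] {V : Type*} [AddCommGroup V] [Module ℂ V]

/-- The commutation relations of the matrix units of `gl`. -/
def IsGl (e : ι → ι → Module.End ℂ V) : Prop :=
  ∀ i k l m v, e i k (e l m v)
    = e l m (e i k v) + (if k = l then e i m v else 0) - (if m = i then e l k v else 0)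

/-- The vector `v` has weight `μ`. -/
def IsWt (e : ι → ι → Module.End ℂ V) (μ : ι → ℂ) (v : V) : Prop := ∀ i, e i i v = μ i • v

/-- The weight `μ` occurs. -/
def Occurs (e : ι → ι → Module.End ℂ V) (μ : ι → ℂ) : Prop := ∃ v, v ≠ 0 ∧ IsWt e μ v

/-- The root `ε_i - ε_k`. -/
def root (i k : ι) : ι → ℂ := Pi.single i 1 - Pi.single k 1

theorem root_comp_swap (i i' k : ι) (hk : k ≠ i) (hk' : k ≠ i') :
    root i k ∘ Equiv.swap i i' = root i' k := by
  ext x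
  simp only [root, Function.comp_apply, Pi.sub_apply, Pi.single_apply]
  have h1 : Equiv.swap i i' x = i ↔ x = i' := by
    rw [Equiv.swap_apply_eq_iff, Equiv.swap_apply_left]
  have h2 : Equiv.swap i i' x = k ↔ x = k := by
    rw [Equiv.swap_apply_eq_iff, Equiv.swap_apply_of_ne_of_ne hk hk']
  simp only [h1, h2]

/-- Local nilpotence. -/
def LocNil (f : Module.End ℂ V) : Prop := ∀ v, ∃ m : ℕ, (f ^ m) v = 0

/-- A simple `gl`-module, spanned by weight vectors, whose weight spaces are at most
one-dimensional. -/
structure SimpleDegreeOne (e : ι → ι → Module.End ℂ V) : Prop where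
  isGl : IsGl e
  nontrivial : ∃ v : V, v ≠ 0
  simple : ∀ U : Submodule ℂ V, (∀ i k, ∀ u ∈ U, e i k u ∈ U) → U = ⊥ ∨ U = ⊤
  span_eq_top : Submodule.span ℂ {v | ∃ μ, IsWt e μ v} = ⊤
  degree_one : ∀ μ v w, v ≠ 0 → IsWt e μ v → IsWt e μ w → ∃ t : ℂ, w = t • v

variable {e : ι → ι → Module.End ℂ V} {μ : ι → ℂ} {v : V}

theorem IsGl.isWt_root (h : IsGl e) (hv : IsWt e μ v) (i k : ι) :
    IsWt e (μ + root i k) (e i k v) := by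
  intro l
  rw [h, hv l, map_smul]
  simp only [root, Pi.add_apply, Pi.sub_apply, Pi.single_apply, add_smul, sub_smul]
  by_cases h1 : l = i <;> by_cases h2 : l = k
  · subst h1; subst h2; simp
  · subst h1; simp [h2, Ne.symm h2]
  · subst h2; simp [h1]; abel
  · simp [h1, h2, Ne.symm h2]

theorem IsGl.isWt_pow (h : IsGl e) (hv : IsWt e μ v) (i k : ι) (m : ℕ) :
    IsWt e (μ + (m : ℂ) • root i k) ((e i k ^ m) v) := by
  induction m with
  | zero => simpa using hv
  | succ m ih =>
    rw [pow_succ', Module.End.mul_apply]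
    convert h.isWt_root ih i k using 1
    push_cast
    rw [add_smul, one_smul, add_assoc]

theorem exists_last {f : Module.End ℂ V} (hf : LocNil f) (hv : v ≠ 0) :
    ∃ p : ℕ, (f ^ p) v ≠ 0 ∧ f ((f ^ p) v) = 0 := by
  classical
  have h := hf v
  have hpos : Nat.find h ≠ 0 := fun h0 => hv (by simpa [h0] using Nat.find_spec h)
  refine ⟨Nat.find h - 1, Nat.find_min h (by omega), ?_⟩
  rw [← Module.End.mul_apply, ← pow_succ', Nat.sub_add_cancel (by omega)]
  exact Nat.find_spec h

theorem IsGl.comm_opposite (h : IsGl e) (i k : ι) (w : V) :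
    e k i (e i k w) = e i k (e k i w) - e i i w + e k k w := by
  rw [h k i i k w]
  simp; abel

/-- Strings of `sl(2)`. -/
theorem IsGl.string (h : IsGl e) (hv : IsWt e μ v) {i k : ι} (hik : i ≠ k) {c : ℂ}
    (hc : e k i (e i k v) = c • v) (t : ℕ) :
    e k i ((e i k ^ (t + 1)) v) = (c - t * (μ i - μ k + t + 1)) • (e i k ^ t) v := by
  -- Moving `e k i` past the `s`-th additional factor `e i k` subtracts `μ i - μ k + 2 s`; the sum
  -- over `1 ≤ s ≤ t` is `t (μ i - μ k + t + 1)`. No singular vector is assumed, only the scalar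
  -- `c`.
  induction t with
  | zero => simpa using hc
  | succ t ih =>
    have hw := h.isWt_pow hv i k (t + 1)
    rw [pow_succ' _ (t + 1), Module.End.mul_apply, h.comm_opposite, ih, hw i, hw k, map_smul,
      ← Module.End.mul_apply, ← pow_succ', ← sub_smul, ← add_smul]
    congr 1
    simp [root, hik, hik.symm]
    ring

theorem IsGl.lower_string (h : IsGl e) (hv : IsWt e μ v) {i k : ι} (hik : i ≠ k)
    (h0 : e i k v = 0) (t : ℕ) :
    e i k ((e k i ^ (t + 1)) v) = ((t + 1) * (μ i - μ k - t)) • (e k i ^ t) v := by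
  have hc : e i k (e k i v) = (μ i - μ k) • v := by
    rw [h.comm_opposite, h0, hv i, hv k, map_zero, sub_smul]; abel
  rw [h.string hv hik.symm hc t]
  congr 1
  ring

namespace SimpleDegreeOne

variable (h : SimpleDegreeOne e)
include h

theorem exists_occurs : ∃ μ, Occurs e μ := by
  by_contra hcon
  have h1 : {v | ∃ μ, IsWt e μ v} ⊆ {0} := by
    rintro v ⟨μ, hv⟩
    by_contra hne
    exact hcon ⟨μ, v, hne, hv⟩
  obtain ⟨v, hv⟩ := h.nontrivial
  have : v ∈ Submodule.span ℂ {v | ∃ μ, IsWt e μ v} := h.span_eq_top ▸ Submodule.mem_top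
  have h2 := Submodule.span_mono h1 this
  simp at h2
  exact hv h2

/-- A root vector acts injectively or locally nilpotently. -/
theorem locNil_or_injective {i k : ι} (hik : i ≠ k) :
    LocNil (e i k) ∨ ∀ v, e i k v = 0 → v = 0 := by
  -- The vectors killed by a power of `e i k` form a submodule, which simplicity forces to be zero
  -- or everything.
  set U := Module.End.maxGenEigenspace (e i k) 0 with hU
  have memU : ∀ v, v ∈ U ↔ ∃ m : ℕ, (e i k ^ m) v = 0 := by
    intro v
    rw [hU, Module.End.mem_maxGenEigenspace]
    simp
  have back : ∀ v, e i k v ∈ U → v ∈ U := by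
    intro v hv
    obtain ⟨m, hm⟩ := (memU _).1 hv
    exact (memU _).2 ⟨m + 1, by rw [pow_succ, Module.End.mul_apply, hm]⟩
  -- Stability under `e l m` follows from stability under its commutator with `e i k`. The order of
  -- `k0` to `k3` is such that each commutator has been treated before: nothing for `e i k`, then
  -- row `i` and column `k`, then the rest.
  have key : ∀ l m, (∀ u ∈ U, (if k = l then e i m u else 0) - (if m = i then e l k u else 0) ∈ U) →
      ∀ u ∈ U, e l m u ∈ U := by
    intro l m hc u hu
    obtain ⟨r, hr⟩ := (memU _).1 hu
    induction r generalizing u with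
    | zero => rw [show u = 0 by simpa using hr, map_zero]; exact U.zero_mem
    | succ r ih =>
      rw [pow_succ, Module.End.mul_apply] at hr
      have h1 := ih _ ((memU _).2 ⟨r, hr⟩) hr
      apply back
      rw [h.isGl i k l m, add_sub_assoc]
      exact U.add_mem h1 (hc u hu)
  have k0 : ∀ u ∈ U, e i k u ∈ U := key i k fun u _ => by simp [hik.symm]
  have k1 : ∀ m, ∀ u ∈ U, e i m u ∈ U := fun m => key i m fun u hu => by
    rw [if_neg hik.symm, zero_sub]
    split_ifs
    · exact U.neg_mem (k0 u hu)
    · simp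
  have k2 : ∀ l, ∀ u ∈ U, e l k u ∈ U := fun l => key l k fun u hu => by
    rw [if_neg hik.symm, sub_zero]
    split_ifs
    · exact k0 u hu
    · simp
  have k3 : ∀ l m, ∀ u ∈ U, e l m u ∈ U := fun l m => key l m fun u hu => by
    refine U.sub_mem ?_ ?_
    · split_ifs
      · exact k1 m u hu
      · exact U.zero_mem
    · split_ifs
      · exact k2 l u hu
      · exact U.zero_mem
  rcases h.simple U k3 with h0 | h0
  · right
    intro v hv
    have : v ∈ U := back v (by rw [hv]; exact U.zero_mem)
    simpa [h0] using this
  · left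
    intro v
    exact (memU v).1 (h0 ▸ Submodule.mem_top)

theorem exists_scalar {i k : ι} (hv : v ≠ 0) (hw : IsWt e μ v) :
    ∃ c : ℂ, e k i (e i k v) = c • v := by
  refine h.degree_one μ v _ hv hw ?_
  convert h.isGl.isWt_root (h.isGl.isWt_root hw i k) k i using 1
  simp only [root]; abel

/-- The ends of the string through `v` in the two directions give two quadratic expressions for the
scalars of `e k i ∘ e i k` and `e i k ∘ e k i`. These scalars differ by `μ i - μ k`, and the common
factor `l + p + 1` cancels. Here `v` need not be singular, but degree one is needed for the scalars
to exist. -/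
theorem string_eq {i k : ι} (hik : i ≠ k) (hv : v ≠ 0) (hw : IsWt e μ v) {p l : ℕ}
    (hp : (e i k ^ p) v ≠ 0) (hp' : e i k ((e i k ^ p) v) = 0)
    (hl : (e k i ^ l) v ≠ 0) (hl' : e k i ((e k i ^ l) v) = 0) : μ i - μ k = l - p := by
  obtain ⟨c, hc⟩ := h.exists_scalar (i := i) (k := k) hv hw
  obtain ⟨c', hc'⟩ := h.exists_scalar (i := k) (k := i) hv hw
  have h1 := h.isGl.string hw hik hc p
  rw [pow_succ', Module.End.mul_apply, hp', map_zero, eq_comm, smul_eq_zero_iff_left hp] at h1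
  have h2 := h.isGl.string hw hik.symm hc' l
  rw [pow_succ', Module.End.mul_apply, hl', map_zero, eq_comm, smul_eq_zero_iff_left hl] at h2
  have h3 := h.isGl.comm_opposite k i v
  rw [hc, hc', hw i, hw k, ← sub_smul, ← add_smul] at h3
  have h4 := smul_left_injective ℂ hv h3
  have h5 : (l + p + 1 : ℂ) * (μ i - μ k - (l - p)) = 0 := by
    linear_combination h2 - h1 - h4
  rcases mul_eq_zero.1 h5 with h6 | h6
  · exact absurd h6 (by exact_mod_cast (by omega : l + p + 1 ≠ 0))
  · linear_combination h6

/-- The weights are invariant under a reflection for which both root vectors are locally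
nilpotent. -/
theorem occurs_swap {i k : ι} (hik : i ≠ k) (h1 : LocNil (e i k)) (h2 : LocNil (e k i))
    (hμ : Occurs e μ) : Occurs e (μ ∘ Equiv.swap i k) := by
  obtain ⟨v, hv, hw⟩ := hμ
  obtain ⟨p, hp, hp'⟩ := exists_last h1 hv
  obtain ⟨l, hl, hl'⟩ := exists_last h2 hv
  have hd := h.string_eq hik hv hw hp hp' hl hl'
  have key : ∀ t : ℂ, t = μ i - μ k → μ + t • root k i = μ ∘ Equiv.swap i k := by
    rintro t rfl
    ext x
    simp only [root, Pi.add_apply, Pi.smul_apply, Pi.sub_apply, Pi.single_apply,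
      Function.comp_apply, smul_eq_mul]
    rcases eq_or_ne x i with rfl | hx
    · simp [hik]
    · rcases eq_or_ne x k with rfl | hx'
      · simp [hik.symm]
      · simp [hx, hx', Equiv.swap_apply_of_ne_of_ne hx hx']
  have sub : ∀ (f : Module.End ℂ V) (a b : ℕ), a ≤ b → (f ^ b) v ≠ 0 → (f ^ a) v ≠ 0 := by
    intro f a b hab hb ha
    apply hb
    rw [← Nat.sub_add_cancel hab, pow_add, Module.End.mul_apply, ha, map_zero]
  -- The reflected weight is `|l - p|` steps away, in the direction of the longer half of the
  -- string, so it is reached before that half ends.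
  rcases le_total p l with hpl | hpl
  · refine ⟨(e k i ^ (l - p)) v, sub _ _ l (by omega) hl, ?_⟩
    rw [← key ((l - p : ℕ) : ℂ) (by rw [hd]; push_cast [hpl]; ring)]
    exact h.isGl.isWt_pow hw k i _
  · refine ⟨(e i k ^ (p - l)) v, sub _ _ p (by omega) hp, ?_⟩
    rw [← key (-((p - l : ℕ) : ℂ)) (by rw [hd]; push_cast [hpl]; ring)]
    convert h.isGl.isWt_pow hw i k (p - l) using 2
    simp only [root]
    module

/-- The weights cannot go on for ever in a locally nilpotent direction. -/
theorem not_forall_occurs {i k : ι} (hik : i ≠ k) (hn : LocNil (e i k)) (μ : ι → ℂ) :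
    ¬ ∀ m : ℕ, Occurs e (μ + (m : ℂ) • root i k) := by
  intro hall
  -- Raising each given weight vector to the end of its string produces singular vectors arbitrarily
  -- far out.
  have sing : ∀ m : ℕ, ∃ t, m ≤ t ∧ ∃ w, w ≠ 0 ∧ IsWt e (μ + (t : ℂ) • root i k) w ∧
      e i k w = 0 := by
    intro m
    obtain ⟨v, hv, hw⟩ := hall m
    obtain ⟨p, hp, hp'⟩ := exists_last hn hv
    refine ⟨m + p, by omega, _, hp, ?_, hp'⟩
    convert h.isGl.isWt_pow hw i k p using 1
    push_cast
    module
  -- Beyond `m0`, no lowering coefficient between two singular vectors can vanish: that would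
  -- require `μ i - μ k = -(2 t' - r)`, of absolute value at least `m0`.
  obtain ⟨m0, hm0⟩ := exists_nat_gt (‖μ i - μ k‖)
  obtain ⟨t, ht, w, hw0, hw, hs⟩ := sing m0
  obtain ⟨t', ht', w', hw0', hw', hs'⟩ := sing (t + 1)
  have coef : ∀ r : ℕ, r < t' - t → ((r : ℂ) + 1) *
      ((μ + (t' : ℂ) • root i k) i - (μ + (t' : ℂ) • root i k) k - r) ≠ 0 := by
    intro r hr
    refine mul_ne_zero (by exact_mod_cast Nat.succ_ne_zero r) ?_
    intro h0
    have h1 : μ i - μ k = -((2 * t' - r : ℕ) : ℂ) := by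
      rw [Nat.cast_sub (by omega)]
      simp [root, hik, hik.symm] at h0
      push_cast
      linear_combination h0
    rw [h1, norm_neg, Complex.norm_natCast] at hm0
    have : 2 * t' - r < m0 := by exact_mod_cast hm0
    omega
  have hne : ∀ r : ℕ, r ≤ t' - t → (e k i ^ r) w' ≠ 0 := by
    intro r
    induction r with
    | zero => intro _; simpa using hw0'
    | succ r ih =>
      intro hr h0
      have h1 := h.isGl.lower_string hw' hik hs' r
      rw [h0, map_zero, eq_comm, smul_eq_zero] at h1
      exact h1.elim (coef r (by omega)) (ih (by omega))
  obtain ⟨s, hs1⟩ : ∃ s, t' - t = s + 1 := ⟨t' - t - 1, by omega⟩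
  have hwt : IsWt e (μ + (t : ℂ) • root i k) ((e k i ^ (s + 1)) w') := by
    -- The outer singular vector, lowered to the weight of the inner one, must be a multiple of it
    -- and hence be killed by `e i k`, against the nonzero coefficient.
    convert h.isGl.isWt_pow hw' k i (s + 1) using 1
    rw [← hs1, Nat.cast_sub (by omega)]
    simp only [root]
    module
  obtain ⟨c, hc⟩ := h.degree_one _ _ _ hw0 hw hwt
  have h1 := h.isGl.lower_string hw' hik hs' s
  rw [hc, map_smul, hs, smul_zero, eq_comm, smul_eq_zero] at h1
  exact h1.elim (coef s (by omega)) (hne s (by omega))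

theorem occurs_add_root {i k : ι} (hi : ∀ v, e i k v = 0 → v = 0) (hμ : Occurs e μ) :
    Occurs e (μ + root i k) := by
  obtain ⟨v, hv, hw⟩ := hμ
  exact ⟨e i k v, fun h0 => hv (hi v h0), h.isGl.isWt_root hw i k⟩

theorem not_closed_root {i k : ι} (hik : i ≠ k) (hn : LocNil (e i k)) :
    ¬ ∀ μ, Occurs e μ → Occurs e (μ + root i k) := by
  intro hc
  obtain ⟨μ, hμ⟩ := h.exists_occurs
  refine h.not_forall_occurs hik hn μ fun m => ?_
  induction m with
  | zero => simpa using hμ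
  | succ m ih =>
    convert hc _ ih using 1
    push_cast
    module

/-- If `e i' k` were injective, the weights would be closed under adding `root i' k`. Conjugating by
the reflection in `i, i'` would make them closed under adding `root i k`, which local nilpotence of
`e i k` forbids. `locNil_right` is the same argument for the column index. -/
theorem locNil_left {i i' k : ι} (hii : i ≠ i') (hk : k ≠ i) (hk' : k ≠ i')
    (h1 : LocNil (e i i')) (h2 : LocNil (e i' i)) (hn : LocNil (e i k)) : LocNil (e i' k) := by
  refine (h.locNil_or_injective hk'.symm).resolve_right fun hinj => ?_
  refine h.not_closed_root hk.symm hn fun μ hμ => ?_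
  have h3 := h.occurs_swap hii h1 h2 (h.occurs_add_root hinj (h.occurs_swap hii h1 h2 hμ))
  convert h3 using 1
  rw [← root_comp_swap i i' k hk hk']
  ext x
  simp

theorem locNil_right {i i' k : ι} (hii : i ≠ i') (hk : k ≠ i) (hk' : k ≠ i')
    (h1 : LocNil (e i i')) (h2 : LocNil (e i' i)) (hn : LocNil (e k i)) : LocNil (e k i') := by
  refine (h.locNil_or_injective hk').resolve_right fun hinj => ?_
  refine h.not_closed_root hk hn fun μ hμ => ?_
  have h3 := h.occurs_swap hii h1 h2 (h.occurs_add_root hinj (h.occurs_swap hii h1 h2 hμ))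
  convert h3 using 1
  have h4 : root k i' = -root i' k := by simp [root]
  have h5 : root k i = -root i k := by simp [root]
  rw [h4, h5, ← root_comp_swap i i' k hk hk']
  ext x
  simp

/-- Local nilpotence spreads over the roots with the same signs for the two blocks. -/
theorem locNil_spread (B : ι → Prop) (hB : ∀ i k, i ≠ k → (B i ↔ B k) → LocNil (e i k))
    {i k i' k' : ι} (hik : B i ↔ ¬ B k) (hi : B i ↔ B i') (hk : B k ↔ B k')
    (hn : LocNil (e i k)) : LocNil (e i' k') := by
  have ne : ∀ a b, ¬ (B a ↔ B b) → a ≠ b := by rintro a b hab rfl; exact hab Iff.rfl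
  have h1 : LocNil (e i' k) := by
    rcases eq_or_ne i i' with rfl | hne
    · exact hn
    · exact h.locNil_left hne (ne _ _ (by tauto)) (ne _ _ (by tauto)) (hB _ _ hne hi)
        (hB _ _ hne.symm hi.symm) hn
  rcases eq_or_ne k k' with rfl | hne
  · exact h1
  · exact h.locNil_right hne (ne _ _ (by tauto)) (ne _ _ (by tauto)) (hB _ _ hne hk)
      (hB _ _ hne.symm hk.symm) h1

/-- The dichotomy for the two nilradicals attached to a partition in two blocks. -/
theorem locNil_dichotomy (B : ι → Prop) (hB : ∀ i k, i ≠ k → (B i ↔ B k) → LocNil (e i k))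
    {i₀ i₁ k₀ : ι} (h01 : i₀ ≠ i₁) (hb : B i₀ ↔ B i₁) (hk : ¬ (B i₀ ↔ B k₀)) :
    (∀ i k, B i → ¬ B k → LocNil (e i k)) ∨ (∀ i k, B i → ¬ B k → LocNil (e k i)) := by
  by_contra hcon
  push Not at hcon
  obtain ⟨⟨i, k, hi, hk1, hn⟩, i', k', hi', hk', hn'⟩ := hcon
  have ne : ∀ a b, ¬ (B a ↔ B b) → a ≠ b := by rintro a b hab rfl; exact hab Iff.rfl
  -- One failure of nilpotence in each nilradical spreads to all of it.
  have inj : ∀ a b, ¬ (B a ↔ B b) → ∀ v, e a b v = 0 → v = 0 := by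
    intro a b hab
    refine (h.locNil_or_injective (ne a b hab)).resolve_left fun hl => ?_
    by_cases ha : B a
    · exact hn (h.locNil_spread B hB (by tauto) (by tauto) (by tauto) hl)
    · exact hn' (h.locNil_spread B hB (by tauto) (by tauto) (by tauto) hl)
  -- The root `ε_{i₀} - ε_{i₁}` of a block is the sum of the cross roots `ε_{i₀} - ε_{k₀}` and
  -- `ε_{k₀} - ε_{i₁}`.
  refine h.not_closed_root h01 (hB _ _ h01 hb) fun μ hμ => ?_
  convert h.occurs_add_root (inj k₀ i₁ (by tauto)) (h.occurs_add_root (inj i₀ k₀ hk) hμ) using 1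
  simp only [root]
  abel

end SimpleDegreeOne

end GlAction

end SlDegreeOne

namespace SlDegreeOne

/-! ### Highest weight vectors: existence, finiteness, uniqueness of the simple module. -/

section Highest

variable {n : ℕ} {V W : Type*} [AddCommGroup V] [Module ℂ V] [AddCommGroup W] [Module ℂ W]

/-- A highest weight vector `v` of weight `μ`. -/
structure IsHighest (e : Fin (n + 1) → Fin (n + 1) → Module.End ℂ V) (μ : Fin (n + 1) → ℂ)
    (v : V) : Prop where
  ne_zero : v ≠ 0
  isWt : IsWt e μ v
  raise_eq_zero : ∀ i k, i < k → e i k v = 0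

/-- The vectors obtained from `v` by applying lowering operators repeatedly. -/
inductive LowerWord (e : Fin (n + 1) → Fin (n + 1) → Module.End ℂ V) (v : V) : V → Prop
  | base : LowerWord e v v
  | step (i k : Fin (n + 1)) (w : V) : i < k → LowerWord e v w → LowerWord e v (e k i w)

/-- The span of the vectors obtained from `v` by applying lowering operators. -/
def lowerSpan (e : Fin (n + 1) → Fin (n + 1) → Module.End ℂ V) (v : V) : Submodule ℂ V :=
  Submodule.span ℂ {w | LowerWord e v w}

/-- The height of a weight; lowering operators increase it. -/
def height (μ : Fin (n + 1) → ℂ) : ℂ := ∑ i, (i.val : ℂ) * μ i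

/-- The operator acting on weight vectors by the height. -/
def heightOp (e : Fin (n + 1) → Fin (n + 1) → Module.End ℂ V) : Module.End ℂ V :=
  ∑ i, (i.val : ℂ) • e i i

variable {e : Fin (n + 1) → Fin (n + 1) → Module.End ℂ V}
  {e' : Fin (n + 1) → Fin (n + 1) → Module.End ℂ W} {μ ν : Fin (n + 1) → ℂ} {v w u : V} {x : W}

theorem IsWt.heightOp_apply (hv : IsWt e μ v) : heightOp e v = height μ • v := by
  simp only [heightOp, LinearMap.sum_apply, LinearMap.smul_apply, height, Finset.sum_smul]
  exact Finset.sum_congr rfl fun i _ => by rw [hv i, smul_smul]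

theorem IsWt.sum_apply (hv : IsWt e μ v) : (∑ i, e i i) v = (∑ i, μ i) • v := by
  simp only [LinearMap.sum_apply, Finset.sum_smul]
  exact Finset.sum_congr rfl fun i _ => hv i

theorem height_add_root (μ : Fin (n + 1) → ℂ) (i k : Fin (n + 1)) :
    height (μ + root i k) = height μ + (i.val - k.val) := by
  simp [height, root, Pi.single_apply, mul_add, mul_sub, Finset.sum_add_distrib,
    Finset.sum_sub_distrib]

/-- The height separates `v` from everything strictly below it. The first coordinate and the
coordinate sum serve to bound the weights in `SimpleDegreeOne.finiteDimensional`. -/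
theorem IsGl.lowerWord_isWt (h : IsGl e) (hv : IsWt e μ v) (hw : LowerWord e v w) :
    ∃ ν, IsWt e ν w ∧ ((w = v ∧ ν = μ) ∨ ∃ r : ℕ, height ν = height μ + (r + 1)) ∧
      (∃ r : ℕ, ν 0 = μ 0 - r) ∧ ∑ i, ν i = ∑ i, μ i := by
  induction hw with
  | base => exact ⟨μ, hv, Or.inl ⟨rfl, rfl⟩, ⟨0, by simp⟩, rfl⟩
  | step i k w hik hw ih =>
    obtain ⟨ν, h1, h2, ⟨r, hr⟩, h4⟩ := ih
    refine ⟨ν + root k i, h.isWt_root h1 k i, Or.inr ?_, ?_, ?_⟩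
    · have hik' : i.val < k.val := hik
      obtain ⟨d, hd⟩ : ∃ d, k.val = i.val + d + 1 := ⟨k.val - i.val - 1, by omega⟩
      rw [height_add_root, hd]
      rcases h2 with ⟨-, rfl⟩ | ⟨s, hs⟩
      · exact ⟨d, by push_cast; ring⟩
      · exact ⟨s + d + 1, by rw [hs]; push_cast; ring⟩
    · have hk : (0 : Fin (n + 1)) ≠ k := (lt_of_le_of_lt (Fin.zero_le i) hik).ne
      by_cases hi : (0 : Fin (n + 1)) = i
      · exact ⟨r + 1, by simp [root, hk, ← hi, hr]; ring⟩
      · exact ⟨r, by simp [root, hk, hi, hr]⟩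
    · simp [root, Finset.sum_add_distrib, h4]

/-- An operator is commuted through a lowering word one letter at a time. The commutators are single
matrix units acting on a shorter word, so no ordering of monomials as in the Poincaré–Birkhoff–Witt
theorem is needed. -/
theorem IsGl.lowerSpan_stable (h : IsGl e) (hv : IsHighest e μ v) (i k : Fin (n + 1))
    (hu : u ∈ lowerSpan e v) : e i k u ∈ lowerSpan e v := by
  have low : ∀ i k, i < k → ∀ u ∈ lowerSpan e v, e k i u ∈ lowerSpan e v := by
    intro i k hik u hu
    refine Submodule.span_induction (p := fun u _ => e k i u ∈ lowerSpan e v) ?_ ?_ ?_ ?_ hu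
    · exact fun w hw => Submodule.subset_span (LowerWord.step i k w hik hw)
    · simp
    · intro a b _ _ ha hb
      rw [map_add]
      exact Submodule.add_mem _ ha hb
    · intro t a _ ha
      rw [map_smul]
      exact Submodule.smul_mem _ _ ha
  have all : ∀ w, LowerWord e v w → ∀ i k, e i k w ∈ lowerSpan e v := by
    intro w hw
    induction hw with
    | base =>
      intro i k
      rcases lt_trichotomy i k with hik | rfl | hik
      · rw [hv.raise_eq_zero i k hik]; exact Submodule.zero_mem _
      · rw [hv.isWt i]; exact Submodule.smul_mem _ _ (Submodule.subset_span .base)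
      · exact Submodule.subset_span (LowerWord.step k i v hik LowerWord.base)
    | step a b w hab hw ih =>
      intro i k
      rw [h i k b a w]
      refine Submodule.sub_mem _ (Submodule.add_mem _ (low a b hab _ (ih i k)) ?_) ?_
      · split_ifs
        · exact ih i a
        · exact Submodule.zero_mem _
      · split_ifs
        · exact ih b k
        · exact Submodule.zero_mem _
  refine Submodule.span_induction (p := fun u _ => e i k u ∈ lowerSpan e v) ?_ ?_ ?_ ?_ hu
  · exact fun w hw => all w hw i k
  · simp
  · intro a b _ _ ha hb
    rw [map_add]
    exact Submodule.add_mem _ ha hb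
  · intro t a _ ha
    rw [map_smul]
    exact Submodule.smul_mem _ _ ha

theorem self_mem_lowerSpan : v ∈ lowerSpan e v := Submodule.subset_span .base

theorem SimpleDegreeOne.lowerSpan_eq_top (h : SimpleDegreeOne e) (hv : IsHighest e μ v) :
    lowerSpan e v = ⊤ := by
  refine (h.simple _ fun i k u hu => h.isGl.lowerSpan_stable hv i k hu).resolve_left fun h0 => ?_
  have := self_mem_lowerSpan (e := e) (v := v)
  rw [h0, Submodule.mem_bot] at this
  exact hv.ne_zero this

omit e e' μ ν v w u x in
/-- The eigenvalue of an eigenvector lying in a span of eigenvectors is one of theirs. -/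
theorem eigenvalue_mem {f : Module.End ℂ V} {S : Set ℂ} {u : V} {c : ℂ}
    (hu : u ∈ Submodule.span ℂ {w | ∃ c ∈ S, f w = c • w}) (hc : f u = c • u) (h0 : u ≠ 0) :
    c ∈ S := by
  by_contra hcS
  have hle : Submodule.span ℂ {w | ∃ c ∈ S, f w = c • w} ≤ ⨆ d, ⨆ (_ : d ≠ c), f.eigenspace d := by
    rw [Submodule.span_le]
    rintro w ⟨d, hd, hw⟩
    have hdc : d ≠ c := by rintro rfl; exact hcS hd
    exact Submodule.mem_iSup_of_mem d (Submodule.mem_iSup_of_mem hdc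
      (Module.End.mem_eigenspace_iff.2 hw))
  exact h0 ((Submodule.disjoint_def.1 (f.eigenspaces_iSupIndep c)) u
    (Module.End.mem_eigenspace_iff.2 hc) (hle hu))

/-- In the submodule generated by a highest weight vector, its multiples are the only vectors of
the same height. -/
theorem IsGl.eq_smul_of_mem_lowerSpan (h : IsGl e) (hv : IsWt e μ v) (hu : u ∈ lowerSpan e v)
    (hh : heightOp e u = height μ • u) : ∃ t : ℂ, u = t • v := by
  set S : Set ℂ := {c | ∃ r : ℕ, c = height μ + (r + 1)}
  have hle : lowerSpan e v ≤ Submodule.span ℂ {v} ⊔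
      Submodule.span ℂ {w | ∃ c ∈ S, heightOp e w = c • w} := by
    refine Submodule.span_le.2 fun w hw => ?_
    obtain ⟨ν, h1, h2, -⟩ := h.lowerWord_isWt hv hw
    rcases h2 with ⟨rfl, -⟩ | ⟨r, hr⟩
    · exact Submodule.mem_sup_left (Submodule.mem_span_singleton_self _)
    · exact Submodule.mem_sup_right (Submodule.subset_span ⟨_, ⟨r, hr⟩, h1.heightOp_apply⟩)
  obtain ⟨a, ha, b, hb, hab⟩ := Submodule.mem_sup.1 (hle hu)
  obtain ⟨t, rfl⟩ := Submodule.mem_span_singleton.1 ha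
  refine ⟨t, ?_⟩
  by_contra hne
  have hb0 : b ≠ 0 := by
    rintro rfl
    exact hne (by simpa using hab.symm)
  have hb' : b = u - t • v := by rw [← hab]; abel
  obtain ⟨r, hr⟩ := eigenvalue_mem (c := height μ) hb (by
    rw [hb', map_sub, map_smul, hh, hv.heightOp_apply, smul_sub, smul_comm]) hb0
  have : ((r + 1 : ℕ) : ℂ) = 0 := by push_cast; linear_combination -hr
  exact absurd this (by exact_mod_cast Nat.succ_ne_zero r)

/-- A simple module has no singular vectors except the multiples of its highest weight vector. -/
theorem SimpleDegreeOne.not_isHighest (h : SimpleDegreeOne e) (hv : IsHighest e μ v)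
    {r : ℕ} (hr : height ν = height μ + (r + 1)) : ¬ IsHighest e ν u := by
  intro hu
  -- Being singular, `u` generates only vectors of height strictly greater than that of `v`;
  -- simplicity would put `v` among them.
  have htop := h.lowerSpan_eq_top hu
  have hle : lowerSpan e u ≤ Submodule.span ℂ
      {w | ∃ c ∈ {c : ℂ | ∃ s : ℕ, c = height μ + (s + 1)}, heightOp e w = c • w} := by
    refine Submodule.span_le.2 fun w hw => Submodule.subset_span ?_
    obtain ⟨κ, h1, h2, -⟩ := h.isGl.lowerWord_isWt hu.isWt hw
    refine ⟨height κ, ?_, h1.heightOp_apply⟩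
    rcases h2 with ⟨-, rfl⟩ | ⟨s, hs⟩
    · exact ⟨r, hr⟩
    · exact ⟨r + s + 1, by rw [hs, hr]; push_cast; ring⟩
  obtain ⟨s, hs⟩ := eigenvalue_mem (hle (htop ▸ Submodule.mem_top)) hv.isWt.heightOp_apply
    hv.ne_zero
  have : ((s + 1 : ℕ) : ℂ) = 0 := by push_cast; linear_combination -hs
  exact absurd this (by exact_mod_cast Nat.succ_ne_zero s)

/-- The raising operators are killed column by column from the right, and within a column row by
row, each time replacing the vector by the last nonzero power of the next operator applied to it. -/
theorem SimpleDegreeOne.exists_isHighest (h : SimpleDegreeOne e)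
    (hn : ∀ i k, i < k → LocNil (e i k)) : ∃ μ v, IsHighest e μ v := by
  have main : ∀ t : ℕ, ∃ μ v, v ≠ 0 ∧ IsWt e μ v ∧
      ∀ i l : Fin (n + 1), i < l → n + 1 ≤ l.val + t → e i l v = 0 := by
    intro t
    induction t with
    | zero =>
      obtain ⟨μ, v, hv, hw⟩ := h.exists_occurs
      exact ⟨μ, v, hv, hw, fun i l _ hl => absurd l.isLt (by omega)⟩
    | succ t ih =>
      by_cases ht : n < t
      · obtain ⟨μ, v, hv, hw, hk⟩ := ih
        exact ⟨μ, v, hv, hw, fun i l hil _ => hk i l hil (by omega)⟩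
      obtain ⟨l₀, hl₀⟩ : ∃ l₀ : Fin (n + 1), l₀.val + t = n :=
        ⟨⟨n - t, by omega⟩, by show n - t + t = n; omega⟩
      have inner : ∀ T : Finset (Fin (n + 1)), ∃ μ v, v ≠ 0 ∧ IsWt e μ v ∧
          (∀ i l : Fin (n + 1), i < l → n + 1 ≤ l.val + t → e i l v = 0) ∧
          ∀ i ∈ T, i < l₀ → e i l₀ v = 0 := by
        intro T
        induction T using Finset.induction_on with
        | empty =>
          obtain ⟨μ, v, hv, hw, hk⟩ := ih
          exact ⟨μ, v, hv, hw, hk, by simp⟩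
        | insert a T _ ihT =>
          obtain ⟨μ, v, hv, hw, hk, hT⟩ := ihT
          by_cases ha : a < l₀
          swap
          · refine ⟨μ, v, hv, hw, hk, fun i hi hil => ?_⟩
            rcases Finset.mem_insert.1 hi with rfl | hi
            · exact absurd hil ha
            · exact hT i hi hil
          obtain ⟨p, hp, hp'⟩ := exists_last (hn a l₀ ha) hv
          -- Raising operators of one column commute, and the commutator of `e a l₀` with an
          -- operator of a later column is zero or lies in that later column. What was killed stays
          -- killed.
          have pres : ∀ q : ℕ, (∀ i l : Fin (n + 1), i < l → n + 1 ≤ l.val + t →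
              e i l ((e a l₀ ^ q) v) = 0) ∧ ∀ i ∈ T, i < l₀ → e i l₀ ((e a l₀ ^ q) v) = 0 := by
            intro q
            induction q with
            | zero => exact ⟨by simpa using hk, by simpa using hT⟩
            | succ q ihq =>
              obtain ⟨q1, q2⟩ := ihq
              rw [pow_succ', Module.End.mul_apply]
              constructor
              · intro i l hil hl
                have hll : l₀.val < l.val := by omega
                have hal : a < l := lt_trans ha hll
                rw [h.isGl, q1 i l hil hl, q1 a l hal hl, if_neg hal.ne']
                simp
              · intro i hi hil
                rw [h.isGl, q2 i hi hil, if_neg ha.ne', if_neg hil.ne']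
                simp
          refine ⟨_, _, hp, h.isGl.isWt_pow hw a l₀ p, (pres p).1, fun i hi hil => ?_⟩
          rcases Finset.mem_insert.1 hi with rfl | hi
          · exact hp'
          · exact (pres p).2 i hi hil
      obtain ⟨μ, v, hv, hw, hk, hT⟩ := inner Finset.univ
      refine ⟨μ, v, hv, hw, fun i l hil hl => ?_⟩
      by_cases hll : l = l₀
      · subst hll
        exact hT i (Finset.mem_univ i) hil
      · refine hk i l hil ?_
        have : l.val ≠ l₀.val := fun h => hll (Fin.ext h)
        omega
  obtain ⟨μ, v, hv, hw, hk⟩ := main (n + 1)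
  exact ⟨μ, v, hv, hw, fun i l hil => hk i l hil (by omega)⟩

/-- If all root vectors are locally nilpotent, the module is finite-dimensional. -/
theorem SimpleDegreeOne.finiteDimensional (h : SimpleDegreeOne e)
    (hn : ∀ i k, i ≠ k → LocNil (e i k)) : FiniteDimensional ℂ V := by
  obtain ⟨κ, v, hv⟩ := h.exists_isHighest fun i k hik => hn i k hik.ne
  have htop := h.lowerSpan_eq_top hv
  have first : ∀ μ, Occurs e μ → ∃ r : ℕ, μ 0 = κ 0 - r := by
    rintro μ ⟨u, hu, hw⟩
    have hle : lowerSpan e v ≤ Submodule.span ℂ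
        {w | ∃ c ∈ {c : ℂ | ∃ s : ℕ, c = κ 0 - s}, e 0 0 w = c • w} := by
      refine Submodule.span_le.2 fun w hw => Submodule.subset_span ?_
      obtain ⟨ν, h1, -, h2, -⟩ := h.isGl.lowerWord_isWt hv.isWt hw
      exact ⟨ν 0, h2, h1 0⟩
    exact eigenvalue_mem (hle (htop ▸ Submodule.mem_top)) (hw 0) hu
  have total : ∀ μ, Occurs e μ → ∑ i, μ i = ∑ i, κ i := by
    rintro μ ⟨u, hu, hw⟩
    have hle : lowerSpan e v ≤ Submodule.span ℂ
        {w | ∃ c ∈ ({∑ i, κ i} : Set ℂ), (∑ i, e i i) w = c • w} := by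
      refine Submodule.span_le.2 fun w hw => Submodule.subset_span ?_
      obtain ⟨ν, h1, -, -, h2⟩ := h.isGl.lowerWord_isWt hv.isWt hw
      exact ⟨_, h2, h1.sum_apply⟩
    exact Set.mem_singleton_iff.1
      (eigenvalue_mem (hle (htop ▸ Submodule.mem_top)) hw.sum_apply hu)
  -- Reflections carry the upper bound from the first coordinate to all of them. As the total is
  -- constant, each deficit is at most the sum of the deficits of one fixed weight, so only finitely
  -- many weights occur.
  have each : ∀ μ, Occurs e μ → ∀ i, ∃ r : ℕ, μ i = κ 0 - r := by
    intro μ hμ i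
    rcases eq_or_ne 0 i with rfl | hi
    · exact first μ hμ
    · simpa using first _ (h.occurs_swap hi (hn _ _ hi) (hn _ _ hi.symm) hμ)
  obtain ⟨K, hK⟩ : ∃ K : ℕ, ∀ μ, Occurs e μ → ∀ i, ∃ r : ℕ, r ≤ K ∧ μ i = κ 0 - r := by
    obtain ⟨μ₀, hμ₀⟩ := h.exists_occurs
    choose r₀ hr₀ using each μ₀ hμ₀
    refine ⟨∑ i, r₀ i, fun μ hμ i => ?_⟩
    choose r hr using each μ hμ
    refine ⟨r i, ?_, hr i⟩
    have h1 : ((∑ i, r i : ℕ) : ℂ) = ((∑ i, r₀ i : ℕ) : ℂ) := by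
      have h2 := (total μ hμ).trans (total μ₀ hμ₀).symm
      simp only [hr, hr₀, Finset.sum_sub_distrib] at h2
      push_cast
      linear_combination -h2
    rw [← Nat.cast_injective h1]
    exact Finset.single_le_sum (f := r) (fun _ _ => Nat.zero_le _) (Finset.mem_univ i)
  have hfin : {μ | Occurs e μ}.Finite := by
    refine (Set.Finite.pi' (t := fun _ : Fin (n + 1) => (fun r : ℕ => κ 0 - (r : ℂ)) '' Set.Iic K)
      fun _ => (Set.finite_Iic K).image _).subset fun μ hμ i => ?_
    obtain ⟨r, h1, h2⟩ := hK μ hμ i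
    exact ⟨r, h1, h2.symm⟩
  choose! f hf0 hf using fun μ (hμ : Occurs e μ) => hμ
  have : Submodule.span ℂ (f '' {μ | Occurs e μ}) = ⊤ := by
    rw [eq_top_iff, ← h.span_eq_top, Submodule.span_le]
    rintro u ⟨μ, hu⟩
    by_cases hu0 : u = 0
    · rw [hu0]; exact Submodule.zero_mem _
    have hμ : Occurs e μ := ⟨u, hu0, hu⟩
    obtain ⟨t, rfl⟩ := h.degree_one μ _ _ (hf0 μ hμ) (hf μ hμ) hu
    exact Submodule.smul_mem _ _ (Submodule.subset_span ⟨μ, hμ, rfl⟩)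
  exact Module.finite_def.2 (this ▸ Submodule.fg_span (hfin.image f))

/-- Simple highest weight modules with the same highest weight are isomorphic. -/
theorem SimpleDegreeOne.exists_equiv (h : SimpleDegreeOne e) (h' : SimpleDegreeOne e')
    (hv : IsHighest e μ v) (hx : IsHighest e' μ x) :
    ∃ f : V ≃ₗ[ℂ] W, ∀ i k u, f (e i k u) = e' i k (f u) := by
  set E : Fin (n + 1) → Fin (n + 1) → Module.End ℂ (V × W) :=
    fun i k => (e i k).prodMap (e' i k) with hE
  have hgl : IsGl E := by
    rintro i k l m ⟨a, b⟩
    have h1 := h.isGl i k l m a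
    have h2 := h'.isGl i k l m b
    simp only [hE, LinearMap.prodMap_apply]
    rw [h1, h2]
    ext <;> simp only [Prod.fst_sub, Prod.fst_add, Prod.snd_sub, Prod.snd_add] <;> split_ifs <;> rfl
  have hE1 : ∀ i k p, (E i k p).1 = e i k p.1 := fun _ _ _ => rfl
  have hE2 : ∀ i k p, (E i k p).2 = e' i k p.2 := fun _ _ _ => rfl
  have hp : IsHighest E μ (v, x) :=
    { ne_zero := fun h0 => hv.ne_zero (Prod.ext_iff.1 h0).1
      isWt := fun i => Prod.ext (hv.isWt i) (hx.isWt i)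
      raise_eq_zero := fun i k hik => Prod.ext (hv.raise_eq_zero i k hik) (hx.raise_eq_zero i k hik) }
  -- The submodule generated by `(v, x)` in the product is the graph of the isomorphism: it meets
  -- each factor trivially and projects onto each factor.
  set K := lowerSpan E (v, x)
  have hK : ∀ i k, ∀ p ∈ K, E i k p ∈ K := fun i k p hp' => hgl.lowerSpan_stable hp i k hp'
  have hmem : (v, x) ∈ K := self_mem_lowerSpan
  have hinl : ∀ y, (y, (0 : W)) ∈ K → y = 0 := by
    rcases h.simple (K.comap (LinearMap.inl ℂ V W)) (fun i k u hu => by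
      have := hK i k _ hu
      simpa [hE] using this) with h0 | h0
    · intro y hy
      have : y ∈ K.comap (LinearMap.inl ℂ V W) := hy
      rwa [h0, Submodule.mem_bot] at this
    -- Otherwise `K` contains `(v, 0)`, which has the height of `(v, x)` and so would be a multiple
    -- of it.
    · have h1 : v ∈ K.comap (LinearMap.inl ℂ V W) := h0 ▸ Submodule.mem_top
      have h2 : IsWt E μ (v, (0 : W)) := fun i => Prod.ext (hv.isWt i) (by simp [hE])
      obtain ⟨t, ht⟩ := hgl.eq_smul_of_mem_lowerSpan hp.isWt h1 h2.heightOp_apply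
      obtain ⟨h3, h4⟩ := Prod.ext_iff.1 ht
      rcases smul_eq_zero.1 (h4.symm : t • x = 0) with rfl | h5
      · exact absurd (by simpa using h3) hv.ne_zero
      · exact absurd h5 hx.ne_zero
  have hinr : ∀ y, ((0 : V), y) ∈ K → y = 0 := by
    rcases h'.simple (K.comap (LinearMap.inr ℂ V W)) (fun i k u hu => by
      have := hK i k _ hu
      simpa [hE] using this) with h0 | h0
    · intro y hy
      have : y ∈ K.comap (LinearMap.inr ℂ V W) := hy
      rwa [h0, Submodule.mem_bot] at this
    · have h1 : x ∈ K.comap (LinearMap.inr ℂ V W) := h0 ▸ Submodule.mem_top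
      have h2 : IsWt E μ ((0 : V), x) := fun i => Prod.ext (by simp [hE]) (hx.isWt i)
      obtain ⟨t, ht⟩ := hgl.eq_smul_of_mem_lowerSpan hp.isWt h1 h2.heightOp_apply
      obtain ⟨h3, h4⟩ := Prod.ext_iff.1 ht
      rcases smul_eq_zero.1 (h3.symm : t • v = 0) with rfl | h5
      · exact absurd (by simpa using h4) hx.ne_zero
      · exact absurd h5 hv.ne_zero
  set p1 : K →ₗ[ℂ] V := LinearMap.fst ℂ V W ∘ₗ K.subtype
  set p2 : K →ₗ[ℂ] W := LinearMap.snd ℂ V W ∘ₗ K.subtype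
  have b1 : Function.Bijective p1 := by
    constructor
    · rw [← LinearMap.ker_eq_bot, LinearMap.ker_eq_bot']
      rintro ⟨⟨a, b⟩, hab⟩ h0
      obtain rfl : a = 0 := h0
      obtain rfl := hinr b hab
      rfl
    · rw [← LinearMap.range_eq_top]
      refine (h.simple _ ?_).resolve_left ?_
      · rintro i k _ ⟨p, rfl⟩
        exact ⟨⟨_, hK i k _ p.2⟩, rfl⟩
      · intro h0
        have : v ∈ LinearMap.range p1 := ⟨⟨_, hmem⟩, rfl⟩
        rw [h0, Submodule.mem_bot] at this
        exact hv.ne_zero this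
  have b2 : Function.Bijective p2 := by
    constructor
    · rw [← LinearMap.ker_eq_bot, LinearMap.ker_eq_bot']
      rintro ⟨⟨a, b⟩, hab⟩ h0
      obtain rfl : b = 0 := h0
      obtain rfl := hinl a hab
      rfl
    · rw [← LinearMap.range_eq_top]
      refine (h'.simple _ ?_).resolve_left ?_
      · rintro i k _ ⟨p, rfl⟩
        exact ⟨⟨_, hK i k _ p.2⟩, rfl⟩
      · intro h0
        have : x ∈ LinearMap.range p2 := ⟨⟨_, hmem⟩, rfl⟩
        rw [h0, Submodule.mem_bot] at this
        exact hx.ne_zero this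
  refine ⟨(LinearEquiv.ofBijective p1 b1).symm.trans (LinearEquiv.ofBijective p2 b2), ?_⟩
  intro i k u
  obtain ⟨p, rfl⟩ := b1.2 u
  have h1 : e i k (p1 p) = p1 ⟨_, hK i k _ p.2⟩ := rfl
  have hs : ∀ q : K, (LinearEquiv.ofBijective p1 b1).symm (p1 q) = q :=
    fun q => (LinearEquiv.ofBijective p1 b1).symm_apply_apply q
  rw [h1, LinearEquiv.trans_apply, LinearEquiv.trans_apply, hs, hs]
  rfl

end Highest

end SlDegreeOne

namespace SlDegreeOne

/-! ### The possible highest weights. -/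

section Classification

variable {n : ℕ} {V : Type*} [AddCommGroup V] [Module ℂ V]
  {e : Fin (n + 1) → Fin (n + 1) → Module.End ℂ V} {μ : Fin (n + 1) → ℂ} {v w : V}

theorem IsGl.raise_eq_zero_of_simple (h : IsGl e)
    (hs : ∀ k : Fin n, e k.castSucc k.succ w = 0) : ∀ i k, i < k → e i k w = 0 := by
  have main : ∀ d : ℕ, ∀ i k : Fin (n + 1), k.val = i.val + d + 1 → e i k w = 0 := by
    intro d
    induction d with
    | zero =>
      intro i k hik
      have h1 := hs ⟨i.val, by omega⟩
      rwa [show (⟨i.val, by omega⟩ : Fin n).castSucc = i from rfl,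
        show (⟨i.val, by omega⟩ : Fin n).succ = k from Fin.ext (by simp [hik])] at h1
    | succ d ih =>
      intro i k hik
      obtain ⟨l, hl⟩ : ∃ l : Fin n, l.succ = k := ⟨⟨i.val + d + 1, by omega⟩, Fin.ext (by simp; omega)⟩
      have hl' : l.castSucc.val = i.val + d + 1 := by
        have := congrArg Fin.val hl
        simp at this ⊢
        omega
      have hki : k ≠ i := fun h0 => by rw [h0] at hik; omega
      have h1 := h i l.castSucc l.castSucc l.succ w
      rw [hs l, ih i _ hl', hl, if_pos rfl, if_neg hki] at h1
      simpa using h1.symm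
  exact fun i k hik => main (k.val - i.val - 1) i k (by have : i.val < k.val := hik; omega)

theorem SimpleDegreeOne.exists_nat_of_locNil (h : SimpleDegreeOne e) (hv : IsHighest e μ v)
    {i k : Fin (n + 1)} (hik : i < k) (hn : LocNil (e k i)) : ∃ m : ℕ, μ i - μ k = m := by
  obtain ⟨l, hl, hl'⟩ := exists_last hn hv.ne_zero
  refine ⟨l, ?_⟩
  have := h.string_eq (p := 0) hik.ne hv.ne_zero hv.isWt (by simpa using hv.ne_zero)
    (by simpa using hv.raise_eq_zero i k hik) hl hl'
  simpa using this

/-- The length of the lowering string of a singular vector is `μ i - μ k`, here zero. -/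
theorem SimpleDegreeOne.lower_eq_zero (h : SimpleDegreeOne e) (hv : IsHighest e μ v)
    {i k : Fin (n + 1)} (hik : i < k) (hn : LocNil (e k i)) (hμ : μ i = μ k) : e k i v = 0 := by
  obtain ⟨l, hl, hl'⟩ := exists_last hn hv.ne_zero
  have := h.string_eq (p := 0) hik.ne hv.ne_zero hv.isWt (by simpa using hv.ne_zero)
    (by simpa using hv.raise_eq_zero i k hik) hl hl'
  rw [hμ] at this
  have hl0 : l = 0 := by simpa using this.symm
  rw [hl0] at hl'
  simpa using hl'

/-- If the difference were `m`, the lowering operator at the break applied `m + 1` times to `v`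
would give a second singular vector: it is killed by the raising operator at the break by the string
formula, and by the other simple raising operators because they commute with this lowering operator.
Injectivity makes it nonzero, against `not_isHighest`. -/
theorem SimpleDegreeOne.sub_ne_nat (h : SimpleDegreeOne e) (hv : IsHighest e μ v) (J : Fin n)
    (hinj : ∀ w, e J.succ J.castSucc w = 0 → w = 0) (m : ℕ) :
    μ J.castSucc - μ J.succ ≠ m := by
  intro hm
  have hlt : J.castSucc < J.succ := Fin.castSucc_lt_succ
  set f := e J.succ J.castSucc with hf
  have hw := h.isGl.isWt_pow hv.isWt J.succ J.castSucc (m + 1)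
  have hne : ∀ q : ℕ, (f ^ q) v ≠ 0 := by
    intro q
    induction q with
    | zero => simpa using hv.ne_zero
    | succ q ih => rw [pow_succ', Module.End.mul_apply]; exact fun h0 => ih (hinj _ h0)
  have other : ∀ k : Fin n, k ≠ J → ∀ q : ℕ, e k.castSucc k.succ ((f ^ q) v) = 0 := by
    intro k hk q
    induction q with
    | zero => simpa using hv.raise_eq_zero _ _ (Fin.castSucc_lt_succ (i := k))
    | succ q ih =>
      rw [pow_succ', Module.End.mul_apply, hf, h.isGl, ih, map_zero,
        if_neg (fun h0 => hk (Fin.succ_injective _ h0)),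
        if_neg (fun h0 => hk (Fin.castSucc_injective _ h0).symm)]
      simp
  refine h.not_isHighest (ν := μ + ((m + 1 : ℕ) : ℂ) • root J.succ J.castSucc) (r := m) hv ?_
    ⟨hne (m + 1), hw, h.isGl.raise_eq_zero_of_simple fun k => ?_⟩
  · have : ∀ q : ℕ, height (μ + (q : ℂ) • root J.succ J.castSucc) = height μ + q := by
      intro q
      induction q with
      | zero => simp
      | succ q ih =>
        have := height_add_root (μ + (q : ℂ) • root J.succ J.castSucc) J.succ J.castSucc
        rw [ih] at this
        push_cast
        rw [add_smul, one_smul, ← add_assoc, this]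
        simp
        ring
    rw [this]
    push_cast
    ring
  · by_cases hk : k = J
    · subst hk
      have := h.isGl.lower_string hv.isWt hlt.ne (hv.raise_eq_zero _ _ hlt) m
      rw [hm, sub_self, mul_zero, zero_smul] at this
      exact this
    · exact other k hk _

section Triple

variable (h : SimpleDegreeOne e) (hv : IsHighest e μ v)
include h hv

theorem IsHighest.raise_lower {i k : Fin (n + 1)} (hik : i < k) :
    e i k (e k i v) = (μ i - μ k) • v := by
  rw [h.isGl.comm_opposite, hv.raise_eq_zero i k hik, hv.isWt i, hv.isWt k, map_zero, sub_smul]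
  abel

theorem IsHighest.lower_ne_zero {i k : Fin (n + 1)} (hik : i < k) (hμ : μ i ≠ μ k) :
    e k i v ≠ 0 := by
  intro h0
  have h1 := hv.raise_lower h hik
  rw [h0, map_zero, eq_comm, smul_eq_zero, sub_eq_zero] at h1
  exact h1.elim hμ hv.ne_zero

/-- The direct path `e q p v` and the two-step path `e q s (e s p v)` have the same weight, so the
second is `t` times the first. Applying `e s q` gives `t = μ s - μ q + 1`, applying `e p s` gives
`-t = μ p - μ s`, and adding eliminates `t`. -/
theorem IsHighest.exists_triple {p s q : Fin (n + 1)} (hps : p < s) (hsq : s < q)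
    (h1 : μ p ≠ μ s) (h2 : μ s ≠ μ q) :
    μ p - μ q = -1 ∧ e q s (e s p v) = -(μ p - μ s) • e q p v := by
  have hpq := hps.trans hsq
  have hsp0 := hv.lower_ne_zero h hps h1
  have hqs0 := hv.lower_ne_zero h hsq h2
  have ha : e s q (e q p v) = e s p v := by
    rw [h.isGl, hv.raise_eq_zero s q hsq]
    simp [hps.ne]
  have hqp0 : e q p v ≠ 0 := fun h0 => hsp0 (by rw [← ha, h0, map_zero])
  obtain ⟨t, ht⟩ := h.degree_one _ _ (e q s (e s p v)) hqp0 (h.isGl.isWt_root hv.isWt q p) (by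
    convert h.isGl.isWt_root (h.isGl.isWt_root hv.isWt s p) q s using 1
    simp only [root]; abel)
  have hb : e s q (e q s (e s p v)) = (μ s - μ q + 1) • e s p v := by
    have hw := h.isGl.isWt_root hv.isWt s p
    rw [h.isGl.comm_opposite, hw s, hw q, h.isGl s q s p, hv.raise_eq_zero s q hsq]
    simp [root, hps.ne, hps.ne', hsq.ne', hpq.ne']
    module
  have hc : e p s (e q p v) = -e q s v := by
    rw [h.isGl, hv.raise_eq_zero p s hps]
    simp [hsq.ne]
  have hd : e p s (e q s (e s p v)) = (μ p - μ s) • e q s v := by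
    rw [h.isGl, hv.raise_lower h hps]
    simp [hsq.ne, hps.ne']
  have t1 : t = μ s - μ q + 1 := by
    rw [ht, map_smul, ha] at hb
    exact smul_left_injective ℂ hsp0 hb
  have t2 : -t = μ p - μ s := by
    rw [ht, map_smul, hc, smul_neg, ← neg_smul] at hd
    exact smul_left_injective ℂ hqs0 hd
  refine ⟨by linear_combination -t1 - t2, ?_⟩
  rw [ht, ← t2, neg_neg]

/-- Applying `e p s'` to the proportionality in `exists_triple` kills the two-step path but sends
the direct path to `-e q s' v`, which is nonzero. A change of weight on both sides of a flat stretch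
is thus impossible. -/
theorem IsHighest.not_plateau {p s s' q : Fin (n + 1)} (hps : p < s) (hss : s < s') (hsq : s' < q)
    (hμ : μ s = μ s') (h1 : μ p ≠ μ s) (h2 : μ s ≠ μ q) : False := by
  obtain ⟨-, hd⟩ := hv.exists_triple h hps (hss.trans hsq) h1 h2
  have hps' := hps.trans hss
  have e1 : e p s' (e s p v) = -e s s' v := by
    rw [h.isGl, hv.raise_eq_zero p s' hps']
    simp [hss.ne']
  have e2 : e p s' (e q p v) = -e q s' v := by
    rw [h.isGl, hv.raise_eq_zero p s' hps']
    simp [hsq.ne]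
  have e3 : e p s' (e q s (e s p v)) = 0 := by
    rw [h.isGl, e1, hv.raise_eq_zero s s' hss]
    simp [hsq.ne, hps.ne']
  rw [hd, map_smul, e2, smul_neg, neg_eq_zero, smul_eq_zero, neg_eq_zero, sub_eq_zero] at e3
  exact e3.elim h1 (hv.lower_ne_zero h hsq (hμ ▸ h2))

/-- The two ways of pairing `{i, i'}` with `{k, k'}` give `e k i (e k' i' v)` and `e k i' (e k' i
v)`, of the same weight. With ratio `t` and `a = μ i - μ k`, applying `e i' k'` gives `t a = -1` and
applying `e i' k` gives `a = -t`. -/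
theorem IsHighest.sq_eq_one {i i' k k' : Fin (n + 1)} (hi : i < i') (hik : i' < k) (hk : k < k')
    (hμi : μ i = μ i') (hμk : μ k = μ k') (h1 : e i' i v = 0) (h2 : e k' k v = 0)
    (ha : μ i ≠ μ k) : (μ i - μ k) ^ 2 = 1 := by
  have l1 : i < k := hi.trans hik
  have l2 : i < k' := l1.trans hk
  have l3 : i' < k' := hik.trans hk
  have r1 : e i' k' (e k' i' v) = (μ i - μ k) • v := by
    rw [hv.raise_lower h l3, hμi, hμk]
  have r2 : e i' k (e k' i' v) = 0 := by
    rw [h.isGl, hv.raise_eq_zero i' k hik]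
    simp [hk.ne, h2]
  have r3 : e i' k' (e k' i v) = 0 := by
    rw [h.isGl, hv.raise_eq_zero i' k' l3]
    simp [hi.ne, h1]
  have r4 : e i' k (e k' i v) = 0 := by
    rw [h.isGl, hv.raise_eq_zero i' k hik]
    simp [hk.ne, hi.ne]
  have r5 : e k k' (e k' i v) = e k i v := by
    rw [h.isGl, hv.raise_eq_zero k k' hk]
    simp [l1.ne]
  have r6 : e i' i (e k' i' v) = -e k' i v := by
    rw [h.isGl, h1]
    simp [l2.ne]
  have hwt := h.isGl.isWt_root hv.isWt k' i
  have a1 : e i' k' (e k i (e k' i' v)) = (μ i - μ k) • e k i v := by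
    rw [h.isGl, r1]
    simp [hi.ne, hk.ne']
  have a2 : e i' k' (e k i' (e k' i v)) = -e k i v := by
    rw [h.isGl, r3, r5]
    simp [hk.ne']
  have a3 : e i' k (e k i (e k' i' v)) = -e k' i v := by
    rw [h.isGl, r2, r6]
    simp [hi.ne]
  have a4 : e i' k (e k i' (e k' i v)) = (μ i - μ k) • e k' i v := by
    rw [h.isGl, r4, hwt i', hwt k, hμi]
    simp [root, hi.ne', hk.ne, l1.ne', l3.ne]
    module
  have z1 : e k i v ≠ 0 := hv.lower_ne_zero h l1 ha
  have z2 : e k' i v ≠ 0 := hv.lower_ne_zero h l2 (hμk ▸ ha)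
  have z3 : e k i (e k' i' v) ≠ 0 := by
    intro h0
    rw [h0, map_zero, eq_comm, smul_eq_zero, sub_eq_zero] at a1
    exact a1.elim ha z1
  obtain ⟨t, ht⟩ := h.degree_one _ _ (e k i' (e k' i v)) z3
    (h.isGl.isWt_root (h.isGl.isWt_root hv.isWt k' i') k i) (by
      convert h.isGl.isWt_root (h.isGl.isWt_root hv.isWt k' i) k i' using 1
      simp only [root]; abel)
  rw [ht, map_smul, a1, smul_smul, ← neg_one_smul ℂ] at a2
  rw [ht, map_smul, a3, smul_neg, ← neg_smul] at a4
  have t1 := smul_left_injective ℂ z1 a2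
  have t2 := smul_left_injective ℂ z2 a4
  linear_combination -t1 - (μ i - μ k) * t2

end Triple

/-- The classification of the highest weights. -/
theorem SimpleDegreeOne.exists_parameter (h : SimpleDegreeOne e) (hn : 2 ≤ n) (J : Fin n)
    (hL : ∀ i k, i ≠ k → (i.val ≤ J.val ↔ k.val ≤ J.val) → LocNil (e i k))
    (hinj : ∀ w, e J.succ J.castSucc w = 0 → w = 0) (hv : IsHighest e μ v) :
    ∃ b ∈ parameters J, ∃ t : ℂ, ∀ i, μ i = b i + t := by
  set p := J.castSucc with hp
  set q := J.succ with hq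
  have hpv : p.val = J.val := rfl
  have hqv : q.val = J.val + 1 := rfl
  have hpq : p < q := Fin.castSucc_lt_succ
  have hnat := h.sub_ne_nat hv J hinj
  have hne : μ p ≠ μ q := fun h0 => hnat 0 (by rw [← hp, ← hq, h0]; simp)
  have dom : ∀ i k : Fin (n + 1), i < k → (i.val ≤ J.val ↔ k.val ≤ J.val) →
      ∃ m : ℕ, μ i - μ k = m := fun i k hik hb =>
    h.exists_nat_of_locNil hv hik (hL _ _ hik.ne' hb.symm)
  have low : ∀ i k : Fin (n + 1), i < k → (i.val ≤ J.val ↔ k.val ≤ J.val) → μ i = μ k →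
      e k i v = 0 := fun i k hik hb => h.lower_eq_zero hv hik (hL _ _ hik.ne' hb.symm)
  have hJ := J.isLt
  by_cases h2 : ∀ k, q < k → μ k = μ q
  · by_cases h1 : ∀ i, i < p → μ i = μ p
    · -- both blocks are constant
      have c1 : ∀ i : Fin (n + 1), i.val ≤ J.val → μ i = μ p := by
        intro i hi
        rcases lt_or_eq_of_le (show i ≤ p from hi) with h3 | rfl
        · exact h1 i h3
        · rfl
      have c2 : ∀ i : Fin (n + 1), J.val < i.val → μ i = μ q := by
        intro i hi
        rcases lt_or_eq_of_le (show q ≤ i from hi) with h3 | rfl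
        · exact h2 i h3
        · rfl
      by_cases j0 : J.val = 0
      · refine ⟨param n 0 (μ p - μ q), Or.inl ⟨j0, Or.inl ⟨_, hnat, rfl⟩⟩, μ q, fun i => ?_⟩
        unfold param
        by_cases hi : i.val = 0
        · rw [c1 i (by omega)]; simp [hi]
        · rw [c2 i (by omega)]; simp [hi]
      by_cases j1 : J.val = n - 1
      · refine ⟨param n n (-1 - (μ p - μ q)), Or.inr (Or.inl ⟨j1, Or.inl ⟨_, ?_, rfl⟩⟩), μ p + 1,
          fun i => ?_⟩
        · rintro ⟨m, hm⟩
          exact hnat m (by linear_combination -hm)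
        · unfold param
          by_cases hi : i.val < n
          · rw [c1 i (by omega), if_pos hi]; ring
          · rw [c2 i (by omega), if_neg hi, if_pos (by omega)]; ring
      · obtain ⟨p', hp'⟩ : ∃ p' : Fin (n + 1), p'.val + 1 = J.val :=
          ⟨⟨J.val - 1, by omega⟩, by show J.val - 1 + 1 = _; omega⟩
        obtain ⟨q', hq'⟩ : ∃ q' : Fin (n + 1), q'.val = J.val + 2 := ⟨⟨J.val + 2, by omega⟩, rfl⟩
        have lp : p' < p := by show p'.val < p.val; omega
        have lq : q < q' := by show q.val < q'.val; omega
        have hsq := hv.sq_eq_one h lp hpq lq (h1 _ lp) (h2 _ lq).symm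
          (low _ _ lp (by omega) (h1 _ lp)) (low _ _ lq (by omega) (h2 _ lq).symm)
          (by rwa [h1 _ lp])
        rw [h1 _ lp] at hsq
        -- Of the two solutions of `a ^ 2 = 1`, the value `1` is a natural number and is excluded by
        -- the injectivity at the break.
        have ha : μ p - μ q = -1 := by
          exact (sq_eq_sq_iff_eq_or_eq_neg.1 (hsq.trans (one_pow 2).symm)).resolve_left
            fun h0 => hnat 1 (by simpa using h0)
        refine ⟨param n (J.val + 1) (0 : ℕ), Or.inr (Or.inr ⟨by omega, by omega, 0, Or.inl rfl⟩),
          μ p + 1, fun i => ?_⟩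
        unfold param
        by_cases hi : i.val < J.val + 1
        · rw [c1 i (by omega), if_pos hi]; ring
        · rw [c2 i (by omega), if_neg hi]
          simp
          linear_combination -ha
    · -- the second block is constant, the first is not
      push Not at h1
      obtain ⟨i₀, hi₀, hne₀⟩ := h1
      have hi₀' : i₀.val < J.val := hi₀
      obtain ⟨p', hp'⟩ : ∃ p' : Fin (n + 1), p'.val + 1 = J.val :=
        ⟨⟨J.val - 1, by omega⟩, by show J.val - 1 + 1 = _; omega⟩
      have lp : p' < p := by show p'.val < p.val; omega
      -- The change inside the first block must occur at its last step; otherwise a flat stretch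
      -- would separate it from the change at the break.
      have hpp : μ p' ≠ μ p := by
        intro h0
        rcases lt_or_eq_of_le (show i₀ ≤ p' by show i₀.val ≤ p'.val; omega) with h3 | rfl
        · exact hv.not_plateau h h3 lp hpq h0 (h0 ▸ hne₀) (h0 ▸ hne)
        · exact hne₀ h0
      obtain ⟨m, hm⟩ := dom p' p lp (by omega)
      have e1 := (hv.exists_triple h lp hpq hpp hne).1
      have c1 : ∀ i, i < p → μ i = μ p' := by
        intro i hi
        rcases lt_or_eq_of_le (show i ≤ p' by
          have : i.val < p.val := hi
          show i.val ≤ p'.val; omega) with h3 | rfl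
        swap
        · rfl
        -- Equality is excluded by dominance between `i`, `p'` and `p`. In the other case the
        -- triples `(i, p, q)` and `(p', p, q)` both give difference `-1` to `μ q`.
        by_cases h4 : μ i = μ p
        · obtain ⟨m', hm'⟩ := dom i p' h3 (by omega)
          have h5 : ((m' + m : ℕ) : ℂ) = 0 := by push_cast; rw [← hm, ← hm', h4]; ring
          have h6 : m' + m = 0 := by exact_mod_cast h5
          have h7 : m = 0 := by omega
          rw [h7, Nat.cast_zero, sub_eq_zero] at hm
          exact absurd hm hpp
        · have := (hv.exists_triple h hi hpq h4 hne).1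
          linear_combination this - e1
      refine ⟨param n J.val (-1 - m), ?_, μ q, fun i => ?_⟩
      · by_cases j1 : J.val = n - 1
        · exact Or.inr (Or.inl ⟨j1, Or.inr ⟨m, by rw [j1]⟩⟩)
        · exact Or.inr (Or.inr ⟨by omega, by omega, m, Or.inr rfl⟩)
      · unfold param
        rcases lt_trichotomy i.val J.val with hi | hi | hi
        · rw [c1 i hi, if_pos hi]
          linear_combination e1
        · rw [show i = p from Fin.ext hi, if_neg (by omega), if_pos hpv]
          linear_combination e1 - hm
        · rw [if_neg (by omega), if_neg (by omega), zero_add]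
          rcases lt_or_eq_of_le (show q ≤ i from hi) with h3 | rfl
          · exact h2 i h3
          · rfl
  · -- the second block is not constant
    push Not at h2
    obtain ⟨i₀, hi₀, hne₀⟩ := h2
    have hi₀' : J.val + 1 < i₀.val := hi₀
    have hi₀n := i₀.isLt
    obtain ⟨q', hq'⟩ : ∃ q' : Fin (n + 1), q'.val = J.val + 2 := ⟨⟨J.val + 2, by omega⟩, rfl⟩
    have lq : q < q' := by show q.val < q'.val; omega
    have hqq : μ q ≠ μ q' := by
      intro h0
      rcases lt_or_eq_of_le (show q' ≤ i₀ by show q'.val ≤ i₀.val; omega) with h3 | rfl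
      · exact hv.not_plateau h hpq lq h3 h0 hne hne₀.symm
      · exact hne₀ h0.symm
    obtain ⟨m, hm⟩ := dom q q' lq (by omega)
    have e1 := (hv.exists_triple h hpq lq hne hqq).1
    have c2 : ∀ i, q < i → μ i = μ q' := by
      intro i hi
      rcases lt_or_eq_of_le (show q' ≤ i by
        have : q.val < i.val := hi
        show q'.val ≤ i.val; omega) with h3 | rfl
      swap
      · rfl
      by_cases h4 : μ q = μ i
      · have h3' : q'.val < i.val := h3
        obtain ⟨m', hm'⟩ := dom q' i h3 (by omega)
        have h5 : ((m' + m : ℕ) : ℂ) = 0 := by push_cast; rw [← hm, ← hm', h4]; ring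
        have h6 : m' + m = 0 := by exact_mod_cast h5
        have h7 : m = 0 := by omega
        rw [h7, Nat.cast_zero, sub_eq_zero] at hm
        exact absurd hm hqq
      · have := (hv.exists_triple h hpq hi hne h4).1
        linear_combination e1 - this
    have hpq' : μ p ≠ μ q' := fun h0 => by
      rw [h0, sub_self] at e1
      exact absurd e1 (by norm_num)
    -- A varying second block forces a constant first one: the triples `(i, p, q')` and `(p, q, q')`
    -- both give difference `-1` to `μ q'`.
    have c1 : ∀ i, i < p → μ i = μ p := by
      intro i hi
      by_contra h4
      have := (hv.exists_triple h hi (hpq.trans lq) h4 hpq').1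
      exact h4 (by linear_combination this - e1)
    refine ⟨param n (J.val + 1) m, ?_, μ q', fun i => ?_⟩
    · by_cases j0 : J.val = 0
      · exact Or.inl ⟨j0, Or.inr ⟨m, by rw [j0]⟩⟩
      · exact Or.inr (Or.inr ⟨by omega, by omega, m, Or.inl rfl⟩)
    · unfold param
      rcases lt_trichotomy i.val (J.val + 1) with hi | hi | hi
      · rw [if_pos hi]
        rcases lt_or_eq_of_le (show i ≤ p by show i.val ≤ p.val; omega) with h3 | h3
        · rw [c1 i h3]
          linear_combination e1
        · rw [h3]
          linear_combination e1
      · rw [show i = q from Fin.ext hi, if_neg (by omega), if_pos hqv]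
        linear_combination hm
      · rw [if_neg (by omega), if_neg (by omega), zero_add]
        exact c2 i hi

end Classification

end SlDegreeOne

namespace SlDegreeOne

/-! ### From modules over `sl(n+1)` to actions of the matrix units of `gl(n+1)`. -/

noncomputable section LieAction

variable {n : ℕ}

/-- The projection of `gl(n+1, ℂ)` onto `sl(n+1, ℂ)`. -/
def slProj : Matrix (Fin (n + 1)) (Fin (n + 1)) ℂ →ₗ[ℂ] sl n where
  toFun A := ⟨A - (A.trace / (n + 1)) • (1 : Matrix (Fin (n + 1)) (Fin (n + 1)) ℂ), by
    show (A - (A.trace / (n + 1)) • (1 : Matrix (Fin (n + 1)) (Fin (n + 1)) ℂ)).trace = 0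
    have : (n + 1 : ℂ) ≠ 0 := by exact_mod_cast Nat.succ_ne_zero n
    simp [Matrix.trace_sub, Matrix.trace_smul, Matrix.trace_one]
    field_simp
    simp⟩
  map_add' A B := by
    apply Subtype.ext
    simp only [Matrix.trace_add, add_div, add_smul]
    show _ = (_ - _) + (_ - _)
    abel
  map_smul' t A := by
    apply Subtype.ext
    simp only [Matrix.trace_smul, smul_eq_mul, mul_div_assoc, mul_smul]
    show _ = t • (_ - _)
    rw [smul_sub]

theorem slProj_val (A : Matrix (Fin (n + 1)) (Fin (n + 1)) ℂ) :
    (slProj A).val = A - (A.trace / (n + 1)) • (1 : Matrix (Fin (n + 1)) (Fin (n + 1)) ℂ) := rfl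

theorem slProj_of_trace_eq_zero {A : Matrix (Fin (n + 1)) (Fin (n + 1)) ℂ} (hA : A.trace = 0) :
    (slProj A).val = A := by simp [slProj_val, hA]

theorem slProj_self (X : sl n) : slProj X.val = X :=
  Subtype.ext (slProj_of_trace_eq_zero X.2)

theorem slProj_lie (A B : Matrix (Fin (n + 1)) (Fin (n + 1)) ℂ) :
    ⁅slProj A, slProj B⁆ = slProj (A * B - B * A) := by
  apply Subtype.ext
  have h : (A * B - B * A).trace = 0 := by rw [Matrix.trace_sub, Matrix.trace_mul_comm, sub_self]
  rw [sl_bracket_val, slProj_of_trace_eq_zero h, slProj_val, slProj_val]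
  simp only [sub_mul, mul_sub, smul_mul_assoc, mul_smul_comm, one_mul, mul_one]
  simp only [smul_sub]
  rw [smul_comm (A.trace / (n + 1 : ℂ)) (B.trace / (n + 1 : ℂ))]
  abel

/-- The image in `sl(n+1, ℂ)` of a matrix unit. -/
def unit (i k : Fin (n + 1)) : sl n := slProj (Matrix.single i k 1)

theorem unit_lie (i k l m : Fin (n + 1)) :
    ⁅unit i k, unit l m⁆ = (if k = l then unit i m else 0) - (if m = i then unit l k else 0) := by
  rw [unit, unit, slProj_lie, map_sub]
  congr 1
  · split_ifs with h
    · subst h; simp [unit]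
    · rw [Matrix.single_mul_single_of_ne _ _ _ _ h, map_zero]
  · split_ifs with h
    · subst h; simp [unit]
    · rw [Matrix.single_mul_single_of_ne _ _ _ _ h, map_zero]

theorem unit_of_ne {i k : Fin (n + 1)} (h : i ≠ k) :
    unit i k = LieAlgebra.SpecialLinear.single i k h 1 := by
  apply Subtype.ext
  rw [unit, slProj_of_trace_eq_zero (Matrix.trace_single_eq_of_ne _ _ _ h)]
  rfl

theorem unit_self_mem_cartan (i : Fin (n + 1)) : unit i i ∈ cartan n := by
  show (unit i i).val.IsDiag
  intro a b hab
  have : ¬ (i = a ∧ i = b) := fun h => hab (h.1.symm.trans h.2)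
  simp [unit, slProj_val, this, Matrix.one_apply_ne hab]

theorem unit_self_apply (i k : Fin (n + 1)) :
    (unit i i).val k k = (if i = k then 1 else 0) - 1 / (n + 1) := by
  simp [unit, slProj_val, Matrix.single_apply]

theorem eq_sum_unit (X : sl n) : X = ∑ i, ∑ k, X.val i k • unit i k := by
  conv_lhs => rw [← slProj_self X, Matrix.matrix_eq_sum_single X.val]
  rw [map_sum]
  refine Finset.sum_congr rfl fun i _ => ?_
  rw [map_sum]
  refine Finset.sum_congr rfl fun k _ => ?_
  rw [unit, ← map_smul, Matrix.smul_single, smul_eq_mul, mul_one]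

/-- The linear form on the Cartan subalgebra with coordinates `μ`. -/
def weightOf (μ : Fin (n + 1) → ℂ) : Module.Dual ℂ (cartan n) where
  toFun H := ∑ i, H.val.val i i * μ i
  map_add' H K := by
    rw [← Finset.sum_add_distrib]
    exact Finset.sum_congr rfl fun i _ => add_mul _ _ _
  map_smul' t H := by
    rw [RingHom.id_apply, smul_eq_mul, Finset.mul_sum]
    exact Finset.sum_congr rfl fun i _ => mul_assoc _ _ _

theorem weightOf_unit (μ : Fin (n + 1) → ℂ) (i : Fin (n + 1)) :
    weightOf μ ⟨unit i i, unit_self_mem_cartan i⟩ = μ i - (∑ k, μ k) / (n + 1) := by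
  show ∑ k, (unit i i).val k k * μ k = _
  simp only [unit_self_apply, sub_mul, Finset.sum_sub_distrib, ← Finset.mul_sum]
  simp
  ring

/-- On traceless diagonal matrices, coordinates matter only up to a common constant; sum zero is the
normalization that fixes it. -/
theorem weightOf_injOn : Set.InjOn (weightOf (n := n)) {μ | ∑ i, μ i = 0} := by
  intro μ hμ ν hν h
  ext i
  have h1 := weightOf_unit μ i
  rw [h, weightOf_unit, hμ, hν] at h1
  simpa using h1.symm

section Module

variable (n) (V : Type*) [AddCommGroup V] [Module ℂ V] [LieRingModule (sl n) V]
  [LieModule ℂ (sl n) V]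

/-- The action of the matrix units of `gl(n+1, ℂ)` through the projection onto `sl(n+1, ℂ)`. -/
def eAct (i k : Fin (n + 1)) : Module.End ℂ V := LieModule.toEnd ℂ (sl n) V (unit i k)

variable {n V}

theorem eAct_apply (i k : Fin (n + 1)) (v : V) : eAct n V i k v = ⁅unit i k, v⁆ := rfl

theorem lie_eq_sum (X : sl n) (v : V) : ⁅X, v⁆ = ∑ i, ∑ k, X.val i k • eAct n V i k v := by
  conv_lhs => rw [eq_sum_unit X]
  simp only [sum_lie, smul_lie, eAct_apply]

theorem isGl_eAct : IsGl (eAct n V) := by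
  intro i k l m v
  simp only [eAct_apply]
  rw [leibniz_lie, unit_lie, sub_lie]
  have : ∀ (p : Prop) [Decidable p] (X : sl n), ⁅(if p then X else 0), v⁆ = if p then ⁅X, v⁆ else 0 := by
    intro p _ X
    split_ifs
    · rfl
    · exact zero_lie _
  rw [this, this]
  abel

theorem IsWt.lie_cartan {μ : Fin (n + 1) → ℂ} {v : V} (hv : IsWt (eAct n V) μ v) (H : cartan n) :
    ⁅H.val, v⁆ = weightOf μ H • v := by
  have hd : ∀ i k, i ≠ k → H.val.val i k = 0 := fun i k hik => H.2 hik
  rw [lie_eq_sum]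
  show _ = (∑ i, H.val.val i i * μ i) • v
  rw [Finset.sum_smul]
  refine Finset.sum_congr rfl fun i _ => ?_
  rw [Finset.sum_eq_single i, hv i, smul_smul]
  · intro k _ hk
    rw [hd i k hk.symm, zero_smul]
  · simp

theorem IsWt.mem_wtSpace {μ : Fin (n + 1) → ℂ} {v : V} (hv : IsWt (eAct n V) μ v) :
    v ∈ wtSpace n V (weightOf μ) := by
  rw [LieModule.mem_weightSpace]
  exact fun H => hv.lie_cartan H

theorem isWt_of_mem_wtSpace {χ : Module.Dual ℂ (cartan n)} {v : V} (hv : v ∈ wtSpace n V χ) :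
    IsWt (eAct n V) (fun i => χ ⟨unit i i, unit_self_mem_cartan i⟩) v := by
  rw [LieModule.mem_weightSpace] at hv
  exact fun i => hv ⟨unit i i, unit_self_mem_cartan i⟩

/-- A subspace stable under the matrix units is a Lie submodule. -/
def lieSubmoduleOfStable (U : Submodule ℂ V) (hU : ∀ i k, ∀ u ∈ U, eAct n V i k u ∈ U) :
    LieSubmodule ℂ (sl n) V :=
  { U with
    lie_mem := by
      intro X u hu
      show ⁅X, u⁆ ∈ U
      rw [lie_eq_sum]
      exact U.sum_mem fun i _ => U.sum_mem fun k _ => U.smul_mem _ (hU i k u hu) }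

theorem rank_wtSpace_le_one (hd : degree n V = 1) (χ : Module.Dual ℂ (cartan n)) :
    Module.rank ℂ (wtSpace n V χ) ≤ 1 := by
  have h1 : Cardinal.toENat (Module.rank ℂ (wtSpace n V χ)) ≤ 1 :=
    hd ▸ le_iSup (fun χ => Cardinal.toENat (Module.rank ℂ (wtSpace n V χ))) χ
  exact Cardinal.toENat_le_one.1 h1

theorem simpleDegreeOne_eAct (hs : LieModule.IsIrreducible ℂ (sl n) V) (hw : IsWeightModule n V)
    (hd : degree n V = 1) : SimpleDegreeOne (eAct n V) where
  isGl := isGl_eAct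
  nontrivial := by
    by_contra hcon
    push Not at hcon
    obtain ⟨N, N', hN⟩ := hs.toNontrivial
    exact hN (LieSubmodule.ext _ _ fun v => by rw [hcon v]; simp)
  simple U hU := by
    rcases hs.eq_bot_or_eq_top (lieSubmoduleOfStable U hU) with h | h
    · left
      exact congrArg LieSubmodule.toSubmodule h
    · right
      exact congrArg LieSubmodule.toSubmodule h
  span_eq_top := by
    classical
    rw [eq_top_iff, ← hw.isInternal.submodule_iSup_eq_top, iSup_le_iff]
    intro χ v hv
    exact Submodule.subset_span ⟨_, isWt_of_mem_wtSpace hv⟩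
  degree_one μ v w hv0 hv hw' := by
    obtain ⟨v₀, h⟩ := rank_le_one_iff.1 (rank_wtSpace_le_one hd (weightOf μ))
    obtain ⟨r, hr⟩ := h ⟨v, hv.mem_wtSpace⟩
    obtain ⟨s, hs⟩ := h ⟨w, hw'.mem_wtSpace⟩
    have hr' : r • (v₀ : V) = v := congrArg Subtype.val hr
    have hs' : s • (v₀ : V) = w := congrArg Subtype.val hs
    have hr0 : r ≠ 0 := by
      rintro rfl
      exact hv0 (by rw [← hr', zero_smul])
    exact ⟨s * r⁻¹, by rw [← hr', ← hs', smul_smul, inv_mul_cancel_right₀ hr0]⟩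

end Module

section Twist

variable {V : Type*} [AddCommGroup V] [Module ℂ V]
  {e : Fin (n + 1) → Fin (n + 1) → Module.End ℂ V}

/-- For the order-reversing permutation this exchanges raising and lowering operators, so lowest
weight modules need no separate treatment. -/
theorem SimpleDegreeOne.twist (h : SimpleDegreeOne e) (σ : Equiv.Perm (Fin (n + 1))) :
    SimpleDegreeOne fun i k => e (σ i) (σ k) where
  isGl i k l m v := by
    rw [h.isGl]
    simp
  nontrivial := h.nontrivial
  simple U hU := h.simple U fun i k u hu => by simpa using hU (σ.symm i) (σ.symm k) u hu
  span_eq_top := by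
    rw [eq_top_iff, ← h.span_eq_top]
    refine Submodule.span_mono ?_
    rintro v ⟨μ, hv⟩
    exact ⟨μ ∘ σ, fun i => hv (σ i)⟩
  degree_one μ v w hv0 hv hw := by
    refine h.degree_one (μ ∘ σ.symm) v w hv0 (fun i => ?_) fun i => ?_
    · simpa using hv (σ.symm i)
    · simpa using hw (σ.symm i)

end Twist

end LieAction

end SlDegreeOne

namespace SlDegreeOne

/-! ### Modules with a monomial basis: simplicity, weights, degree. -/

noncomputable section MonomialBasis

variable {n : ℕ} {V : Type*} [AddCommGroup V] [Module ℂ V]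

section Basis

variable {b : Fin (n + 1) → ℂ} {B : Module.Basis (exponents b) ℂ V}

theorem mem_of_forall_mem {U : Submodule ℂ V} {u : V} (h : ∀ c, B.repr u c ≠ 0 → B c ∈ U) :
    u ∈ U := by
  rw [← B.linearCombination_repr u, Finsupp.linearCombination_apply, Finsupp.sum]
  exact U.sum_mem fun c hc => U.smul_mem _ (h c (Finsupp.mem_support_iff.1 hc))

theorem exists_repr_ne_zero {u : V} (hu : u ≠ 0) : ∃ c, B.repr u c ≠ 0 := by
  by_contra hcon
  push Not at hcon
  exact hu (B.repr.map_eq_zero_iff.1 (Finsupp.ext hcon))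

/-- The module is infinite-dimensional unless all exponents are bounded on the same side. -/
theorem not_finiteDimensional (B : Module.Basis (exponents b) ℂ V) {i k : Fin (n + 1)}
    (hi : ¬ IsNegInt (b i)) (hk : ∀ m : ℕ, b k ≠ m) (hik : i ≠ k) : ¬ FiniteDimensional ℂ V := by
  intro hfd
  have hfin : Finite (exponents b) := Module.Finite.finite_basis B
  -- Increasing a coordinate that is not a negative integer, or decreasing one that is not a natural
  -- number, never crosses between `-1` and `0`.
  have hmem : ∀ t : ℕ, b + (t : ℂ) • root i k ∈ exponents b := by
    intro t
    refine ⟨fun l => ⟨t * ((if l = i then 1 else 0) - (if l = k then 1 else 0)), ?_⟩, ?_,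
      fun l => ?_⟩
    · simp [root, Pi.single_apply]
    · simp only [Pi.add_apply, Pi.smul_apply, smul_eq_mul, Finset.sum_add_distrib,
        ← Finset.mul_sum, root, Pi.sub_apply, Finset.sum_sub_distrib]
      simp
    · rcases eq_or_ne l i with rfl | hli
      · have h1 : (b + (t : ℂ) • root l k) l = b l + t := by simp [root, hik]
        rw [h1]
        refine ⟨fun ⟨m, hm⟩ => ?_, fun h => absurd h hi⟩
        exact absurd ⟨m + t, by push_cast; linear_combination hm⟩ hi
      · rcases eq_or_ne l k with rfl | hlk
        · have h1 : (b + (t : ℂ) • root i l) l = b l - t := by simp [root, hik]; ring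
          rw [h1]
          constructor
          · rintro ⟨m, hm⟩
            by_cases hmt : m + 1 ≤ t
            · refine absurd ?_ (hk (t - (m + 1)))
              rw [Nat.cast_sub hmt]
              push_cast
              linear_combination hm
            · refine ⟨m - t, ?_⟩
              rw [Nat.cast_sub (by omega)]
              linear_combination hm
          · rintro ⟨m, hm⟩
            exact ⟨m + t, by rw [hm]; push_cast; ring⟩
        · have h1 : (b + (t : ℂ) • root i k) l = b l := by simp [root, hli, hlk]
          rw [h1]
  have hinj : Function.Injective fun t : ℕ => (⟨_, hmem t⟩ : exponents b) := by
    intro t t' h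
    have h1 := congrFun (congrArg Subtype.val h) i
    simpa [root, hik] using h1
  exact not_injective_infinite_finite _ hinj

end Basis

variable [LieRingModule (sl n) V] [LieModule ℂ (sl n) V]

/-- The weight of the monomial `x(c)`, with coordinates normalized to have sum zero. -/
def monWeight (b c : Fin (n + 1) → ℂ) : Fin (n + 1) → ℂ := fun i => c i - (∑ l, b l) / (n + 1)

/-- The exponent `c - ε_k + ε_i`. -/
def shift (c : Fin (n + 1) → ℂ) (i k : Fin (n + 1)) : Fin (n + 1) → ℂ :=
  c - Pi.single k 1 + Pi.single i 1

/-- A basis on which the Lie algebra acts by the formulas that define `N(b)`. -/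
structure IsMonomialBasis (b : Fin (n + 1) → ℂ) (B : Module.Basis (exponents b) ℂ V) : Prop where
  isWt : ∀ c : exponents b, IsWt (eAct n V) (monWeight b c) (B c)
  apply_of_mem : ∀ i k, i ≠ k → ∀ c : exponents b, ∀ h : shift c i k ∈ exponents b,
    eAct n V i k (B c) = c.1 k • B ⟨_, h⟩
  apply_of_notMem : ∀ i k, i ≠ k → ∀ c : exponents b, shift c i k ∉ exponents b →
    eAct n V i k (B c) = 0

variable {b : Fin (n + 1) → ℂ} {B : Module.Basis (exponents b) ℂ V}

theorem self_mem_exponents (b : Fin (n + 1) → ℂ) : b ∈ exponents b :=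
  ⟨fun _ => ⟨0, by simp⟩, rfl, fun _ => Iff.rfl⟩

theorem sum_monWeight {c : Fin (n + 1) → ℂ} (hc : c ∈ exponents b) : ∑ i, monWeight b c i = 0 := by
  have : (n + 1 : ℂ) ≠ 0 := by exact_mod_cast Nat.succ_ne_zero n
  simp only [monWeight, Finset.sum_sub_distrib, hc.2.1]
  simp
  field_simp
  simp

theorem monWeight_injective (b : Fin (n + 1) → ℂ) : Function.Injective (monWeight b) := by
  intro c c' h
  ext i
  simpa [monWeight] using congrFun h i

namespace IsMonomialBasis

variable (hB : IsMonomialBasis b B)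
include hB

theorem repr_diag (i : Fin (n + 1)) (u : V) (d : exponents b) :
    B.repr (eAct n V i i u) d = monWeight b d i * B.repr u d := by
  have : Finsupp.lapply d ∘ₗ B.repr.toLinearMap ∘ₗ eAct n V i i
      = monWeight b d i • (Finsupp.lapply d ∘ₗ B.repr.toLinearMap) := by
    refine B.ext fun c => ?_
    simp only [LinearMap.comp_apply, LinearMap.smul_apply, hB.isWt c i, map_smul,
      LinearEquiv.coe_coe, Module.Basis.repr_self, Finsupp.lapply_apply, Finsupp.single_apply]
    split_ifs with h
    · rw [h]
    · simp
  exact LinearMap.congr_fun this u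

/-- A nonzero subspace stable under the diagonal operators contains a basis vector. -/
theorem exists_mem {U : Submodule ℂ V} (hU : ∀ i, ∀ u ∈ U, eAct n V i i u ∈ U) {u : V}
    (hu : u ∈ U) {d : exponents b} (hd : B.repr u d ≠ 0) : ∃ c, B c ∈ U := by
  -- Applying `e i i` minus the weight of `c` removes `c` from the support of `u` and keeps `d`, for
  -- an `i` at which `c` and `d` differ.
  induction h : (B.repr u).support.card using Nat.strong_induction_on generalizing u d with
  | _ N ih =>
    by_cases hone : ∃ c, B.repr u c ≠ 0 ∧ c ≠ d
    · obtain ⟨c, hc, hcd⟩ := hone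
      obtain ⟨i, hi⟩ : ∃ i, c.1 i ≠ d.1 i := by
        by_contra hcon
        push Not at hcon
        exact hcd (Subtype.ext (funext hcon))
      have hr : ∀ x, B.repr (eAct n V i i u - monWeight b c i • u) x
          = (monWeight b x i - monWeight b c i) * B.repr u x := by
        intro x
        rw [map_sub, map_smul, Finsupp.sub_apply, Finsupp.smul_apply, hB.repr_diag, smul_eq_mul,
          sub_mul]
      refine ih _ ?_ (U.sub_mem (hU i u hu) (U.smul_mem (monWeight b c i) hu)) (d := d) ?_ rfl
      · rw [← h]
        refine Finset.card_lt_card (Finset.ssubset_iff_subset_ne.2 ⟨fun x hx => ?_, fun heq => ?_⟩)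
        · rw [Finsupp.mem_support_iff, hr] at hx
          exact Finsupp.mem_support_iff.2 (right_ne_zero_of_mul hx)
        · have h1 : c ∈ (B.repr u).support := Finsupp.mem_support_iff.2 hc
          rw [← heq, Finsupp.mem_support_iff, hr, sub_self, zero_mul] at h1
          exact h1 rfl
      · rw [hr]
        refine mul_ne_zero (fun h0 => hi ?_) hd
        simp only [monWeight] at h0
        linear_combination -h0
    · push Not at hone
      refine ⟨d, ?_⟩
      have h1 : u = B.repr u d • B d := by
        apply B.repr.injective
        ext x
        rw [map_smul, B.repr_self, Finsupp.smul_apply, Finsupp.single_apply]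
        by_cases hx : B.repr u x = 0
        · rw [hx]
          by_cases hxd : d = x
          · subst hxd; exact absurd hx hd
          · simp [hxd]
        · rw [hone x hx]
          simp
      have h2 : B d = (B.repr u d)⁻¹ • u := by
        conv_rhs => rw [h1]
        simp [smul_smul, inv_mul_cancel₀ hd]
      rw [h2]
      exact U.smul_mem _ hu

/-- Basis vectors whose exponents have the same sums over the blocks of a partition `β` generate
one another under the matrix units of the blocks. -/
theorem mem_of_mem {κ : Type*} [DecidableEq κ] (β : Fin (n + 1) → κ) {U : Submodule ℂ V}
    (hU : ∀ i k, β i = β k → ∀ u ∈ U, eAct n V i k u ∈ U) {c c' : exponents b} (hc : B c ∈ U)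
    (hs : ∀ x, ∑ i with β i = x, c.1 i = ∑ i with β i = x, c'.1 i) : B c' ∈ U := by
  obtain ⟨z, hz⟩ : ∃ z : Fin (n + 1) → ℤ, ∀ i, c'.1 i = c.1 i + z i := by
    choose y hy using c.2.1
    choose y' hy' using c'.2.1
    exact ⟨fun i => y' i - y i, fun i => by rw [hy, hy']; push_cast; ring⟩
  -- Induction on the distance between the exponents: one unit is moved inside a block from a
  -- coordinate `k` that is too large to a coordinate `i` that is too small.
  induction h : ∑ i, (z i).natAbs using Nat.strong_induction_on generalizing c z with
  | _ N ih =>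
    by_cases h0 : ∀ i, z i = 0
    · rwa [show c' = c from Subtype.ext (funext fun i => by rw [hz, h0]; simp)]
    push Not at h0
    obtain ⟨l, hl⟩ := h0
    have hzs : ∑ i with β i = β l, z i = 0 := by
      have h1 := hs (β l)
      simp only [hz, Finset.sum_add_distrib] at h1
      exact_mod_cast (left_eq_add.1 h1)
    have hlm : l ∈ ({i | β i = β l} : Finset (Fin (n + 1))) := by simp
    obtain ⟨i, hi, hzi⟩ := Finset.exists_pos_of_sum_zero_of_exists_nonzero z hzs ⟨l, hlm, hl⟩
    obtain ⟨k, hk, hzk⟩ := Finset.exists_pos_of_sum_zero_of_exists_nonzero (fun i => -z i)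
      (by rw [Finset.sum_neg_distrib, hzs, neg_zero]) ⟨l, hlm, neg_ne_zero.2 hl⟩
    simp only [Finset.mem_filter, Finset.mem_univ, true_and] at hi hk
    have hik : i ≠ k := by rintro rfl; omega
    -- The move has a nonzero coefficient and stays in the module: `c k = 0` with `c' k < 0`, or `c
    -- i = -1` with `c' i ≥ 0`, would mean a change in the positions of the negative integers.
    have hck : c.1 k ≠ 0 := by
      intro hck
      obtain ⟨m, hm⟩ : ∃ m : ℕ, z k = -(m + 1 : ℤ) := ⟨(-z k - 1).toNat, by omega⟩
      have h1 : IsNegInt (c'.1 k) := ⟨m, by rw [hz, hck, hm]; push_cast; ring⟩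
      obtain ⟨m', hm'⟩ := (c.2.2.2 k).2 ((c'.2.2.2 k).1 h1)
      rw [hck] at hm'
      have : ((m' + 1 : ℕ) : ℂ) = 0 := by push_cast; linear_combination hm'
      exact absurd this (by exact_mod_cast Nat.succ_ne_zero m')
    have hci : (c.1 - Pi.single k 1 : Fin (n + 1) → ℂ) i ≠ -1 := by
      intro hci
      have hci' : c.1 i = -1 := by simpa [hik] using hci
      obtain ⟨m, hm⟩ := (c'.2.2.2 i).2 ((c.2.2.2 i).1 ⟨0, by simp [hci']⟩)
      rw [hz, hci'] at hm
      have h1 : ((z i + m : ℤ) : ℂ) = ((0 : ℤ) : ℂ) := by push_cast; linear_combination hm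
      have h2 : z i + m = 0 := by exact_mod_cast h1
      omega
    have hmem : shift c i k ∈ exponents b := exponents_shift c.2 hck hci
    have h1 : B ⟨_, hmem⟩ ∈ U := by
      have h2 := hU i k (hi.trans hk.symm) _ hc
      rw [hB.apply_of_mem i k hik c hmem] at h2
      exact (U.smul_mem_iff hck).1 h2
    refine ih _ ?_ h1 (fun x => ?_) (fun l => z l + (if l = k then 1 else 0) -
      (if l = i then 1 else 0)) (fun l => ?_) rfl
    · rw [← h]
      refine Finset.sum_lt_sum (fun l _ => ?_) ⟨i, Finset.mem_univ i, ?_⟩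
      · by_cases h3 : l = k
        · subst h3; simp [hik.symm]; omega
        · by_cases h4 : l = i
          · subst h4; simp [h3]; omega
          · simp [h3, h4]
      · simp [hik]; omega
    · rw [← hs x]
      simp only [shift, Pi.add_apply, Pi.sub_apply, Finset.sum_add_distrib,
        Finset.sum_sub_distrib]
      simp [hi, hk]
    · show c'.1 l = shift c.1 i k l + _
      rw [hz]
      simp only [shift, Pi.add_apply, Pi.sub_apply, Pi.single_apply]
      push_cast
      ring

theorem eq_top_of_ne_zero {U : Submodule ℂ V} (hU : ∀ i k, ∀ u ∈ U, eAct n V i k u ∈ U) {u : V}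
    (hu : u ∈ U) (h0 : u ≠ 0) : U = ⊤ := by
  obtain ⟨d, hd⟩ := exists_repr_ne_zero (B := B) h0
  obtain ⟨c, hc⟩ := hB.exists_mem (fun i => hU i i) hu hd
  refine eq_top_iff.2 fun w _ => mem_of_forall_mem (B := B) fun c' _ => ?_
  refine hB.mem_of_mem (fun _ => ()) (fun i k _ => hU i k) hc fun x => ?_
  simp [c.2.2.1, c'.2.2.1]

theorem isIrreducible : LieModule.IsIrreducible ℂ (sl n) V where
  exists_pair_ne := by
    refine ⟨⊥, ⊤, fun h => B.ne_zero ⟨b, self_mem_exponents b⟩ ?_⟩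
    have : B ⟨b, self_mem_exponents b⟩ ∈ (⊥ : LieSubmodule ℂ (sl n) V) := h ▸ LieSubmodule.mem_top _
    simpa using this
  eq_bot_or_eq_top N := by
    by_cases h : ∃ u ∈ N, u ≠ 0
    · right
      obtain ⟨u, hu, h0⟩ := h
      have := hB.eq_top_of_ne_zero (U := N.toSubmodule) (fun i k u hu => N.lie_mem hu) hu h0
      exact (LieSubmodule.toSubmodule_eq_top N).1 this
    · left
      push Not at h
      exact (LieSubmodule.eq_bot_iff _).2 h

theorem eq_of_isWt {μ : Fin (n + 1) → ℂ} {u : V} (hu : IsWt (eAct n V) μ u) {d : exponents b}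
    (hd : B.repr u d ≠ 0) : monWeight b d = μ := by
  ext i
  have h1 := hB.repr_diag i u d
  rw [hu i, map_smul, Finsupp.smul_apply, smul_eq_mul] at h1
  exact (mul_right_cancel₀ hd h1).symm

theorem rank_le_one (χ : Module.Dual ℂ (cartan n)) : Module.rank ℂ (wtSpace n V χ) ≤ 1 := by
  rw [rank_le_one_iff]
  by_cases h : ∃ v : wtSpace n V χ, v ≠ 0
  · obtain ⟨v, hv⟩ := h
    refine ⟨v, fun w => ?_⟩
    obtain ⟨d, hd⟩ := exists_repr_ne_zero (B := B) (u := v) (fun h => hv (Subtype.ext h))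
    have hone : ∀ u ∈ wtSpace n V χ, u = B.repr u d • B d := by
      intro u hu
      apply B.repr.injective
      ext x
      rw [map_smul, B.repr_self, Finsupp.smul_apply, Finsupp.single_apply]
      by_cases hx : d = x
      · simp [hx]
      · by_contra h0
        have h0' : B.repr u x ≠ 0 := by simpa [hx] using h0
        have h1 := (hB.eq_of_isWt (isWt_of_mem_wtSpace v.2) hd).trans
          (hB.eq_of_isWt (isWt_of_mem_wtSpace hu) h0').symm
        exact hx (Subtype.ext (monWeight_injective b h1))
    refine ⟨B.repr w d * (B.repr v d)⁻¹, Subtype.ext ?_⟩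
    show (B.repr w d * (B.repr v d)⁻¹) • (v : V) = w
    rw [hone w w.2]
    conv_lhs => rw [hone v v.2]
    simp [smul_smul, inv_mul_cancel₀ hd, mul_assoc]
  · push Not at h
    exact ⟨0, fun v => ⟨0, by rw [h v, zero_smul]⟩⟩

theorem degree_eq_one : degree n V = 1 := by
  refine le_antisymm (iSup_le fun χ => Cardinal.toENat_le_one.2 (hB.rank_le_one χ)) ?_
  have h1 := (hB.isWt ⟨b, self_mem_exponents b⟩).mem_wtSpace
  refine le_trans ?_ (le_iSup _ (weightOf (monWeight b b)))
  have : Nontrivial (wtSpace n V (weightOf (monWeight b b))) :=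
    ⟨⟨_, h1⟩, 0, fun h => B.ne_zero _ (congrArg Subtype.val h)⟩
  exact Cardinal.one_le_toENat.2 (Cardinal.one_le_iff_pos.2 rank_pos)

end IsMonomialBasis

instance : IsLieAbelian (cartan n) where
  trivial H K := by
    apply Subtype.ext
    apply Subtype.ext
    show H.val.val * K.val.val - K.val.val * H.val.val = 0
    obtain ⟨d, hd⟩ : ∃ d, H.val.val = Matrix.diagonal d := ⟨_, H.prop.diagonal_diag.symm⟩
    obtain ⟨d', hd'⟩ : ∃ d, K.val.val = Matrix.diagonal d := ⟨_, K.prop.diagonal_diag.symm⟩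
    rw [hd, hd', Matrix.diagonal_mul_diagonal, Matrix.diagonal_mul_diagonal, sub_eq_zero]
    simp only [mul_comm]

theorem IsMonomialBasis.isWeightModule (hB : IsMonomialBasis b B) : IsWeightModule n V where
  finitelyGenerated := by
    refine ⟨{B ⟨b, self_mem_exponents b⟩}, ?_⟩
    refine (hB.isIrreducible.eq_bot_or_eq_top _).resolve_left fun h => ?_
    rw [LieSubmodule.lieSpan_eq_bot_iff] at h
    exact B.ne_zero ⟨b, self_mem_exponents b⟩ (h _ (by simp))
  isInternal := by
    classical
    rw [DirectSum.isInternal_submodule_iff_iSupIndep_and_iSup_eq_top]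
    constructor
    · have h1 := LieModule.iSupIndep_genWeightSpace ℂ (cartan n) V
      have h2 := (LieSubmodule.iSupIndep_toSubmodule).2 h1
      have h3 : iSupIndep fun μ : Module.Dual ℂ (cartan n) =>
          (LieModule.genWeightSpace V μ).toSubmodule :=
        h2.comp DFunLike.coe_injective
      exact h3.mono fun μ => LieModule.weightSpace_le_genWeightSpace V μ
    · rw [eq_top_iff]
      intro u _
      refine mem_of_forall_mem (B := B) fun c _ => ?_
      exact Submodule.mem_iSup_of_mem (weightOf (monWeight b c)) (hB.isWt c).mem_wtSpace
  finiteDimensional χ := by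
    refine Module.rank_lt_aleph0_iff.1 ?_
    exact (hB.rank_le_one χ).trans_lt Cardinal.one_lt_aleph0

end MonomialBasis

end SlDegreeOne

namespace SlDegreeOne

/-! ### Decomposition over the Levi subalgebra. -/

noncomputable section FiniteType

variable {n : ℕ}

/-- The block of the Levi subalgebra `l_j` to which an index belongs. -/
def blk (j : Fin n) (i : Fin (n + 1)) : Bool := decide (i.val ≤ j.val)

theorem blk_eq_iff {j : Fin n} {i k : Fin (n + 1)} :
    blk j i = blk j k ↔ (i.val ≤ j.val ↔ k.val ≤ j.val) := decide_eq_decide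

/-- The block diagonal matrices. -/
def blockDiagonal (j : Fin n) : LieSubalgebra ℂ (sl n) where
  carrier := {X | ∀ i k, blk j i ≠ blk j k → X.val i k = 0}
  add_mem' {X Y} hX hY i k h := by
    show X.val i k + Y.val i k = 0
    rw [hX i k h, hY i k h, add_zero]
  zero_mem' _ _ _ := rfl
  smul_mem' c X hX i k h := by
    show c * X.val i k = 0
    rw [hX i k h, mul_zero]
  lie_mem' {X Y} hX hY i k h := by
    have key : ∀ Z W : sl n, (∀ i k, blk j i ≠ blk j k → Z.val i k = 0) →
        (∀ i k, blk j i ≠ blk j k → W.val i k = 0) → (Z.val * W.val) i k = 0 := by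
      intro Z W hZ hW
      rw [Matrix.mul_apply]
      refine Finset.sum_eq_zero fun l _ => ?_
      by_cases hl : blk j i = blk j l
      · rw [hW l k (hl ▸ h), mul_zero]
      · rw [hZ i l hl, zero_mul]
    show (X.val * Y.val - Y.val * X.val) i k = 0
    rw [Matrix.sub_apply, key X Y hX hY, key Y X hY hX, sub_zero]

/-- Together with `unit_mem_levi` this reduces stability under the Levi subalgebra to stability
under the matrix units inside the blocks. -/
theorem levi_le_blockDiagonal (j : Fin n) : levi j ≤ blockDiagonal j := by
  refine LieSubalgebra.lieSpan_le.2 (Set.union_subset ?_ ?_)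
  · intro X hX i k h
    exact hX (by rintro rfl; exact h rfl)
  · simp only [Set.iUnion_subset_iff]
    intro k hk X hX a c h
    have hk' : k.val ≠ j.val := fun h => hk (Fin.ext h)
    have hb : blk j k.castSucc = blk j k.succ := by
      rw [blk_eq_iff]
      simp
      omega
    rcases hX with rfl | rfl
    · show Matrix.single k.castSucc k.succ (1 : ℂ) a c = 0
      rw [Matrix.single_apply, if_neg]
      rintro ⟨rfl, rfl⟩
      exact h hb
    · show Matrix.single k.succ k.castSucc (1 : ℂ) a c = 0
      rw [Matrix.single_apply, if_neg]
      rintro ⟨rfl, rfl⟩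
      exact h hb.symm

theorem unit_self_mem_levi (j : Fin n) (i : Fin (n + 1)) : unit i i ∈ levi j :=
  LieSubalgebra.subset_lieSpan (Or.inl (unit_self_mem_cartan i))

theorem unit_mem_levi (j : Fin n) {i k : Fin (n + 1)} (h : blk j i = blk j k) :
    unit i k ∈ levi j := by
  have gen : ∀ k : Fin n, k ≠ j → unit k.castSucc k.succ ∈ levi j ∧
      unit k.succ k.castSucc ∈ levi j := by
    intro k hk
    have hlt : k.castSucc < k.succ := Fin.castSucc_lt_succ
    rw [unit_of_ne hlt.ne, unit_of_ne hlt.ne']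
    exact ⟨LieSubalgebra.subset_lieSpan (Or.inr (Set.mem_iUnion₂.2 ⟨k, hk, Or.inl rfl⟩)),
      LieSubalgebra.subset_lieSpan (Or.inr (Set.mem_iUnion₂.2 ⟨k, hk, Or.inr rfl⟩))⟩
  -- Matrix units away from the diagonal are brackets of nearer ones with Chevalley generators.
  -- Blocks are intervals, so the generator at the break is never used.
  have main : ∀ d : ℕ, ∀ i k : Fin (n + 1), k.val = i.val + d + 1 → blk j i = blk j k →
      unit i k ∈ levi j ∧ unit k i ∈ levi j := by
    intro d
    induction d with
    | zero =>
      intro i k hik hb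
      rw [blk_eq_iff] at hb
      have h1 := gen ⟨i.val, by omega⟩ (by rintro rfl; simp at hb; omega)
      rwa [show (⟨i.val, by omega⟩ : Fin n).castSucc = i from rfl,
        show (⟨i.val, by omega⟩ : Fin n).succ = k from Fin.ext (by simp [hik])] at h1
    | succ d ih =>
      intro i k hik hb
      obtain ⟨l, hl⟩ : ∃ l : Fin (n + 1), l.val = i.val + d + 1 := ⟨⟨i.val + d + 1, by omega⟩, rfl⟩
      rw [blk_eq_iff] at hb
      have h1 := ih i l hl (by rw [blk_eq_iff]; omega)
      have h2 : unit l k ∈ levi j ∧ unit k l ∈ levi j := by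
        have h3 := gen ⟨l.val, by omega⟩ (by rintro rfl; simp at hb; omega)
        rwa [show (⟨l.val, by omega⟩ : Fin n).castSucc = l from rfl,
          show (⟨l.val, by omega⟩ : Fin n).succ = k from Fin.ext (by simp; omega)] at h3
      have hki : k ≠ i := by rintro rfl; omega
      have e1 := unit_lie i l l k
      have e2 := unit_lie k l l i
      rw [if_pos rfl, if_neg hki, sub_zero] at e1
      rw [if_pos rfl, if_neg hki.symm, sub_zero] at e2
      exact ⟨e1 ▸ (levi j).lie_mem h1.1 h2.1, e2 ▸ (levi j).lie_mem h2.2 h1.2⟩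
  rcases lt_trichotomy i.val k.val with hik | hik | hik
  · exact (main (k.val - i.val - 1) i k (by omega) h).1
  · rw [Fin.ext hik]
    exact unit_self_mem_levi j k
  · exact (main (i.val - k.val - 1) k i (by omega) h.symm).2

variable {V : Type*} [AddCommGroup V] [Module ℂ V] [LieRingModule (sl n) V] [LieModule ℂ (sl n) V]

/-- A subspace stable under the matrix units in the blocks is stable under the Levi subalgebra. -/
theorem lie_mem_of_stable {j : Fin n} {U : Submodule ℂ V}
    (hU : ∀ i k, blk j i = blk j k → ∀ u ∈ U, eAct n V i k u ∈ U) {X : sl n} (hX : X ∈ levi j)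
    {u : V} (hu : u ∈ U) : ⁅X, u⁆ ∈ U := by
  rw [lie_eq_sum]
  refine U.sum_mem fun i _ => U.sum_mem fun k _ => ?_
  by_cases h : blk j i = blk j k
  · exact U.smul_mem _ (hU i k h u hu)
  · rw [levi_le_blockDiagonal j hX i k h, zero_smul]
    exact U.zero_mem

/-- The sum of the diagonal matrix units of the first block. -/
def levelElement (j : Fin n) : sl n := ∑ i with blk j i = true, unit i i

theorem levelElement_mem (j : Fin n) : levelElement j ∈ levi j :=
  Submodule.sum_mem (levi j).toSubmodule fun i _ => unit_self_mem_levi j i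

variable (V) in
/-- The operator by which `levelElement` acts. -/
def levelOp (j : Fin n) : Module.End ℂ V := LieModule.toEnd ℂ (sl n) V (levelElement j)

theorem levelOp_apply (j : Fin n) (v : V) :
    levelOp V j v = ∑ i with blk j i = true, eAct n V i i v := by
  show ⁅levelElement j, v⁆ = _
  rw [levelElement, sum_lie]
  rfl

theorem levelOp_comm {j : Fin n} {i k : Fin (n + 1)} (h : blk j i = blk j k) (v : V) :
    levelOp V j (eAct n V i k v) = eAct n V i k (levelOp V j v) := by
  rw [levelOp_apply, levelOp_apply, map_sum]
  have h1 : ∀ l, eAct n V l l (eAct n V i k v) = eAct n V i k (eAct n V l l v) +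
      (if l = i then eAct n V i k v else 0) - (if l = k then eAct n V i k v else 0) := by
    intro l
    rw [isGl_eAct l l i k v]
    congr 1
    · by_cases h2 : l = i
      · subst h2; simp
      · simp [h2]
    · by_cases h2 : l = k
      · subst h2; simp
      · simp [h2, Ne.symm h2]
  simp only [h1, Finset.sum_sub_distrib, Finset.sum_add_distrib, Finset.sum_ite_eq',
    Finset.mem_filter, Finset.mem_univ, true_and, h, add_sub_cancel_right]

variable (V) in
/-- The eigenspaces of the level operator, as modules over the Levi subalgebra. -/
def levelSpace (j : Fin n) (t : ℂ) : LieSubmodule ℂ (levi j) V :=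
  { (levelOp V j).eigenspace t with
    lie_mem := by
      intro X u hu
      refine lie_mem_of_stable (U := (levelOp V j).eigenspace t) (fun i k h u hu => ?_) X.2 hu
      rw [Module.End.mem_eigenspace_iff] at hu ⊢
      rw [levelOp_comm h, hu, map_smul] }

theorem mem_levelSpace {j : Fin n} {t : ℂ} {v : V} : v ∈ levelSpace V j t ↔ levelOp V j v = t • v :=
  Module.End.mem_eigenspace_iff

/-- The level of the monomial `x(c)`. -/
def level (j : Fin n) (b c : Fin (n + 1) → ℂ) : ℂ := ∑ i with blk j i = true, monWeight b c i

variable {b : Fin (n + 1) → ℂ} {B : Module.Basis (exponents b) ℂ V}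

/-- The finiteness condition on `b`: in each block with at least two entries, all the entries are
negative integers, or all are nonnegative integers. -/
def IsBlockwiseInt (j : Fin n) (b : Fin (n + 1) → ℂ) : Prop :=
  ∀ i k, i ≠ k → blk j i = blk j k →
    (IsNegInt (b i) ∧ IsNegInt (b k)) ∨ ((∃ m : ℕ, b i = m) ∧ ∃ m : ℕ, b k = m)

theorem not_isNegInt_nat (m : ℕ) : ¬ IsNegInt m := by
  rintro ⟨r, hr⟩
  have : ((m + r + 1 : ℕ) : ℂ) = 0 := by push_cast; linear_combination hr
  exact absurd this (by exact_mod_cast Nat.succ_ne_zero (m + r))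

theorem exists_nat_of_mem_exponents {c : Fin (n + 1) → ℂ} (hc : c ∈ exponents b) {i : Fin (n + 1)}
    (hi : ∃ m : ℕ, b i = m) : ∃ m : ℕ, c i = m := by
  obtain ⟨m, hm⟩ := hi
  obtain ⟨z, hz⟩ := hc.1 i
  have h1 : ¬ IsNegInt (c i) := fun h => not_isNegInt_nat m (hm ▸ (hc.2.2 i).1 h)
  by_cases h0 : 0 ≤ m + z
  · exact ⟨(m + z).toNat, by
      rw [hz, hm, ← Int.cast_natCast (m + z).toNat, Int.toNat_of_nonneg h0]; push_cast; ring⟩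
  · refine absurd ⟨(-(m + z) - 1).toNat, ?_⟩ h1
    rw [hz, hm, ← Int.cast_natCast (-(m + z) - 1).toNat, Int.toNat_of_nonneg (by omega)]
    push_cast
    ring

/-- The level and the total determine both block sums, and integers of one sign with a given sum
take finitely many values. -/
theorem finite_level {j : Fin n} (hb : IsBlockwiseInt j b) (t : ℂ) :
    {c | c ∈ exponents b ∧ level j b c = t}.Finite := by
  -- the block sums are determined by the level
  obtain ⟨T, hT⟩ : ∃ T : Bool → ℂ, ∀ c, c ∈ exponents b → level j b c = t →
      ∀ x, ∑ i with blk j i = x, c i = T x := by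
    set T₁ : ℂ := t + ∑ i with blk j i = true, (∑ l, b l) / (n + 1)
    refine ⟨fun x => if x = true then T₁ else ∑ l, b l - T₁, fun c hc hl x => ?_⟩
    have h1 : ∑ i with blk j i = true, c i = T₁ := by
      simp only [level, monWeight, Finset.sum_sub_distrib] at hl
      linear_combination hl
    have h2 := Finset.sum_filter_add_sum_filter_not Finset.univ (fun i => blk j i = true) c
    rw [h1, hc.2.1] at h2
    cases x
    · simp only [Bool.not_eq_true] at h2
      simp
      linear_combination h2
    · simpa using h1
  -- The singleton serves a coordinate alone in its block, which is the block sum and may be any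
  -- complex number. The other two sets serve blocks of natural numbers and of negative integers.
  set F : ℂ → Set ℂ := fun s => {s} ∪ ((fun m : ℕ => (m : ℂ)) '' Set.Iic ⌈‖s‖⌉₊ ∪
    (fun m : ℕ => -(m + 1 : ℂ)) '' Set.Iic ⌈‖s‖⌉₊) with hF
  refine (Set.Finite.pi' (t := fun i => F (T (blk j i))) fun i => ?_).subset ?_
  · exact (Set.finite_singleton _).union
      (((Set.finite_Iic _).image _).union ((Set.finite_Iic _).image _))
  rintro c ⟨hc, hl⟩ i
  have hsum := hT c hc hl (blk j i)
  have hmem : i ∈ ({k | blk j k = blk j i} : Finset (Fin (n + 1))) := by simp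
  by_cases hex : ∃ k, k ≠ i ∧ blk j k = blk j i
  · right
    obtain ⟨k, hki, hk⟩ := hex
    rcases hb k i hki hk with ⟨-, hi⟩ | ⟨-, hi⟩
    · right
      have all : ∀ l, ∃ m : ℕ, blk j l = blk j i → c l = -(m + 1 : ℂ) := by
        intro l
        by_cases hl : blk j l = blk j i
        · have h1 : IsNegInt (c l) := by
            rw [hc.2.2 l]
            rcases eq_or_ne l i with rfl | hli
            · exact hi
            · rcases hb l i hli hl with h2 | h2
              · exact h2.1
              · obtain ⟨m, hm⟩ := h2.2
                exact absurd (hm ▸ hi) (not_isNegInt_nat m)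
          obtain ⟨m, hm⟩ := h1
          exact ⟨m, fun _ => hm⟩
        · exact ⟨0, fun h => absurd h hl⟩
      choose m hm using all
      refine ⟨m i, ?_, (hm i rfl).symm⟩
      have h2 : ((∑ l with blk j l = blk j i, (m l + 1) : ℕ) : ℂ) = -T (blk j i) := by
        rw [← hsum, ← Finset.sum_neg_distrib]
        push_cast
        refine Finset.sum_congr rfl fun l hl => ?_
        rw [hm l (Finset.mem_filter.1 hl).2]
        ring
      have h3 : ‖T (blk j i)‖ = ((∑ l with blk j l = blk j i, (m l + 1) : ℕ) : ℝ) := by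
        rw [← norm_neg, ← h2, Complex.norm_natCast]
      rw [Set.mem_Iic, h3, Nat.ceil_natCast]
      have := Finset.single_le_sum (f := fun l => m l + 1) (fun _ _ => Nat.zero_le _) hmem
      omega
    · left
      have all : ∀ l, ∃ m : ℕ, blk j l = blk j i → c l = m := by
        intro l
        by_cases hl : blk j l = blk j i
        · have h1 : ∃ m : ℕ, c l = m := by
            refine exists_nat_of_mem_exponents hc ?_
            rcases eq_or_ne l i with rfl | hli
            · exact hi
            · rcases hb l i hli hl with h2 | h2
              · obtain ⟨m, hm⟩ := hi
                exact absurd (hm ▸ h2.2) (not_isNegInt_nat m)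
              · exact h2.1
          obtain ⟨m, hm⟩ := h1
          exact ⟨m, fun _ => hm⟩
        · exact ⟨0, fun h => absurd h hl⟩
      choose m hm using all
      refine ⟨m i, ?_, (hm i rfl).symm⟩
      have h2 : ((∑ l with blk j l = blk j i, m l : ℕ) : ℂ) = T (blk j i) := by
        rw [← hsum]
        push_cast
        exact Finset.sum_congr rfl fun l hl => (hm l (Finset.mem_filter.1 hl).2).symm
      have h3 : ‖T (blk j i)‖ = ((∑ l with blk j l = blk j i, m l : ℕ) : ℝ) := by
        rw [← h2, Complex.norm_natCast]
      rw [Set.mem_Iic, h3, Nat.ceil_natCast]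
      exact Finset.single_le_sum (f := m) (fun _ _ => Nat.zero_le _) hmem
  · left
    push Not at hex
    rw [← hsum, Set.mem_singleton_iff, eq_comm]
    refine Finset.sum_eq_single_of_mem i hmem fun k hk hki => ?_
    exact absurd (Finset.mem_filter.1 hk).2 (hex k hki)

namespace IsMonomialBasis

variable (hB : IsMonomialBasis b B)
include hB

theorem levelOp_basis (j : Fin n) (c : exponents b) :
    levelOp V j (B c) = level j b c • B c := by
  rw [levelOp_apply, level, Finset.sum_smul]
  exact Finset.sum_congr rfl fun i _ => hB.isWt c i

theorem basis_mem_levelSpace {j : Fin n} {t : ℂ} {c : exponents b} :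
    B c ∈ levelSpace V j t ↔ level j b c = t := by
  rw [mem_levelSpace, hB.levelOp_basis]
  exact ⟨fun h => smul_left_injective ℂ (B.ne_zero c) h, fun h => by rw [h]⟩

theorem level_of_mem {j : Fin n} {t : ℂ} {u : V} (hu : u ∈ levelSpace V j t) {c : exponents b}
    (hc : B.repr u c ≠ 0) : level j b c = t := by
  rw [mem_levelSpace, levelOp_apply] at hu
  have h1 := DFunLike.congr_fun (congrArg B.repr hu) c
  rw [map_sum, Finsupp.finsetSum_apply, map_smul, Finsupp.smul_apply, smul_eq_mul] at h1
  simp only [hB.repr_diag, ← Finset.sum_mul] at h1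
  exact mul_right_cancel₀ hc h1

theorem isIrreducible_levelSpace {j : Fin n} {t : ℂ} (ht : levelSpace V j t ≠ ⊥) :
    LieModule.IsIrreducible ℂ (levi j) (levelSpace V j t) where
  exists_pair_ne := by
    refine ⟨⊥, ⊤, fun h => ht ?_⟩
    rw [LieSubmodule.eq_bot_iff]
    intro u hu
    have : (⟨u, hu⟩ : levelSpace V j t) ∈ (⊥ : LieSubmodule ℂ (levi j) (levelSpace V j t)) :=
      h ▸ LieSubmodule.mem_top _
    exact congrArg Subtype.val ((LieSubmodule.mem_bot _).1 this)
  eq_bot_or_eq_top N := by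
    by_cases h : ∃ u ∈ N, u ≠ 0
    · right
      obtain ⟨u, hu, h0⟩ := h
      set U : Submodule ℂ V := N.toSubmodule.map (levelSpace V j t).toSubmodule.subtype with hUdef
      have hU : ∀ i k, blk j i = blk j k → ∀ u ∈ U, eAct n V i k u ∈ U := by
        rintro i k hik _ ⟨w, hw, rfl⟩
        exact ⟨_, N.lie_mem (x := (⟨unit i k, unit_mem_levi j hik⟩ : levi j)) hw, rfl⟩
      obtain ⟨d, hd⟩ := exists_repr_ne_zero (B := B) (u := (u : V))
        (fun h => h0 (Subtype.ext h))
      obtain ⟨c, hc⟩ := hB.exists_mem (U := U) (fun i => hU i i rfl) ⟨u, hu, rfl⟩ hd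
      have hct : level j b c = t := by
        obtain ⟨w, -, hw⟩ := hc
        exact hB.basis_mem_levelSpace.1 (hw ▸ w.2)
      rw [eq_top_iff]
      intro w _
      have hw : (w : V) ∈ U := by
        refine mem_of_forall_mem (B := B) fun c' hc' => ?_
        have hct' := hB.level_of_mem w.2 hc'
        have h1 : ∑ i with blk j i = true, c.1 i = ∑ i with blk j i = true, c'.1 i := by
          have h2 := hct.trans hct'.symm
          simp only [level, monWeight, Finset.sum_sub_distrib] at h2
          exact sub_left_injective h2
        refine hB.mem_of_mem (blk j) hU hc fun x => ?_
        cases x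
        · have h2 := Finset.sum_filter_add_sum_filter_not Finset.univ (fun i => blk j i = true) c.1
          have h3 := Finset.sum_filter_add_sum_filter_not Finset.univ (fun i => blk j i = true) c'.1
          rw [c.2.2.1] at h2
          rw [c'.2.2.1, ← h1] at h3
          simp only [Bool.not_eq_true] at h2 h3
          linear_combination h2 - h3
        · exact h1
      obtain ⟨w', hw', h2⟩ := hw
      rwa [show w = w' from Subtype.ext h2.symm]
    · left
      push Not at h
      exact (LieSubmodule.eq_bot_iff _).2 h

theorem finiteDimensional_levelSpace {j : Fin n} (hb : IsBlockwiseInt j b) (t : ℂ) :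
    FiniteDimensional ℂ (levelSpace V j t) := by
  have hfin : {c : exponents b | level j b c = t}.Finite := by
    refine Set.Finite.of_finite_image ((finite_level hb t).subset ?_) Subtype.val_injective.injOn
    rintro _ ⟨c, hc, rfl⟩
    exact ⟨c.2, hc⟩
  have hle : (levelSpace V j t).toSubmodule ≤
      Submodule.span ℂ (B '' {c : exponents b | level j b c = t}) := fun u hu =>
    mem_of_forall_mem (B := B) fun c hc => Submodule.subset_span ⟨c, hB.level_of_mem hu hc, rfl⟩
  have := FiniteDimensional.span_of_finite ℂ (hfin.image B)
  exact Submodule.finiteDimensional_of_le hle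

/-- The summands are the nonzero eigenspaces of the level operator. That operator comes from an
element of the Levi subalgebra, so an isomorphism preserves its eigenvalue and every multiplicity is
one. -/
theorem isFiniteType {j : Fin n} (hb : IsBlockwiseInt j b) : IsFiniteType V (levi j) := by
  classical
  set S : Set (LieSubmodule ℂ (levi j) V) := {W | W ≠ ⊥ ∧ ∃ t, W = levelSpace V j t} with hS
  choose t ht using fun W : S => W.2.2
  have tinj : Function.Injective t := fun W W' h => Subtype.ext (by rw [ht W, ht W', h])
  refine ⟨S, ?_, ?_, ?_⟩
  · rw [DirectSum.isInternal_submodule_iff_iSupIndep_and_iSup_eq_top]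
    constructor
    · refine ((levelOp V j).eigenspaces_iSupIndep.comp tinj).mono fun W => ?_
      rw [ht W]
      exact le_rfl
    · rw [eq_top_iff]
      intro u _
      refine mem_of_forall_mem (B := B) fun c _ => ?_
      have hc : B c ∈ levelSpace V j (level j b c) := hB.basis_mem_levelSpace.2 rfl
      refine Submodule.mem_iSup_of_mem (⟨levelSpace V j (level j b c), ?_, _, rfl⟩ : S) hc
      intro h0
      rw [h0, LieSubmodule.mem_bot] at hc
      exact B.ne_zero c hc
  · rintro W ⟨h0, t, rfl⟩
    exact ⟨hB.isIrreducible_levelSpace h0, hB.finiteDimensional_levelSpace hb t⟩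
  · rintro W ⟨h0, s, rfl⟩
    refine (Set.finite_singleton (levelSpace V j s)).subset ?_
    rintro W' ⟨⟨h0', s', rfl⟩, ⟨f⟩⟩
    obtain ⟨u, hu, hu0⟩ : ∃ u ∈ levelSpace V j s', u ≠ 0 := by
      by_contra hcon
      push Not at hcon
      exact h0' ((LieSubmodule.eq_bot_iff _).2 hcon)
    set Z : levi j := ⟨levelElement j, levelElement_mem j⟩
    have h1 : ⁅Z, (⟨u, hu⟩ : levelSpace V j s')⁆ = s' • (⟨u, hu⟩ : levelSpace V j s') :=
      Subtype.ext (mem_levelSpace.1 hu)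
    have h2 : ⁅Z, f ⟨u, hu⟩⁆ = s • f ⟨u, hu⟩ := Subtype.ext (mem_levelSpace.1 (f ⟨u, hu⟩).2)
    have h3 : f ⁅Z, (⟨u, hu⟩ : levelSpace V j s')⁆ = ⁅Z, f ⟨u, hu⟩⁆ :=
      LieModuleHom.map_lie f.toLieModuleHom _ _
    rw [h1, h2] at h3
    have h4 : f (s' • (⟨u, hu⟩ : levelSpace V j s')) = s' • f ⟨u, hu⟩ :=
      map_smul f.toLieModuleHom.toLinearMap _ _
    rw [h4] at h3
    have h5 : f ⟨u, hu⟩ ≠ 0 := by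
      intro h
      have h6 : (⟨u, hu⟩ : levelSpace V j s') = 0 := f.injective
        (h.trans (map_zero f.toLieModuleHom.toLinearMap).symm)
      exact hu0 (congrArg Subtype.val h6)
    have h6 := smul_left_injective ℂ h5 h3
    exact Set.mem_singleton_iff.2 (congrArg (levelSpace V j) h6)

end IsMonomialBasis

end FiniteType

end SlDegreeOne

namespace SlDegreeOne

/-! ### The modules `N(b)` and their contragredients as models. -/

noncomputable section Models

variable {n : ℕ}

theorem glAct_single (i k : Fin (n + 1)) : glAct (Matrix.single i k 1) = opQ i * opP k := by
  unfold glAct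
  rw [Finset.sum_eq_single i, Finset.sum_eq_single k]
  · simp
  · intro l _ hl
    simp [hl.symm]
  · simp
  · intro l _ hl
    exact Finset.sum_eq_zero fun m _ => by simp [hl.symm]
  · simp

theorem opQ_opP_mon (i k : Fin (n + 1)) (c : Fin (n + 1) → ℂ) :
    (opQ i * opP k) (mon c) = c k •
      if (c - Pi.single k 1 : Fin (n + 1) → ℂ) i = -1 then 0 else mon (shift c i k) := by
  rw [Module.End.mul_apply, opP_mon, map_smul, opQ_mon]
  rfl

theorem opQ_opP_mon_self (i : Fin (n + 1)) (c : Fin (n + 1) → ℂ) :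
    (opQ i * opP i) (mon c) = c i • mon c := by
  rw [opQ_opP_mon]
  split_ifs with h
  · have h0 : c i = 0 := by
      simp only [Pi.sub_apply, Pi.single_eq_same] at h
      linear_combination h
    rw [h0, zero_smul, zero_smul]
  · rw [show shift c i i = c by simp [shift]]

theorem glAct_one_mon (c : Fin (n + 1) → ℂ) : glAct 1 (mon c) = (∑ i, c i) • mon c := by
  rw [Finset.sum_smul, glAct, LinearMap.sum_apply]
  refine Finset.sum_congr rfl fun i _ => ?_
  rw [Finset.sum_eq_single i]
  · rw [Matrix.one_apply_eq, one_smul, opQ_opP_mon_self]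
  · intro k _ hk
    rw [Matrix.one_apply_ne hk.symm, zero_smul]
  · simp

theorem glAct_unit_self_mon (i : Fin (n + 1)) (c : Fin (n + 1) → ℂ) :
    glAct (unit i i).val (mon c) = monWeight c c i • mon c := by
  rw [unit, slProj_val, glAct_sub, glAct_smul, LinearMap.sub_apply, LinearMap.smul_apply,
    glAct_single, opQ_opP_mon_self, glAct_one_mon, smul_smul, ← sub_smul, Matrix.trace_single_eq_same]
  congr 1
  simp only [monWeight]
  ring

theorem glAct_unit_mon {i k : Fin (n + 1)} (hik : i ≠ k) (c : Fin (n + 1) → ℂ) :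
    glAct (unit i k).val (mon c) = c k •
      if (c - Pi.single k 1 : Fin (n + 1) → ℂ) i = -1 then 0 else mon (shift c i k) := by
  rw [unit, slProj_of_trace_eq_zero (Matrix.trace_single_eq_of_ne _ _ _ hik), glAct_single,
    opQ_opP_mon]

theorem shift_notMem {b c : Fin (n + 1) → ℂ} {i k : Fin (n + 1)} (hik : i ≠ k)
    (hc : c ∈ exponents b) (hi : c i = -1) : shift c i k ∉ exponents b := by
  intro h
  have h1 := (h.2.2 i).2 ((hc.2.2 i).1 ⟨0, by simp [hi]⟩)
  have h2 : shift c i k i = (0 : ℕ) := by simp [shift, hik, hi]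
  rw [h2] at h1
  exact not_isNegInt_nat 0 h1

/-- The monomials as a basis of `N(b)`. -/
def monBasis (b : Fin (n + 1) → ℂ) : Module.Basis (exponents b) ℂ (moduleN b) :=
  Module.Basis.mk (v := fun c : exponents b =>
      (⟨mon c, Submodule.subset_span ⟨c, c.2, rfl⟩⟩ : moduleN b))
    (by
      have h1 : LinearIndependent ℂ fun c : Fin (n + 1) → ℂ =>
          (Finsupp.single c 1 : (Fin (n + 1) → ℂ) →₀ ℂ) := Finsupp.linearIndependent_single_one ℂ _
      have h2 : LinearIndependent ℂ fun c : exponents b => mon c.1 :=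
        h1.comp _ Subtype.val_injective
      exact LinearIndependent.of_comp (moduleN b).toSubmodule.subtype h2)
    (by
      rintro ⟨w, hw⟩ -
      have hw' : w ∈ Submodule.span ℂ (mon '' exponents b) := hw
      induction hw' using Submodule.span_induction with
      | mem w h =>
        obtain ⟨c, hc, rfl⟩ := h
        exact Submodule.subset_span ⟨⟨c, hc⟩, rfl⟩
      | zero => exact Submodule.zero_mem _
      | add x y hx hy ihx ihy => exact Submodule.add_mem _ (ihx hx) (ihy hy)
      | smul t x hx ih => exact Submodule.smul_mem _ t (ih hx))

theorem monBasis_val {b : Fin (n + 1) → ℂ} (c : exponents b) : (monBasis b c).val = mon c := by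
  rw [monBasis, Module.Basis.mk_apply]

theorem isMonomialBasis_monBasis (b : Fin (n + 1) → ℂ) : IsMonomialBasis b (monBasis b) where
  isWt c i := by
    apply Subtype.ext
    show glAct (unit i i).val (monBasis b c).val = monWeight b c i • (monBasis b c).val
    rw [monBasis_val, glAct_unit_self_mon]
    simp only [monWeight, c.2.2.1]
  apply_of_mem i k hik c h := by
    apply Subtype.ext
    show glAct (unit i k).val (monBasis b c).val = c.1 k • (monBasis b _).val
    rw [monBasis_val, monBasis_val, glAct_unit_mon hik, if_neg]
    intro h0
    exact shift_notMem hik c.2 (by simpa [hik] using h0) h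
  apply_of_notMem i k hik c h := by
    apply Subtype.ext
    show glAct (unit i k).val (monBasis b c).val = 0
    rw [monBasis_val, glAct_unit_mon hik]
    by_cases h0 : c.1 k = 0
    · rw [h0, zero_smul]
    · split_ifs with h1
      · rw [smul_zero]
      · exact absurd (exponents_shift c.2 h0 h1) h

section Equiv

variable {V W : Type*} [AddCommGroup V] [Module ℂ V] [LieRingModule (sl n) V]
  [LieModule ℂ (sl n) V] [AddCommGroup W] [Module ℂ W] [LieRingModule (sl n) W]
  [LieModule ℂ (sl n) W] {b : Fin (n + 1) → ℂ} {B : Module.Basis (exponents b) ℂ V}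
  {B' : Module.Basis (exponents b) ℂ W}

/-- A linear equivalence that intertwines the matrix units is an isomorphism of modules. -/
def lieEquivOfIntertwines (f : V ≃ₗ[ℂ] W)
    (hf : ∀ i k u, f (eAct n V i k u) = eAct n W i k (f u)) : V ≃ₗ⁅ℂ,sl n⁆ W :=
  { f with
    map_lie' := by
      intro X u
      show f ⁅X, u⁆ = ⁅X, f u⁆
      rw [lie_eq_sum, lie_eq_sum, map_sum]
      refine Finset.sum_congr rfl fun i _ => ?_
      rw [map_sum]
      refine Finset.sum_congr rfl fun k _ => ?_
      rw [map_smul, hf] }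

theorem IsMonomialBasis.map (hB : IsMonomialBasis b B) (f : V ≃ₗ[ℂ] W)
    (hf : ∀ i k u, f (eAct n V i k u) = eAct n W i k (f u)) : IsMonomialBasis b (B.map f) where
  isWt c i := by rw [Module.Basis.map_apply, ← hf, hB.isWt c i, map_smul]
  apply_of_mem i k hik c h := by
    rw [Module.Basis.map_apply, Module.Basis.map_apply, ← hf, hB.apply_of_mem i k hik c h, map_smul]
  apply_of_notMem i k hik c h := by
    rw [Module.Basis.map_apply, ← hf, hB.apply_of_notMem i k hik c h, map_zero]

theorem IsMonomialBasis.nonempty_equiv (hB : IsMonomialBasis b B) (hB' : IsMonomialBasis b B') :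
    Nonempty (V ≃ₗ⁅ℂ,sl n⁆ W) := by
  set f : V ≃ₗ[ℂ] W := B.equiv B' (Equiv.refl _) with hfdef
  have hfB : ∀ c, f (B c) = B' c := fun c => by rw [hfdef, Module.Basis.equiv_apply]; rfl
  refine ⟨lieEquivOfIntertwines f fun i k u => ?_⟩
  have : f.toLinearMap ∘ₗ eAct n V i k = eAct n W i k ∘ₗ f.toLinearMap := by
    refine B.ext fun c => ?_
    show f (eAct n V i k (B c)) = eAct n W i k (f (B c))
    rw [hfB]
    rcases eq_or_ne i k with rfl | hik
    · rw [hB.isWt c i, hB'.isWt c i, map_smul, hfB]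
    · by_cases h : shift c i k ∈ exponents b
      · rw [hB.apply_of_mem i k hik c h, hB'.apply_of_mem i k hik c h, map_smul, hfB]
      · rw [hB.apply_of_notMem i k hik c h, hB'.apply_of_notMem i k hik c h, map_zero]
  exact LinearMap.congr_fun this u

/-- In the order given by `σ`, each raising operator kills `x(b)` either by its coefficient `b (σ k)
= 0` or because `b (σ i) = -1` cannot be increased. -/
theorem IsMonomialBasis.isHighest (hB : IsMonomialBasis b B) (σ : Equiv.Perm (Fin (n + 1)))
    (hb : ∀ i k, i < k → b (σ k) = 0 ∨ b (σ i) = -1) :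
    IsHighest (fun i k => eAct n V (σ i) (σ k)) (monWeight b b ∘ σ)
      (B ⟨b, self_mem_exponents b⟩) where
  ne_zero := B.ne_zero _
  isWt i := hB.isWt _ (σ i)
  raise_eq_zero i k hik := by
    have hne : σ i ≠ σ k := σ.injective.ne hik.ne
    by_cases h : shift b (σ i) (σ k) ∈ exponents b
    · rcases hb i k hik with h0 | h0
      · refine (hB.apply_of_mem _ _ hne _ h).trans ?_
        show b (σ k) • _ = _
        rw [h0, zero_smul]
      · exact absurd h (shift_notMem hne (self_mem_exponents b) h0)
    · exact hB.apply_of_notMem _ _ hne _ h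

end Equiv

section Dual

variable {V : Type*} [AddCommGroup V] [Module ℂ V] [LieRingModule (sl n) V]
  [LieModule ℂ (sl n) V] {b : Fin (n + 1) → ℂ} {B : Module.Basis (exponents b) ℂ V}

/-- The exponent `-1 - c`. -/
def reflect (c : Fin (n + 1) → ℂ) : Fin (n + 1) → ℂ := fun i => -1 - c i

theorem reflect_reflect (c : Fin (n + 1) → ℂ) : reflect (reflect c) = c := by
  ext i
  simp [reflect]

theorem isNegInt_reflect {z : ℂ} : IsNegInt (-1 - z) ↔ ∃ m : ℕ, z = m :=
  ⟨fun ⟨m, hm⟩ => ⟨m, by linear_combination -hm⟩, fun ⟨m, hm⟩ => ⟨m, by rw [hm]; ring⟩⟩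

theorem exponents_symm {c : Fin (n + 1) → ℂ} (hc : c ∈ exponents b) : b ∈ exponents c :=
  ⟨fun i => (hc.1 i).elim fun z hz => ⟨-z, by rw [hz]; push_cast; ring⟩, hc.2.1.symm,
    fun i => (hc.2.2 i).symm⟩

theorem reflect_mem {c : Fin (n + 1) → ℂ} (hc : c ∈ exponents b) :
    reflect c ∈ exponents (reflect b) := by
  refine ⟨fun i => ?_, ?_, fun i => ?_⟩
  · obtain ⟨z, hz⟩ := hc.1 i
    exact ⟨-z, by simp only [reflect, hz]; push_cast; ring⟩
  · simp only [reflect, Finset.sum_sub_distrib, hc.2.1]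
  · simp only [reflect, isNegInt_reflect]
    exact ⟨exists_nat_of_mem_exponents (exponents_symm hc), exists_nat_of_mem_exponents hc⟩

/-- The bijection `c ↦ -1 - c` between the exponents of `N(b)` and of `N(-1-b)`. -/
def reflectEquiv (b : Fin (n + 1) → ℂ) : exponents b ≃ exponents (reflect b) where
  toFun c := ⟨reflect c, reflect_mem c.2⟩
  invFun d := ⟨reflect d, by simpa only [reflect_reflect] using reflect_mem d.2⟩
  left_inv c := Subtype.ext (reflect_reflect c.1)
  right_inv d := Subtype.ext (reflect_reflect d.1)

theorem IsMonomialBasis.coord_mem (hB : IsMonomialBasis b B) (c : exponents b) :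
    B.coord c ∈ contragredient n V := by
  show {χ : Module.Dual ℂ (cartan n) | ∃ v ∈ wtSpace n V χ, B.coord c v ≠ 0}.Finite
  refine (Set.finite_singleton (weightOf (monWeight b c))).subset ?_
  rintro χ ⟨v, hv, hc⟩
  have h1 := hB.eq_of_isWt (isWt_of_mem_wtSpace hv) hc
  have h2 := (h1 ▸ isWt_of_mem_wtSpace hv : IsWt (eAct n V) (monWeight b c) v)
  have hv0 : v ≠ 0 := fun h => hc (by rw [h, map_zero])
  refine Set.mem_singleton_iff.2 (LinearMap.ext fun H => ?_)
  have h3 : ⁅H.val, v⁆ = χ H • v := (LieModule.mem_weightSpace _ _).1 hv H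
  exact smul_left_injective ℂ hv0 (h3.symm.trans (h2.lie_cartan H))

/-- The dual basis, as a basis of the contragredient. -/
def dualBasis (hB : IsMonomialBasis b B) : Module.Basis (exponents b) ℂ (contragredient n V) :=
  Module.Basis.mk (v := fun c => (⟨B.coord c, hB.coord_mem c⟩ : contragredient n V))
    (by
      refine LinearIndependent.of_comp (contragredient n V).toSubmodule.subtype ?_
      rw [linearIndependent_iff']
      intro s g hg c hc
      have h1 : (∑ x ∈ s, g x • B.coord x) (B c) = 0 := LinearMap.congr_fun hg (B c)
      simpa [Finsupp.single_apply, hc] using h1)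
    (by
      rintro ⟨f, hf⟩ -
      have hfin : {c | f (B c) ≠ 0}.Finite := by
        refine Set.Finite.of_finite_image (f := fun c : exponents b => weightOf (monWeight b c))
          (Set.Finite.subset hf ?_) ?_
        · rintro _ ⟨c, hc, rfl⟩
          exact ⟨B c, (hB.isWt c).mem_wtSpace, hc⟩
        · intro c _ c' _ h
          exact Subtype.ext (monWeight_injective b
            (weightOf_injOn (sum_monWeight c.2) (sum_monWeight c'.2) h))
      have hsum : (⟨f, hf⟩ : contragredient n V) = ∑ c ∈ hfin.toFinset,
          f (B c) • (⟨B.coord c, hB.coord_mem c⟩ : contragredient n V) := by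
        apply (contragredient n V).toSubmodule.subtype_injective
        rw [map_sum]
        refine B.ext fun d => ?_
        rw [LinearMap.sum_apply]
        show f (B d) = ∑ c ∈ hfin.toFinset, f (B c) • B.coord c (B d)
        by_cases hd : f (B d) = 0
        · rw [hd, eq_comm]
          refine Finset.sum_eq_zero fun c hc => ?_
          have hcd : d ≠ c := by
            rintro rfl
            exact (hfin.mem_toFinset.1 hc) hd
          simp [hcd]
        · rw [Finset.sum_eq_single d]
          · simp
          · intro c _ hcd
            simp [hcd.symm]
          · intro h
            exact absurd (hfin.mem_toFinset.2 hd) h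
      rw [hsum]
      exact Submodule.sum_mem _ fun c _ => Submodule.smul_mem _ _ (Submodule.subset_span ⟨c, rfl⟩))

theorem dualBasis_val (hB : IsMonomialBasis b B) (c : exponents b) :
    (dualBasis hB c).val = B.coord c := by
  rw [dualBasis, Module.Basis.mk_apply]

theorem eAct_contragredient_apply (i k : Fin (n + 1)) (f : contragredient n V) (v : V) :
    (eAct n (contragredient n V) i k f).val v = -f.val (eAct n V i k v) :=
  Module.Dual.lie_apply _ _ _

theorem shift_shift (c : Fin (n + 1) → ℂ) (i k : Fin (n + 1)) : shift (shift c k i) i k = c := by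
  simp only [shift]
  abel

theorem shift_reflect (c : Fin (n + 1) → ℂ) (i k : Fin (n + 1)) :
    shift (reflect c) i k = reflect (shift c k i) := by
  ext l
  simp only [shift, reflect, Pi.add_apply, Pi.sub_apply]
  ring

/-- The contragredient of `N(b)` is `N(-1-b)`. -/
theorem isMonomialBasis_dualBasis (hB : IsMonomialBasis b B) :
    IsMonomialBasis (reflect b) ((dualBasis hB).reindex (reflectEquiv b)) := by
  have hval : ∀ c : exponents b, (((dualBasis hB).reindex (reflectEquiv b))
      ⟨reflect c, reflect_mem c.2⟩).val = B.coord c := by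
    intro c
    rw [show (⟨reflect c, reflect_mem c.2⟩ : exponents (reflect b)) = reflectEquiv b c from rfl,
      Module.Basis.reindex_apply, Equiv.symm_apply_apply, dualBasis_val]
  -- Only `x = c - ε_i + ε_k` is sent by `e i k` to a multiple of the basis vector of `c`, with
  -- coefficient `c_k + 1`. The dual action therefore has coefficient `-1 - c_k`, the `k`-th entry
  -- of `reflect c`.
  have off : ∀ i k, i ≠ k → ∀ c x : exponents b, x.1 ≠ shift c k i →
      B.coord c (eAct n V i k (B x)) = 0 := by
    intro i k hik c x hx
    by_cases hs : shift x i k ∈ exponents b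
    · rw [hB.apply_of_mem i k hik x hs, map_smul, B.coord_apply, B.repr_self,
        Finsupp.single_apply, if_neg, smul_zero]
      rintro rfl
      exact hx (shift_shift x.1 k i).symm
    · rw [hB.apply_of_notMem i k hik x hs, map_zero]
  refine ⟨fun d i => ?_, fun i k hik d h => ?_, fun i k hik d h => ?_⟩
  · obtain ⟨c, rfl⟩ := (reflectEquiv b).surjective d
    apply Subtype.ext
    refine B.ext fun x => ?_
    rw [eAct_contragredient_apply]
    show -(((dualBasis hB).reindex (reflectEquiv b)) ⟨reflect c, reflect_mem c.2⟩).val _ =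
      monWeight (reflect b) (reflect c) i •
        (((dualBasis hB).reindex (reflectEquiv b)) ⟨reflect c, reflect_mem c.2⟩).val (B x)
    rw [hval, hB.isWt x i, map_smul, B.coord_apply, B.repr_self, Finsupp.single_apply]
    split_ifs with hx
    · subst hx
      have : (n + 1 : ℂ) ≠ 0 := by exact_mod_cast Nat.succ_ne_zero n
      simp [monWeight, reflect, Finset.sum_sub_distrib]
      field_simp
      ring
    · simp
  · obtain ⟨c, rfl⟩ := (reflectEquiv b).surjective d
    have h' : shift (reflect c) i k ∈ exponents (reflect b) := h
    have hc2 : shift c.1 k i ∈ exponents b := by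
      rw [shift_reflect] at h'
      simpa only [reflect_reflect] using reflect_mem h'
    apply Subtype.ext
    refine B.ext fun x => ?_
    rw [eAct_contragredient_apply]
    have e1 : (⟨shift (reflect c) i k, h'⟩ : exponents (reflect b)) =
        ⟨reflect (⟨_, hc2⟩ : exponents b), reflect_mem hc2⟩ := Subtype.ext (shift_reflect c.1 i k)
    show -(((dualBasis hB).reindex (reflectEquiv b)) ⟨reflect c, reflect_mem c.2⟩).val _ =
      reflect c k • (((dualBasis hB).reindex (reflectEquiv b)) ⟨shift (reflect c) i k, h'⟩).val (B x)
    rw [e1, hval, hval]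
    by_cases hx : x.1 = shift c k i
    · obtain rfl : x = ⟨_, hc2⟩ := Subtype.ext hx
      have hs : shift (shift c.1 k i) i k ∈ exponents b := by rw [shift_shift]; exact c.2
      rw [hB.apply_of_mem i k hik _ hs, map_smul, B.coord_apply, B.coord_apply, B.repr_self,
        B.repr_self, show (⟨_, hs⟩ : exponents b) = c from Subtype.ext (shift_shift c.1 i k)]
      simp [shift, reflect, hik.symm]
      ring
    · rw [off i k hik c x hx, B.coord_apply, B.repr_self, Finsupp.single_apply, if_neg]
      · simp
      · rintro rfl
        exact hx rfl
  · obtain ⟨c, rfl⟩ := (reflectEquiv b).surjective d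
    have h' : shift (reflect c) i k ∉ exponents (reflect b) := h
    apply Subtype.ext
    refine B.ext fun x => ?_
    rw [eAct_contragredient_apply]
    show -(((dualBasis hB).reindex (reflectEquiv b)) ⟨reflect c, reflect_mem c.2⟩).val _ = 0
    rw [hval, off i k hik c x, neg_zero]
    intro hx
    apply h'
    rw [shift_reflect, ← hx]
    exact reflect_mem x.2

end Dual

end Models

end SlDegreeOne

namespace SlDegreeOne

/-! ### The list of parameters and the final argument. -/

noncomputable section Main

variable {n : ℕ}

section Parameters

variable {j : Fin n} {b : Fin (n + 1) → ℂ}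

theorem exists_param_of_mem (hb : b ∈ parameters j) : ∃ (r : ℕ) (z : ℂ), b = param n r z := by
  rcases hb with ⟨-, ⟨a, -, rfl⟩ | ⟨m, rfl⟩⟩ | ⟨-, ⟨a, -, rfl⟩ | ⟨m, rfl⟩⟩ | ⟨-, -, m, rfl | rfl⟩ <;>
    exact ⟨_, _, rfl⟩

theorem param_lt {r : ℕ} {z : ℂ} {i : Fin (n + 1)} (hi : i.val < r) : param n r z i = -1 :=
  if_pos hi

theorem param_eq {r : ℕ} {z : ℂ} {i : Fin (n + 1)} (hi : i.val = r) : param n r z i = z := by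
  unfold param
  rw [if_neg (by omega), if_pos hi]

theorem param_gt {r : ℕ} {z : ℂ} {i : Fin (n + 1)} (hi : r < i.val) : param n r z i = 0 := by
  unfold param
  rw [if_neg (by omega), if_neg (by omega)]

theorem param_eq_zero_or {r : ℕ} {z : ℂ} {i k : Fin (n + 1)} (hik : i < k) :
    param n r z k = 0 ∨ param n r z i = -1 := by
  have hik' : i.val < k.val := hik
  by_cases h : i.val < r
  · exact Or.inr (param_lt h)
  · exact Or.inl (param_gt (by omega))

/-- The symmetry of the list of parameters. -/
theorem reflect_rev_mem_parameters (hn : 2 ≤ n) (hb : b ∈ parameters j) :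
    reflect (b ∘ Fin.rev) ∈ parameters j.rev := by
  have hj := j.isLt
  have hr : j.rev.val = n - (j.val + 1) := Fin.val_rev j
  have key : ∀ (r s : ℕ) (z : ℂ), r + s = n →
      reflect (param n r z ∘ Fin.rev) = param n s (-1 - z) := by
    intro r s z hrs
    ext i
    have hi := i.isLt
    have hv : i.rev.val = n + 1 - (i.val + 1) := Fin.val_rev i
    simp only [reflect, param, Function.comp_apply, hv]
    rcases lt_trichotomy i.val s with h | h | h
    · rw [if_pos h, if_neg (by omega), if_neg (by omega)]; ring
    · rw [if_neg (by omega), if_pos (by omega), if_neg (by omega), if_pos h]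
    · rw [if_pos (by omega), if_neg (by omega), if_neg (by omega)]; ring
  rcases hb with ⟨h0, ⟨a, ha, rfl⟩ | ⟨m, rfl⟩⟩ | ⟨h0, ⟨a, ha, rfl⟩ | ⟨m, rfl⟩⟩ |
    ⟨h0, h1, m, rfl | rfl⟩
  · rw [key 0 n a (by omega)]
    refine Or.inr (Or.inl ⟨by omega, Or.inl ⟨_, ?_, rfl⟩⟩)
    rw [isNegInt_reflect]
    exact fun ⟨m, hm⟩ => ha m hm
  · rw [key 1 (n - 1) m (by omega)]
    exact Or.inr (Or.inl ⟨by omega, Or.inr ⟨m, rfl⟩⟩)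
  · rw [key n 0 a (by omega)]
    refine Or.inl ⟨by omega, Or.inl ⟨_, fun m hm => ha ⟨m, by linear_combination -hm⟩, rfl⟩⟩
  · rw [key (n - 1) 1 _ (by omega)]
    exact Or.inl ⟨by omega, Or.inr ⟨m, by congr 1; ring⟩⟩
  · rw [key (j.val + 1) j.rev.val _ (by omega)]
    exact Or.inr (Or.inr ⟨by omega, by omega, m, Or.inr rfl⟩)
  · rw [key j.val (j.rev.val + 1) _ (by omega)]
    exact Or.inr (Or.inr ⟨by omega, by omega, m, Or.inl (by congr 1; ring)⟩)

theorem isBlockwiseInt_param {r : ℕ} {z : ℂ}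
    (h : ∀ i k : Fin (n + 1), i.val = r → i ≠ k → blk j i = blk j k →
      (IsNegInt z ∧ k.val < r) ∨ ((∃ m : ℕ, z = m) ∧ r < k.val))
    (h' : ∀ i k : Fin (n + 1), i.val < r → r < k.val → blk j i ≠ blk j k) :
    IsBlockwiseInt j (param n r z) := by
  have neg : IsNegInt (-1) := ⟨0, by simp⟩
  have zero : ∃ m : ℕ, (0 : ℂ) = m := ⟨0, by simp⟩
  intro i k hik hb
  rcases lt_trichotomy i.val r with hi | hi | hi <;> rcases lt_trichotomy k.val r with hk | hk | hk
  · rw [param_lt hi, param_lt hk]; exact Or.inl ⟨neg, neg⟩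
  · rw [param_lt hi, param_eq hk]
    rcases h k i hk hik.symm hb.symm with h1 | h1
    · exact Or.inl ⟨neg, h1.1⟩
    · omega
  · exact absurd hb (h' i k hi hk)
  · rw [param_eq hi, param_lt hk]
    rcases h i k hi hik hb with h1 | h1
    · exact Or.inl ⟨h1.1, neg⟩
    · omega
  · exact absurd (Fin.ext (hi.trans hk.symm)) hik
  · rw [param_eq hi, param_gt hk]
    rcases h i k hi hik hb with h1 | h1
    · omega
    · exact Or.inr ⟨h1.1, zero⟩
  · exact absurd hb.symm (h' k i hk hi)
  · rw [param_gt hi, param_eq hk]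
    rcases h k i hk hik.symm hb.symm with h1 | h1
    · omega
    · exact Or.inr ⟨zero, h1.1⟩
  · rw [param_gt hi, param_gt hk]; exact Or.inr ⟨zero, zero⟩

theorem isBlockwiseInt_of_mem (hb : b ∈ parameters j) : IsBlockwiseInt j b := by
  have hj := j.isLt
  have hneg : ∀ m : ℕ, IsNegInt (-1 - m) := fun m => isNegInt_reflect.2 ⟨m, rfl⟩
  have ne : ∀ {i k : Fin (n + 1)}, i ≠ k → i.val ≠ k.val := fun h h' => h (Fin.ext h')
  rcases hb with ⟨h0, ⟨a, ha, rfl⟩ | ⟨m, rfl⟩⟩ | ⟨h0, ⟨a, ha, rfl⟩ | ⟨m, rfl⟩⟩ |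
    ⟨h0, h1, m, rfl | rfl⟩ <;>
  refine isBlockwiseInt_param (fun i k hi hik h => ?_) fun i k hi hk h => ?_ <;>
  rw [blk_eq_iff] at h
  · have := ne hik; omega
  · omega
  · exact Or.inr ⟨⟨m, rfl⟩, by have := ne hik; omega⟩
  · omega
  · have := ne hik; omega
  · omega
  · exact Or.inl ⟨hneg m, by have := ne hik; omega⟩
  · omega
  · exact Or.inr ⟨⟨m, rfl⟩, by have := ne hik; omega⟩
  · omega
  · exact Or.inl ⟨hneg m, by have := ne hik; omega⟩
  · omega

/-- The last and the first coordinate can move apart indefinitely. Where one of them is the free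
parameter `a`, the condition on `a` in the list is exactly what is needed. -/
theorem exists_unbounded (hn : 2 ≤ n) (hb : b ∈ parameters j) :
    ∃ i k, i ≠ k ∧ ¬ IsNegInt (b i) ∧ ∀ m : ℕ, b k ≠ m := by
  have hj := j.isLt
  have hne : (Fin.last n) ≠ 0 := fun h => by
    have := congrArg Fin.val h
    simp at this
    omega
  have neg : ∀ m : ℕ, (-1 : ℂ) ≠ m := fun m h => not_isNegInt_nat m (h ▸ ⟨0, by simp⟩)
  have zero : ¬ IsNegInt (0 : ℂ) := by simpa using not_isNegInt_nat 0
  have v0 : (0 : Fin (n + 1)).val = 0 := rfl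
  have vn : (Fin.last n).val = n := rfl
  refine ⟨Fin.last n, 0, hne, ?_⟩
  rcases hb with ⟨h0, ⟨a, ha, rfl⟩ | ⟨m, rfl⟩⟩ | ⟨h0, ⟨a, ha, rfl⟩ | ⟨m, rfl⟩⟩ |
    ⟨h0, h1, m, rfl | rfl⟩
  · rw [param_gt (by omega), param_eq v0]; exact ⟨zero, ha⟩
  · rw [param_gt (by omega), param_lt (by omega)]; exact ⟨zero, neg⟩
  · rw [param_eq vn, param_lt (by omega)]; exact ⟨ha, neg⟩
  all_goals rw [param_gt (by omega), param_lt (by omega)]; exact ⟨zero, neg⟩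

theorem IsBlockwiseInt.reflect (hb : IsBlockwiseInt j b) : IsBlockwiseInt j (reflect b) := by
  intro i k hik h
  have key : ∀ z : ℂ, IsNegInt z → ∃ m : ℕ, -1 - z = m :=
    fun z ⟨m, hm⟩ => ⟨m, by rw [hm]; ring⟩
  rcases hb i k hik h with h1 | h1
  · exact Or.inr ⟨key _ h1.1, key _ h1.2⟩
  · exact Or.inl ⟨isNegInt_reflect.2 h1.1, isNegInt_reflect.2 h1.2⟩

end Parameters

section Modules

variable {V : Type*} [AddCommGroup V] [Module ℂ V] [LieRingModule (sl n) V] [LieModule ℂ (sl n) V]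
  {j : Fin n} {b : Fin (n + 1) → ℂ} {B : Module.Basis (exponents b) ℂ V}

theorem IsMonomialBasis.isSimpleFiniteTypeDegreeOne (hB : IsMonomialBasis b B)
    (hb : IsBlockwiseInt j b) {i k : Fin (n + 1)} (hik : i ≠ k) (hi : ¬ IsNegInt (b i))
    (hk : ∀ m : ℕ, b k ≠ m) : IsSimpleFiniteTypeDegreeOne V j where
  simple := hB.isIrreducible
  infiniteDimensional := not_finiteDimensional B hi hk hik
  finiteType := hB.isFiniteType hb
  weightModule := hB.isWeightModule
  degree_eq_one := hB.degree_eq_one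

theorem IsMonomialBasis.simpleDegreeOne (hB : IsMonomialBasis b B) : SimpleDegreeOne (eAct n V) :=
  simpleDegreeOne_eAct hB.isIrreducible hB.isWeightModule hB.degree_eq_one

/-- The root vectors of the Levi subalgebra are locally nilpotent on modules of finite type. -/
theorem locNil_of_isFiniteType (h : SimpleDegreeOne (eAct n V)) (hf : IsFiniteType V (levi j))
    {i k : Fin (n + 1)} (hik : i ≠ k) (hb : blk j i = blk j k) : LocNil (eAct n V i k) := by
  classical
  obtain ⟨S, hS, hfd, -⟩ := hf
  obtain ⟨μ, v, hv0, hv⟩ := h.exists_occurs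
  refine (h.locNil_or_injective hik).resolve_right fun hinj => ?_
  have hv' : v ∈ ⨆ W : S, W.val.toSubmodule := hS.submodule_iSup_eq_top ▸ Submodule.mem_top
  obtain ⟨s, hs⟩ := Submodule.mem_iSup_iff_exists_finset.1 hv'
  set U : Submodule ℂ V := ⨆ W ∈ s, W.val.toSubmodule
  have hU : ∀ u ∈ U, eAct n V i k u ∈ U := by
    have hle : U ≤ U.comap (eAct n V i k) := by
      refine iSup₂_le fun W hW u hu => ?_
      have h1 : eAct n V i k u ∈ W.val :=
        W.val.lie_mem (x := (⟨unit i k, unit_mem_levi j hb⟩ : levi j)) hu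
      exact Submodule.mem_iSup_of_mem W (Submodule.mem_iSup_of_mem hW h1)
    exact hle
  have hUfd : FiniteDimensional ℂ U := by
    have : ∀ W : S, FiniteDimensional ℂ W.val.toSubmodule := fun W => (hfd W W.2).2
    have h1 := Submodule.finiteDimensional_finset_sup s fun W : S => W.val.toSubmodule
    rwa [Finset.sup_eq_iSup] at h1
  have hmem : ∀ m : ℕ, (eAct n V i k ^ m) v ∈ U := by
    intro m
    induction m with
    | zero => exact hs
    | succ m ih => rw [pow_succ', Module.End.mul_apply]; exact hU _ ih
  have hne : ∀ m : ℕ, (eAct n V i k ^ m) v ≠ 0 := by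
    intro m
    induction m with
    | zero => exact hv0
    | succ m ih => rw [pow_succ', Module.End.mul_apply]; exact fun h0 => ih (hinj _ h0)
  -- If `e i k` were injective, its powers would give infinitely many nonzero vectors of distinct
  -- weights in the finite-dimensional space `U`.
  have hli : LinearIndependent ℂ fun m : ℕ => (eAct n V i k ^ m) v := by
    refine Module.End.eigenvectors_linearIndependent' (eAct n V i i) (fun m : ℕ => μ i + m)
      (fun m m' h => by simpa using h) _ fun m => ⟨?_, hne m⟩
    rw [Module.End.mem_eigenspace_iff, h.isGl.isWt_pow hv i k m i]
    simp [root, hik]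
  have hli' : LinearIndependent ℂ fun m : ℕ => (⟨_, hmem m⟩ : U) :=
    LinearIndependent.of_comp U.subtype hli
  exact not_finite_iff_infinite.2 inferInstance hli'.finite

/-- The identity matrix projects to zero in `sl(n+1)`. This fixes the constant `t` by which a
highest weight differs from its parameter. -/
theorem sum_eq_zero_of_isWt {μ : Fin (n + 1) → ℂ} {v : V} (hv : IsWt (eAct n V) μ v)
    (h0 : v ≠ 0) : ∑ i, μ i = 0 := by
  have h1 := hv.sum_apply
  have h2 : (∑ i, eAct n V i i) v = 0 := by
    simp only [LinearMap.sum_apply, eAct_apply, ← sum_lie]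
    have : ∑ i : Fin (n + 1), unit i i = 0 := by
      simp only [unit, ← map_sum, Matrix.sum_single_one]
      apply Subtype.ext
      rw [slProj_val, Matrix.trace_one]
      have : (n + 1 : ℂ) ≠ 0 := by exact_mod_cast Nat.succ_ne_zero n
      simp [this]
    rw [this, zero_lie]
  rw [h2, eq_comm, smul_eq_zero] at h1
  exact h1.resolve_right h0

/-- A simple module of degree one with a highest weight vector of suitable weight is `N(b)`. -/
theorem exists_isMonomialBasis (h : SimpleDegreeOne (eAct n V)) {j : Fin n}
    (hb : b ∈ parameters j) (σ : Equiv.Perm (Fin (n + 1))) {μ : Fin (n + 1) → ℂ} {v : V} {t : ℂ}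
    (hv : IsHighest (fun i k => eAct n V (σ i) (σ k)) μ v) (hμ : ∀ i, μ i = b i + t) :
    ∃ B : Module.Basis (exponents (b ∘ σ.symm)) ℂ V, IsMonomialBasis (b ∘ σ.symm) B := by
  have hN := isMonomialBasis_monBasis (b ∘ σ.symm)
  obtain ⟨r, z, hrz⟩ := exists_param_of_mem hb
  have hx := hN.isHighest σ fun i k hik => by
    simp only [Function.comp_apply, Equiv.symm_apply_apply, hrz]
    exact param_eq_zero_or hik
  have hsum : ∑ i, μ i = 0 := by
    have h1 : IsWt (eAct n V) (μ ∘ σ.symm) v := fun i => by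
      simpa using hv.isWt (σ.symm i)
    have h2 := sum_eq_zero_of_isWt h1 hv.ne_zero
    rwa [← Equiv.sum_comp σ.symm μ]
  have hwt : monWeight (b ∘ σ.symm) (b ∘ σ.symm) ∘ σ = μ := by
    have hn1 : (n + 1 : ℂ) ≠ 0 := by exact_mod_cast Nat.succ_ne_zero n
    have h1 : ∑ i, (b ∘ σ.symm) i = ∑ i, b i := Equiv.sum_comp σ.symm b
    simp only [hμ, Finset.sum_add_distrib] at hsum
    simp at hsum
    ext i
    simp only [Function.comp_apply, monWeight, Equiv.symm_apply_apply, hμ] at h1 ⊢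
    rw [h1]
    field_simp
    linear_combination -hsum
  rw [hwt] at hx
  obtain ⟨f, hf⟩ := (hN.simpleDegreeOne.twist σ).exists_equiv (h.twist σ) hx hv
  exact ⟨_, hN.map f fun i k u => by simpa using hf (σ.symm i) (σ.symm k) u⟩

end Modules

section Abstract

variable {V : Type*} [AddCommGroup V] [Module ℂ V]
  {e : Fin (n + 1) → Fin (n + 1) → Module.End ℂ V}

theorem SimpleDegreeOne.exists_isHighest_parameter (h : SimpleDegreeOne e) (hn : 2 ≤ n) (J : Fin n)
    (hL : ∀ i k, i ≠ k → (i.val ≤ J.val ↔ k.val ≤ J.val) → LocNil (e i k))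
    (hu : ∀ i k, i.val ≤ J.val → ¬ k.val ≤ J.val → LocNil (e i k))
    (hinf : ¬ FiniteDimensional ℂ V) :
    ∃ b ∈ parameters J, ∃ μ v t, IsHighest e μ v ∧ ∀ i, μ i = b i + t := by
  obtain ⟨μ, v, hv⟩ := h.exists_isHighest fun i k hik => by
    have hik' : i.val < k.val := hik
    by_cases hb : (i.val ≤ J.val ↔ k.val ≤ J.val)
    · exact hL i k hik.ne hb
    · exact hu i k (by omega) (by omega)
  -- Local nilpotence of this one lowering operator would spread to the whole opposite nilradical
  -- and make the module finite-dimensional.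
  have hinj : ∀ w, e J.succ J.castSucc w = 0 → w = 0 := by
    refine (h.locNil_or_injective (Fin.castSucc_lt_succ (i := J)).ne').resolve_left fun hl => ?_
    refine hinf (h.finiteDimensional fun i k hik => ?_)
    by_cases hb : (i.val ≤ J.val ↔ k.val ≤ J.val)
    · exact hL i k hik hb
    · by_cases hi : i.val ≤ J.val
      · exact hu i k hi (by tauto)
      · refine h.locNil_spread (fun i => i.val ≤ J.val) hL ?_ ?_ ?_ hl
        · simp
        · simp; omega
        · simp; omega
  obtain ⟨b, hb, t, ht⟩ := h.exists_parameter hn J hL hinj hv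
  exact ⟨b, hb, μ, v, t, hv, ht⟩

end Abstract

end Main

end SlDegreeOne

open SlDegreeOne

theorem mainTheorem6 (n : ℕ) (hn : 2 ≤ n) (j : Fin n) :
    (∀ (V : Type*) [AddCommGroup V] [Module ℂ V] [LieRingModule (sl n) V] [LieModule ℂ (sl n) V],
      IsSimpleFiniteTypeDegreeOne V j → ∃ b ∈ parameters j, IsNUpToContragredient V b) ∧
    (∀ b ∈ parameters j,
      IsSimpleFiniteTypeDegreeOne (moduleN b) j ∧
      IsSimpleFiniteTypeDegreeOne (contragredient n (moduleN b)) j) := by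
  refine ⟨fun V _ _ _ _ hV => ?_, fun b hb => ?_⟩
  · have h := simpleDegreeOne_eAct hV.simple hV.weightModule hV.degree_eq_one
    have hL : ∀ i k, i ≠ k → (i.val ≤ j.val ↔ k.val ≤ j.val) → LocNil (eAct n V i k) :=
      fun i k hik hb => locNil_of_isFiniteType h hV.finiteType hik (blk_eq_iff.2 hb)
    have hj := j.isLt
    -- With at least three indices, one of the two blocks contains two of them.
    obtain ⟨i₀, i₁, k₀, h01, hi, hk⟩ : ∃ i₀ i₁ k₀ : Fin (n + 1), i₀ ≠ i₁ ∧
        (i₀.val ≤ j.val ↔ i₁.val ≤ j.val) ∧ ¬ (i₀.val ≤ j.val ↔ k₀.val ≤ j.val) := by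
      by_cases h0 : j.val = 0
      · refine ⟨⟨1, by omega⟩, ⟨2, by omega⟩, ⟨0, by omega⟩, by simp, ?_, ?_⟩ <;> simp [h0]
      · refine ⟨⟨0, by omega⟩, ⟨1, by omega⟩, ⟨n, by omega⟩, by simp, by simp; omega, by simp⟩
    rcases h.locNil_dichotomy (fun i => i.val ≤ j.val) hL h01 hi hk with hu | hu
    · obtain ⟨b, hb, μ, v, t, hv, hμ⟩ :=
        h.exists_isHighest_parameter hn j hL hu hV.infiniteDimensional
      obtain ⟨B, hB⟩ := exists_isMonomialBasis h hb (Equiv.refl _) hv hμ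
      exact ⟨b, hb, Or.inl (hB.nonempty_equiv (isMonomialBasis_monBasis b))⟩
    · have hr : j.rev.val = n - (j.val + 1) := Fin.val_rev j
      have hrev : ∀ i : Fin (n + 1), (Fin.revPerm i).val = n - i.val := fun i => by
        rw [Fin.revPerm_apply, Fin.val_rev]; omega
      -- Reversal turns the blocks of `j` into those of `j.rev` and the nilpotent lower nilradical
      -- into the upper one. It identifies `V` with `N(b ∘ rev)`, and passing to the contragredient
      -- brings the parameter back to the list for `j`.
      obtain ⟨b, hb, μ, v, t, hv, hμ⟩ := (h.twist Fin.revPerm).exists_isHighest_parameter hn j.rev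
        (fun i k hik hb => hL _ _ (Fin.revPerm.injective.ne hik) (by
          rw [hrev, hrev]; omega))
        (fun i k hi hk => hu _ _ (by rw [hrev]; omega) (by rw [hrev]; omega))
        hV.infiniteDimensional
      obtain ⟨B, hB⟩ := exists_isMonomialBasis h hb Fin.revPerm hv hμ
      have hb' := reflect_rev_mem_parameters hn hb
      rw [Fin.rev_rev] at hb'
      exact ⟨_, hb', Or.inr ((isMonomialBasis_dualBasis hB).nonempty_equiv
        (isMonomialBasis_monBasis _))⟩
  · have hB := isMonomialBasis_monBasis b
    have hint := isBlockwiseInt_of_mem hb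
    obtain ⟨i, k, hik, hi, hk⟩ := exists_unbounded hn hb
    refine ⟨hB.isSimpleFiniteTypeDegreeOne hint hik hi hk,
      (isMonomialBasis_dualBasis hB).isSimpleFiniteTypeDegreeOne hint.reflect hik.symm ?_ ?_⟩
    · exact fun h => (isNegInt_reflect.1 h).elim hk
    · intro m hm
      simp only [reflect] at hm
      exact hi ⟨m, by linear_combination -hm⟩
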